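/- **Proposition.** Let $k$ be a field, let $H_1,H_2$ be finite-dimensional Hopf algebras over $k$, and let $\mathfrak B$ be a finite-dimensional $H_1|H_2$-bicomodule algebra, that is, a $k$-algebra with a left $H_1$-coaction and a right $H_2$-coaction which commute and are homomorphisms of algebras; equivalently, with a bicomodule structure $\beta:\mathfrak B\to H_1\otimes\mathfrak B\otimes H_2$, $\beta(b)=\sum b^{[-1]}\otimes b^{[0]}\otimes b^{[1]}$, that is a homomorphism of algebras. All modules below are finite-dimensional over $k$. Let ${}_{\mathfrak B}\mathsf{Mod}$ be the category of left $\mathfrak B$-modules. It is a $\mathsf{Rep}(H_1)|\mathsf{Rep}(H_2)$-bimodule category: for $X_i\in\mathsf{Rep}(H_i)$ and $M\in{}_{\mathfrak B}\mathsf{Mod}$, $\mathfrak B$ acts on $X_1\otimes M\otimes X_2$ by $b\cdot(x_1\otimes m\otimes x_2)=\sum b^{[-1]}x_1\otimes b^{[0]}m\otimes b^{[1]}x_2$. Let $H_2^{\rm cop}$ be $H_2$ with the opposite comultiplication. Then $\mathfrak B$ is also a left $H_1\otimes H_2^{\rm cop}$-comodule algebra, with coaction $b\mapsto\sum (b^{[-1]}\otimes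 b^{[1]})\otimes b^{[0]}$, so that $\mathsf{Rep}(H_1\otimes H_2^{\rm cop})$ acts on ${}_{\mathfrak B}\mathsf{Mod}$: on $X\otimes M$, $b$ acts by $\sum (b^{[-1]}\otimes b^{[1]})\otimes b^{[0]}$. Module functors and bimodule functors are understood to be $k$-linear and right exact, with invertible structure maps, and their morphisms are the natural transformations that commute with the structure maps. The following categories, each of which describes the topological excitations of the gapped domain wall given by $\mathfrak B$, are equivalent as $k$-linear categories: 1. the category $\mathsf{Fun}_{\mathsf{Rep}(H_1)|\mathsf{Rep}(H_2)}({}_{\mathfrak B}\mathsf{Mod},{}_{\mathfrak B}\mathsf{Mod})$ of $\mathsf{Rep}(H_1)|\mathsf{Rep}(H_2)$-bimodule functors; 2. the category $\mathsf{Fun}_{\mathsf{Rep}(H_1\otimes H_2^{\rm cop})}({}_{\mathfrak B}\mathsf{Mod},{}_{\mathfrak B}\mathsf{Mod})$ of $\mathsf{Rep}(H_1\otimes H_2^{\rm cop})$-module functors; 3. the category of $H_1\otimes H_2^{\rm cop}$-covariant $\mathfrak B|\mathfrak B$-bimodules, that is, of $\mathfrak B|\mathfrak B$-bimodules $Y$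 with a left $H_1\otimes H_2^{\rm cop}$-coaction $Y\to (H_1\otimes H_2^{\rm cop})\otimes Y$ which is a morphism of $\mathfrak B|\mathfrak B$-bimodules, where, in Sweedler notation $a\mapsto \sum a^{\langle -1\rangle}\otimes a^{\langle 0\rangle}$ for the coaction of $H_1\otimes H_2^{\rm cop}$ on $\mathfrak B$, one puts $a\cdot(h\otimes y)\cdot b=\sum a^{\langle -1\rangle}hb^{\langle -1\rangle}\otimes a^{\langle 0\rangle}yb^{\langle 0\rangle}$. More precisely, there are a $k$-linear equivalence from (1) to (2) that preserves the underlying functor up to natural isomorphism, and a $k$-linear equivalence from (2) to (3) that sends a module functor $F$ to a bimodule whose underlying left $\mathfrak B$-module is naturally isomorphic to $F(\mathfrak B)$. Finally, if $\mathfrak B$ is semisimple, then every additive functor from ${}_{\mathfrak B}\mathsf{Mod}$ to itself is right exact, so that the exactness condition in (1) and (2) may be omitted. -/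

import Mathlib

open CategoryTheory MonoidalCategory
open scoped TensorProduct

universe u

noncomputable section

namespace HopfWall

section Tensor

variable {k : Type u} [Field k]
variable {A A' A'' : Type u} [Ring A] [Algebra k A] [Ring A'] [Algebra k A'] [Ring A'']
  [Algebra k A'']
variable {V W U V' W' : Type u} [AddCommGroup V] [Module k V] [AddCommGroup W] [Module k W]
  [AddCommGroup U] [Module k U] [AddCommGroup V'] [Module k V'] [AddCommGroup W'] [Module k W']

/-- If `A` acts on `V` and `A'` acts on `W`, then `A ⊗ A'` acts on `V ⊗ W`, factorwise. -/
def tensorAct (f : A →ₐ[k] Module.End k V) (g : A' →ₐ[k] Module.End k W) :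
    A ⊗[k] A' →ₐ[k] Module.End k (V ⊗[k] W) :=
  Module.endTensorEndAlgHom.comp (Algebra.TensorProduct.map f g)

@[simp]
theorem tensorAct_tmul (f : A →ₐ[k] Module.End k V) (g : A' →ₐ[k] Module.End k W) (a : A) (b : A') :
    tensorAct f g (a ⊗ₜ b) = TensorProduct.map (f a) (g b) := rfl

theorem tensorAct_map (f : A →ₐ[k] Module.End k V) (g : A' →ₐ[k] Module.End k W)
    (f' : A →ₐ[k] Module.End k V') (g' : A' →ₐ[k] Module.End k W')
    (s : V →ₗ[k] V') (t : W →ₗ[k] W')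
    (hs : ∀ a, s ∘ₗ f a = f' a ∘ₗ s) (ht : ∀ a, t ∘ₗ g a = g' a ∘ₗ t) (x : A ⊗[k] A') :
    TensorProduct.map s t ∘ₗ tensorAct f g x = tensorAct f' g' x ∘ₗ TensorProduct.map s t := by
  induction x using TensorProduct.induction_on with
  | zero => simp
  | add x y hx hy => rw [map_add, map_add, LinearMap.comp_add, LinearMap.add_comp, hx, hy]
  | tmul a b =>
    rw [tensorAct_tmul, tensorAct_tmul, ← TensorProduct.map_comp, ← TensorProduct.map_comp, hs, ht]

theorem tensorAct_assoc (f : A →ₐ[k] Module.End k V) (g : A' →ₐ[k] Module.End k W)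
    (h : A'' →ₐ[k] Module.End k U) (x : (A ⊗[k] A') ⊗[k] A'') :
    (TensorProduct.assoc k V W U).toLinearMap ∘ₗ tensorAct (tensorAct f g) h x =
      tensorAct f (tensorAct g h) (TensorProduct.assoc k A A' A'' x) ∘ₗ
        (TensorProduct.assoc k V W U).toLinearMap := by
  induction x using TensorProduct.induction_on with
  | zero => simp
  | add x y hx hy =>
    rw [map_add, map_add, map_add, LinearMap.comp_add, LinearMap.add_comp, hx, hy]
  | tmul x c =>
    induction x using TensorProduct.induction_on with
    | zero => simp
    | add x y hx hy =>
      rw [TensorProduct.add_tmul, map_add, map_add, map_add, LinearMap.comp_add,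
        LinearMap.add_comp, hx, hy]
    | tmul a b =>
      refine TensorProduct.ext_threefold fun v w u => ?_
      simp

theorem ext_fourfold_right {f g : V ⊗[k] ((W ⊗[k] U) ⊗[k] V') →ₗ[k] W'}
    (h : ∀ v w u v', f (v ⊗ₜ ((w ⊗ₜ u) ⊗ₜ v')) = g (v ⊗ₜ ((w ⊗ₜ u) ⊗ₜ v'))) : f = g := by
  ext v w u v'
  exact h v w u v'

theorem tensorAct_comp_left (φ : A →ₐ[k] A') (f : A' →ₐ[k] Module.End k V)
    (g : A'' →ₐ[k] Module.End k W) (x : A ⊗[k] A'') :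
    tensorAct (f.comp φ) g x = tensorAct f g (φ.toLinearMap.rTensor A'' x) := by
  induction x using TensorProduct.induction_on with
  | zero => simp
  | add x y hx hy => rw [map_add, map_add, map_add, hx, hy]
  | tmul a b => rfl

theorem tensorAct_comp_right (φ : A →ₐ[k] A') (f : A'' →ₐ[k] Module.End k V)
    (g : A' →ₐ[k] Module.End k W) (x : A'' ⊗[k] A) :
    tensorAct f (g.comp φ) x = tensorAct f g (φ.toLinearMap.lTensor A'' x) := by
  induction x using TensorProduct.induction_on with
  | zero => simp
  | add x y hx hy => rw [map_add, map_add, map_add, hx, hy]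
  | tmul a b => rfl

end Tensor

/-! ### Finite-dimensional modules -/

/-- A finite-dimensional left module over the `k`-algebra `A`: a finite-dimensional `k`-vector
space together with a homomorphism of `k`-algebras from `A` to its endomorphisms. -/
structure FDMod (k : Type u) [Field k] (A : Type u) [Ring A] [Algebra k A] : Type (u + 1) where
  carrier : Type u
  [addCommGroup : AddCommGroup carrier]
  [module : Module k carrier]
  [finite : FiniteDimensional k carrier]
  act : A →ₐ[k] Module.End k carrier

attribute [instance] FDMod.addCommGroup FDMod.module FDMod.finite

namespace FDMod

variable {k : Type u} [Field k] {A : Type u} [Ring A] [Algebra k A]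

/-- The space of `A`-linear maps. -/
def homs (X Y : FDMod k A) : Submodule k (X.carrier →ₗ[k] Y.carrier) where
  carrier := {f | ∀ a, f ∘ₗ X.act a = Y.act a ∘ₗ f}
  zero_mem' a := by simp
  add_mem' hf hg a := by rw [LinearMap.add_comp, LinearMap.comp_add, hf a, hg a]
  smul_mem' c f hf a := by rw [LinearMap.smul_comp, LinearMap.comp_smul, hf a]

instance : Category (FDMod k A) where
  Hom X Y := homs X Y
  id X := ⟨LinearMap.id, fun _ => rfl⟩
  comp f g := ⟨g.1 ∘ₗ f.1, fun a => by
    rw [LinearMap.comp_assoc, f.2 a, ← LinearMap.comp_assoc, g.2 a, LinearMap.comp_assoc]⟩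

/-- The linear map underlying a morphism of modules. -/
def lin {X Y : FDMod k A} (f : X ⟶ Y) : X.carrier →ₗ[k] Y.carrier := f.1

/-- A morphism of modules from an `A`-linear map. -/
def mkHom {X Y : FDMod k A} (f : X.carrier →ₗ[k] Y.carrier)
    (hf : ∀ a, f ∘ₗ X.act a = Y.act a ∘ₗ f) : X ⟶ Y := ⟨f, hf⟩

theorem lin_comm {X Y : FDMod k A} (f : X ⟶ Y) (a : A) :
    lin f ∘ₗ X.act a = Y.act a ∘ₗ lin f := f.2 a

@[ext]
theorem hom_ext {X Y : FDMod k A} {f g : X ⟶ Y} (h : lin f = lin g) : f = g := Subtype.ext h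

@[simp]
theorem lin_mkHom {X Y : FDMod k A} (f : X.carrier →ₗ[k] Y.carrier)
    (hf : ∀ a, f ∘ₗ X.act a = Y.act a ∘ₗ f) : lin (mkHom f hf) = f := rfl

@[simp]
theorem lin_id (X : FDMod k A) : lin (𝟙 X) = LinearMap.id := rfl

@[simp]
theorem lin_comp {X Y Z : FDMod k A} (f : X ⟶ Y) (g : Y ⟶ Z) : lin (f ≫ g) = lin g ∘ₗ lin f := rfl

instance : Preadditive (FDMod k A) where
  homGroup X Y := inferInstanceAs (AddCommGroup (homs X Y))
  add_comp _ _ _ _ _ _ := Subtype.ext (LinearMap.comp_add _ _ _)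
  comp_add _ _ _ _ _ _ := Subtype.ext (LinearMap.add_comp _ _ _)

instance : Linear k (FDMod k A) where
  homModule X Y := inferInstanceAs (Module k (homs X Y))
  smul_comp _ _ _ _ _ _ := Subtype.ext (LinearMap.comp_smul _ _ _)
  comp_smul _ _ _ _ _ _ := Subtype.ext (LinearMap.smul_comp _ _ _)

/-- An isomorphism of modules from an `A`-linear equivalence. -/
def mkIso {X Y : FDMod k A} (e : X.carrier ≃ₗ[k] Y.carrier)
    (he : ∀ a, e.toLinearMap ∘ₗ X.act a = Y.act a ∘ₗ e.toLinearMap) : X ≅ Y where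
  hom := mkHom e.toLinearMap he
  inv := mkHom e.symm.toLinearMap fun a => by
    ext y
    have := LinearMap.congr_fun (he a) (e.symm y)
    simp only [LinearMap.comp_apply, LinearEquiv.coe_coe, LinearEquiv.apply_symm_apply] at this ⊢
    rw [← this, LinearEquiv.symm_apply_apply]
  hom_inv_id := by ext; simp
  inv_hom_id := by ext; simp

@[simp]
theorem lin_mkIso_hom {X Y : FDMod k A} (e : X.carrier ≃ₗ[k] Y.carrier)
    (he : ∀ a, e.toLinearMap ∘ₗ X.act a = Y.act a ∘ₗ e.toLinearMap) :
    lin (mkIso e he).hom = e.toLinearMap := rfl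

@[simp]
theorem lin_mkIso_inv {X Y : FDMod k A} (e : X.carrier ≃ₗ[k] Y.carrier)
    (he : ∀ a, e.toLinearMap ∘ₗ X.act a = Y.act a ∘ₗ e.toLinearMap) :
    lin (mkIso e he).inv = e.symm.toLinearMap := rfl

variable (k A) in
/-- The left regular module. -/
def regular [FiniteDimensional k A] : FDMod k A where
  carrier := A
  act := Algebra.lmul k A

/-- A functor between categories of modules is right exact if it sends every exact sequence
`X ⟶ Y ⟶ Z ⟶ 0` to an exact sequence. -/
def RightExact {A' : Type u} [Ring A'] [Algebra k A'] (F : FDMod k A ⥤ FDMod k A') : Prop :=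
  ∀ ⦃X Y Z : FDMod k A⦄ (f : X ⟶ Y) (g : Y ⟶ Z),
    Function.Exact (lin f) (lin g) → Function.Surjective (lin g) →
      Function.Exact (lin (F.map f)) (lin (F.map g)) ∧ Function.Surjective (lin (F.map g))

/-- The tensor product of an `A`-module and an `A'`-module, made into an `A''`-module through a
homomorphism `A'' → A ⊗ A'`. -/
def tensor {A' A'' : Type u} [Ring A'] [Algebra k A'] [Ring A''] [Algebra k A'']
    (φ : A'' →ₐ[k] A ⊗[k] A') (X : FDMod k A) (Y : FDMod k A') : FDMod k A'' where
  carrier := X.carrier ⊗[k] Y.carrier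
  act := (tensorAct X.act Y.act).comp φ

/-- The tensor product of two morphisms. -/
def tensorMap {A' A'' : Type u} [Ring A'] [Algebra k A'] [Ring A''] [Algebra k A'']
    (φ : A'' →ₐ[k] A ⊗[k] A') {X X' : FDMod k A} {Y Y' : FDMod k A'} (f : X ⟶ X') (g : Y ⟶ Y') :
    tensor φ X Y ⟶ tensor φ X' Y' :=
  mkHom (TensorProduct.map (lin f) (lin g)) fun a =>
    tensorAct_map _ _ _ _ _ _ (lin_comm f) (lin_comm g) (φ a)

@[simp]
theorem lin_tensorMap {A' A'' : Type u} [Ring A'] [Algebra k A'] [Ring A''] [Algebra k A'']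
    (φ : A'' →ₐ[k] A ⊗[k] A') {X X' : FDMod k A} {Y Y' : FDMod k A'} (f : X ⟶ X') (g : Y ⟶ Y') :
    lin (tensorMap φ f g) = TensorProduct.map (lin f) (lin g) := rfl

section Assoc

variable {A₁ A₂ A₃ C D E : Type u} [Ring A₁] [Algebra k A₁] [Ring A₂] [Algebra k A₂]
  [Ring A₃] [Algebra k A₃] [Ring C] [Algebra k C] [Ring D] [Algebra k D] [Ring E] [Algebra k E]

/-- The associativity isomorphism `(X ⊗ Y) ⊗ Z ≅ X ⊗ (Y ⊗ Z)`, `(x ⊗ y) ⊗ z ↦ x ⊗ (y ⊗ z)`, for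
homomorphisms that satisfy the corresponding coassociativity law. -/
def tensorAssoc (φ : C →ₐ[k] D ⊗[k] A₃) (ψ : D →ₐ[k] A₁ ⊗[k] A₂)
    (φ' : C →ₐ[k] A₁ ⊗[k] E) (ψ' : E →ₐ[k] A₂ ⊗[k] A₃)
    (h : ∀ c, TensorProduct.assoc k A₁ A₂ A₃ (ψ.toLinearMap.rTensor A₃ (φ c)) =
      ψ'.toLinearMap.lTensor A₁ (φ' c))
    (X : FDMod k A₁) (Y : FDMod k A₂) (Z : FDMod k A₃) :
    tensor φ (tensor ψ X Y) Z ≅ tensor φ' X (tensor ψ' Y Z) :=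
  mkIso (TensorProduct.assoc k X.carrier Y.carrier Z.carrier) fun c => by
    change _ ∘ₗ tensorAct ((tensorAct X.act Y.act).comp ψ) Z.act (φ c) =
      tensorAct X.act ((tensorAct Y.act Z.act).comp ψ') (φ' c) ∘ₗ _
    rw [tensorAct_comp_left, tensorAct_comp_right, tensorAct_assoc, h]

@[simp]
theorem lin_tensorAssoc_hom (φ : C →ₐ[k] D ⊗[k] A₃) (ψ : D →ₐ[k] A₁ ⊗[k] A₂)
    (φ' : C →ₐ[k] A₁ ⊗[k] E) (ψ' : E →ₐ[k] A₂ ⊗[k] A₃)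
    (h : ∀ c, TensorProduct.assoc k A₁ A₂ A₃ (ψ.toLinearMap.rTensor A₃ (φ c)) =
      ψ'.toLinearMap.lTensor A₁ (φ' c))
    (X : FDMod k A₁) (Y : FDMod k A₂) (Z : FDMod k A₃) :
    lin (tensorAssoc φ ψ φ' ψ' h X Y Z).hom =
      (TensorProduct.assoc k X.carrier Y.carrier Z.carrier).toLinearMap := rfl

@[simp]
theorem lin_tensorAssoc_inv (φ : C →ₐ[k] D ⊗[k] A₃) (ψ : D →ₐ[k] A₁ ⊗[k] A₂)
    (φ' : C →ₐ[k] A₁ ⊗[k] E) (ψ' : E →ₐ[k] A₂ ⊗[k] A₃)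
    (h : ∀ c, TensorProduct.assoc k A₁ A₂ A₃ (ψ.toLinearMap.rTensor A₃ (φ c)) =
      ψ'.toLinearMap.lTensor A₁ (φ' c))
    (X : FDMod k A₁) (Y : FDMod k A₂) (Z : FDMod k A₃) :
    lin (tensorAssoc φ ψ φ' ψ' h X Y Z).inv =
      (TensorProduct.assoc k X.carrier Y.carrier Z.carrier).symm.toLinearMap := rfl

end Assoc

/-- The one-dimensional module given by a character `e : A → k`. -/
def unit (e : A →ₐ[k] k) : FDMod k A where
  carrier := k
  act := (Algebra.lmul k k).comp e

section Unit

variable {C D : Type u} [Ring C] [Algebra k C] [Ring D] [Algebra k D]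

/-- The unit isomorphism `1 ⊗ X ≅ X`, `c ⊗ x ↦ c x`. -/
def leftUnit (e : A →ₐ[k] k) (φ : C →ₐ[k] A ⊗[k] C)
    (h : ∀ c, e.toLinearMap.rTensor C (φ c) = 1 ⊗ₜ c) (X : FDMod k C) :
    tensor φ (unit e) X ≅ X :=
  mkIso (TensorProduct.lid k X.carrier) fun c => by
    change _ ∘ₗ tensorAct ((Algebra.lmul k k).comp e) X.act (φ c) = _
    rw [tensorAct_comp_left, h]
    ext
    change TensorProduct.lid k X.carrier (_ ⊗ₜ _) = X.act c (TensorProduct.lid k X.carrier (_ ⊗ₜ _))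
    simp

/-- The unit isomorphism `X ⊗ 1 ≅ X`, `x ⊗ c ↦ c x`. -/
def rightUnit (e : A →ₐ[k] k) (φ : C →ₐ[k] C ⊗[k] A)
    (h : ∀ c, e.toLinearMap.lTensor C (φ c) = c ⊗ₜ 1) (X : FDMod k C) :
    tensor φ X (unit e) ≅ X :=
  mkIso (TensorProduct.rid k X.carrier) fun c => by
    change _ ∘ₗ tensorAct X.act ((Algebra.lmul k k).comp e) (φ c) = _
    rw [tensorAct_comp_right, h]
    ext
    change TensorProduct.rid k X.carrier (_ ⊗ₜ _) = X.act c (TensorProduct.rid k X.carrier (_ ⊗ₜ _))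
    simp

@[simp]
theorem lin_leftUnit_hom (e : A →ₐ[k] k) (φ : C →ₐ[k] A ⊗[k] C)
    (h : ∀ c, e.toLinearMap.rTensor C (φ c) = 1 ⊗ₜ c) (X : FDMod k C) :
    lin (leftUnit e φ h X).hom = (TensorProduct.lid k X.carrier).toLinearMap := rfl

@[simp]
theorem lin_rightUnit_hom (e : A →ₐ[k] k) (φ : C →ₐ[k] C ⊗[k] A)
    (h : ∀ c, e.toLinearMap.lTensor C (φ c) = c ⊗ₜ 1) (X : FDMod k C) :
    lin (rightUnit e φ h X).hom = (TensorProduct.rid k X.carrier).toLinearMap := rfl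

end Unit

/-! ### `Rep(H)` as a monoidal category -/

section Rep

variable {H : Type u} [Ring H] [Bialgebra k H]

theorem comul_coassoc (h : H) :
    TensorProduct.assoc k H H H ((Bialgebra.comulAlgHom k H).toLinearMap.rTensor H
      (Bialgebra.comulAlgHom k H h)) =
    (Bialgebra.comulAlgHom k H).toLinearMap.lTensor H (Bialgebra.comulAlgHom k H h) :=
  Coalgebra.coassoc_apply h

theorem counit_left (h : H) : (Bialgebra.counitAlgHom k H).toLinearMap.rTensor H
    (Bialgebra.comulAlgHom k H h) = 1 ⊗ₜ h :=
  Coalgebra.rTensor_counit_comul h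

theorem counit_right (h : H) : (Bialgebra.counitAlgHom k H).toLinearMap.lTensor H
    (Bialgebra.comulAlgHom k H h) = h ⊗ₜ 1 :=
  Coalgebra.lTensor_counit_comul h

/-- The tensor product of representations of `H`: `h` acts on `X ⊗ Y` by `h₍₁₎ ⊗ h₍₂₎`, and on the
unit `k` by the counit. -/
instance : MonoidalCategoryStruct (FDMod k H) where
  tensorObj X Y := tensor (Bialgebra.comulAlgHom k H) X Y
  whiskerLeft X _ _ f := tensorMap (Bialgebra.comulAlgHom k H) (𝟙 X) f
  whiskerRight f Y := tensorMap (Bialgebra.comulAlgHom k H) f (𝟙 Y)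
  tensorHom f g := tensorMap (Bialgebra.comulAlgHom k H) f g
  tensorUnit := unit (Bialgebra.counitAlgHom k H)
  associator X Y Z := tensorAssoc (Bialgebra.comulAlgHom k H) (Bialgebra.comulAlgHom k H)
    (Bialgebra.comulAlgHom k H) (Bialgebra.comulAlgHom k H) comul_coassoc X Y Z
  leftUnitor X := leftUnit (Bialgebra.counitAlgHom k H) (Bialgebra.comulAlgHom k H) counit_left X
  rightUnitor X := rightUnit (Bialgebra.counitAlgHom k H) (Bialgebra.comulAlgHom k H) counit_right X

/-- `Rep(H)` is a monoidal category. -/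
instance : MonoidalCategory (FDMod k H) where
  tensorHom_def _ _ := hom_ext (TensorProduct.ext' fun _ _ => rfl)
  id_tensorHom_id _ _ := hom_ext (TensorProduct.ext' fun _ _ => rfl)
  tensorHom_comp_tensorHom _ _ _ _ := hom_ext (TensorProduct.ext' fun _ _ => rfl)
  whiskerLeft_id _ _ := hom_ext (TensorProduct.ext' fun _ _ => rfl)
  id_whiskerRight _ _ := hom_ext (TensorProduct.ext' fun _ _ => rfl)
  associator_naturality _ _ _ := hom_ext (TensorProduct.ext_threefold fun _ _ _ => rfl)
  leftUnitor_naturality f := hom_ext (TensorProduct.ext' fun c x => ((lin f).map_smul c x).symm)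
  rightUnitor_naturality f := hom_ext (TensorProduct.ext' fun x c => ((lin f).map_smul c x).symm)
  pentagon _ _ _ _ := hom_ext (TensorProduct.ext_fourfold fun _ _ _ _ => rfl)
  triangle _ _ := hom_ext (TensorProduct.ext_threefold fun x c y =>
    (TensorProduct.smul_tmul (show k from c) x y).symm)

end Rep

end FDMod

/-! ### Comodule algebras -/

/-- A left `H`-comodule algebra `A`: the coaction `A → H ⊗ A` is a homomorphism of algebras. -/
class LeftComoduleAlgebra (k : Type u) [Field k] (H A : Type u) [Ring H] [Bialgebra k H]
    [Ring A] [Algebra k A] where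
  coact : A →ₐ[k] H ⊗[k] A
  coassoc (a : A) : TensorProduct.assoc k H H A
      ((Bialgebra.comulAlgHom k H).toLinearMap.rTensor A (coact a)) =
    coact.toLinearMap.lTensor H (coact a)
  counit_coact (a : A) : (Bialgebra.counitAlgHom k H).toLinearMap.rTensor A (coact a) = 1 ⊗ₜ a

/-- A right `H`-comodule algebra `A`: the coaction `A → A ⊗ H` is a homomorphism of algebras. -/
class RightComoduleAlgebra (k : Type u) [Field k] (H A : Type u) [Ring H] [Bialgebra k H]
    [Ring A] [Algebra k A] where
  coact : A →ₐ[k] A ⊗[k] H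
  coassoc (a : A) : TensorProduct.assoc k A H H (coact.toLinearMap.rTensor H (coact a)) =
    (Bialgebra.comulAlgHom k H).toLinearMap.lTensor A (coact a)
  counit_coact (a : A) : (Bialgebra.counitAlgHom k H).toLinearMap.lTensor A (coact a) = a ⊗ₜ 1

/-- An `H₁|H₂`-bicomodule algebra: a left `H₁`- and right `H₂`-comodule algebra whose two coactions
commute. The common value of the two sides of `coact_comm` is the algebra homomorphism
`β : B → H₁ ⊗ B ⊗ H₂`, `b ↦ b⁽⁻¹⁾ ⊗ b⁽⁰⁾ ⊗ b⁽¹⁾`. -/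
class BicomoduleAlgebra (k : Type u) [Field k] (H₁ H₂ B : Type u) [Ring H₁] [Bialgebra k H₁]
    [Ring H₂] [Bialgebra k H₂] [Ring B] [Algebra k B] [LeftComoduleAlgebra k H₁ B]
    [RightComoduleAlgebra k H₂ B] : Prop where
  coact_comm (b : B) : TensorProduct.assoc k H₁ B H₂
      ((LeftComoduleAlgebra.coact (k := k) (H := H₁) (A := B)).toLinearMap.rTensor H₂
        (RightComoduleAlgebra.coact (k := k) (H := H₂) b)) =
    (RightComoduleAlgebra.coact (k := k) (H := H₂) (A := B)).toLinearMap.lTensor H₁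
      (LeftComoduleAlgebra.coact (k := k) (H := H₁) b)

/-! ### The actions of `Rep(H)` on modules over a comodule algebra -/

section Actions

open FDMod

variable {k : Type u} [Field k]

/-- For a left `H`-comodule algebra `A`, the monoidal category `Rep(H)` acts on the left on
`A`-modules: `X ⊙ M` is `X ⊗ M`, on which `a` acts by `a⁽⁻¹⁾ ⊗ a⁽⁰⁾`. -/
instance leftActionStruct {H A : Type u} [Ring H] [Bialgebra k H] [Ring A] [Algebra k A]
    [LeftComoduleAlgebra k H A] : MonoidalLeftActionStruct (FDMod k H) (FDMod k A) where
  actionObj X M := tensor (LeftComoduleAlgebra.coact (k := k) (H := H) (A := A)) X M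
  actionHomLeft f M := tensorMap _ f (𝟙 M)
  actionHomRight X _ _ g := tensorMap _ (𝟙 X) g
  actionHom f g := tensorMap _ f g
  actionAssocIso X Y M := tensorAssoc LeftComoduleAlgebra.coact (Bialgebra.comulAlgHom k H)
    LeftComoduleAlgebra.coact LeftComoduleAlgebra.coact LeftComoduleAlgebra.coassoc X Y M
  actionUnitIso M := leftUnit (Bialgebra.counitAlgHom k H) LeftComoduleAlgebra.coact
    LeftComoduleAlgebra.counit_coact M

instance leftAction {H A : Type u} [Ring H] [Bialgebra k H] [Ring A] [Algebra k A]
    [LeftComoduleAlgebra k H A] : MonoidalLeftAction (FDMod k H) (FDMod k A) where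
  actionHom_def _ _ := hom_ext (TensorProduct.ext' fun _ _ => rfl)
  actionHomRight_id _ _ := hom_ext (TensorProduct.ext' fun _ _ => rfl)
  id_actionHomLeft _ _ := hom_ext (TensorProduct.ext' fun _ _ => rfl)
  actionHom_comp _ _ _ _ := hom_ext (TensorProduct.ext' fun _ _ => rfl)
  actionAssocIso_hom_naturality _ _ _ := hom_ext (TensorProduct.ext_threefold fun _ _ _ => rfl)
  actionUnitIso_hom_naturality f :=
    hom_ext (TensorProduct.ext' fun c x => (lin f).map_smul c x)
  whiskerLeft_actionHomLeft _ _ _ _ _ := hom_ext (TensorProduct.ext_threefold fun _ _ _ => rfl)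
  whiskerRight_actionHomLeft _ _ _ := hom_ext (TensorProduct.ext_threefold fun _ _ _ => rfl)
  associator_actionHom _ _ _ _ := hom_ext (TensorProduct.ext_fourfold fun _ _ _ _ => rfl)
  leftUnitor_actionHom _ _ := hom_ext (TensorProduct.ext_threefold fun c x m =>
    TensorProduct.smul_tmul' (show k from c) x m)
  rightUnitor_actionHom _ _ := hom_ext (TensorProduct.ext_threefold fun x c m =>
    TensorProduct.smul_tmul (show k from c) x m)

/-- For a right `H`-comodule algebra `A`, the monoidal category `Rep(H)` acts on the right on
`A`-modules: `M ⊙ X` is `M ⊗ X`, on which `a` acts by `a⁽⁰⁾ ⊗ a⁽¹⁾`. -/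
instance rightActionStruct {H A : Type u} [Ring H] [Bialgebra k H] [Ring A] [Algebra k A]
    [RightComoduleAlgebra k H A] : MonoidalRightActionStruct (FDMod k H) (FDMod k A) where
  actionObj M X := tensor (RightComoduleAlgebra.coact (k := k) (H := H) (A := A)) M X
  actionHomLeft f X := tensorMap _ f (𝟙 X)
  actionHomRight M _ _ g := tensorMap _ (𝟙 M) g
  actionHom f g := tensorMap _ f g
  actionAssocIso M X Y := (tensorAssoc RightComoduleAlgebra.coact RightComoduleAlgebra.coact
    RightComoduleAlgebra.coact (Bialgebra.comulAlgHom k H) RightComoduleAlgebra.coassoc M X Y).symm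
  actionUnitIso M := rightUnit (Bialgebra.counitAlgHom k H) RightComoduleAlgebra.coact
    RightComoduleAlgebra.counit_coact M

instance rightAction {H A : Type u} [Ring H] [Bialgebra k H] [Ring A] [Algebra k A]
    [RightComoduleAlgebra k H A] : MonoidalRightAction (FDMod k H) (FDMod k A) where
  actionHom_def _ _ := hom_ext (TensorProduct.ext' fun _ _ => rfl)
  actionHomRight_id _ _ := hom_ext (TensorProduct.ext' fun _ _ => rfl)
  id_actionHomLeft _ _ := hom_ext (TensorProduct.ext' fun _ _ => rfl)
  actionHom_comp _ _ _ _ := hom_ext (TensorProduct.ext' fun _ _ => rfl)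
  actionAssocIso_hom_naturality _ _ _ := hom_ext (TensorProduct.ext_threefold' fun _ _ _ => rfl)
  actionUnitIso_hom_naturality f :=
    hom_ext (TensorProduct.ext' fun x c => (lin f).map_smul c x)
  actionHomRight_whiskerRight _ _ _ := hom_ext (TensorProduct.ext_threefold' fun _ _ _ => rfl)
  whiskerRight_actionHomLeft _ _ _ _ _ := hom_ext (TensorProduct.ext_threefold' fun _ _ _ => rfl)
  actionHom_associator _ _ _ _ := hom_ext (ext_fourfold_right fun _ _ _ _ => rfl)
  actionHom_leftUnitor _ _ := hom_ext (TensorProduct.ext_threefold' fun m c x =>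
    (TensorProduct.smul_tmul (show k from c) m x).symm)
  actionHom_rightUnitor _ _ := hom_ext (TensorProduct.ext_threefold' fun m x c =>
    TensorProduct.tmul_smul (show k from c) m x)

/-- The middle associativity isomorphism `(X ⊙ M) ⊙ Y ≅ X ⊙ (M ⊙ Y)`, `(x ⊗ m) ⊗ y ↦ x ⊗ (m ⊗ y)`,
of the `Rep(H₁)|Rep(H₂)`-bimodule category of `B`-modules; on both sides `b` acts by
`b⁽⁻¹⁾ ⊗ b⁽⁰⁾ ⊗ b⁽¹⁾`. -/
def middleAssoc {H₁ H₂ B : Type u} [Ring H₁] [Bialgebra k H₁] [Ring H₂] [Bialgebra k H₂]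
    [Ring B] [Algebra k B] [LeftComoduleAlgebra k H₁ B] [RightComoduleAlgebra k H₂ B]
    [BicomoduleAlgebra k H₁ H₂ B] (X : FDMod k H₁) (M : FDMod k B) (Y : FDMod k H₂) :
    MonoidalRightActionStruct.actionObj (MonoidalLeftActionStruct.actionObj X M) Y ≅
      MonoidalLeftActionStruct.actionObj X (MonoidalRightActionStruct.actionObj M Y) :=
  tensorAssoc RightComoduleAlgebra.coact LeftComoduleAlgebra.coact LeftComoduleAlgebra.coact
    RightComoduleAlgebra.coact BicomoduleAlgebra.coact_comm X M Y

end Actions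

/-! ### Folding -/

/-- The coopposite bialgebra `H^cop`: the algebra `H` with the comultiplication
`h ↦ h₍₂₎ ⊗ h₍₁₎`. -/
def Cop (H : Type u) : Type u := H

section Cop

variable {k : Type u} [Field k] {H : Type u} [Ring H]

instance : Ring (Cop H) := inferInstanceAs (Ring H)

instance [Algebra k H] : Algebra k (Cop H) := inferInstanceAs (Algebra k H)

variable (k H) in
/-- The identity map `H → H^cop`, an isomorphism of algebras. -/
def toCop [Algebra k H] : H ≃ₐ[k] Cop H := AlgEquiv.refl

variable [Bialgebra k H]

theorem cop_coassoc (h : H) :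
    TensorProduct.assoc k H H H
      (((TensorProduct.comm k H H).toLinearMap ∘ₗ Coalgebra.comul).rTensor H
        (TensorProduct.comm k H H (Coalgebra.comul h))) =
    ((TensorProduct.comm k H H).toLinearMap ∘ₗ Coalgebra.comul).lTensor H
      (TensorProduct.comm k H H (Coalgebra.comul h)) := by
  have key (f : H →ₗ[k] H ⊗[k] H) (x : H ⊗[k] H) :
      TensorProduct.assoc k H H H (((TensorProduct.comm k H H).toLinearMap ∘ₗ f).rTensor H
        (TensorProduct.comm k H H x)) =
      TensorProduct.assoc k H H H ((TensorProduct.comm k H H).toLinearMap.rTensor H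
        (TensorProduct.comm k H (H ⊗[k] H) (f.lTensor H x))) := by
    induction x using TensorProduct.induction_on with
    | zero => simp
    | add x y hx hy => simp only [map_add, hx, hy]
    | tmul a b => simp
  have key' (f : H →ₗ[k] H ⊗[k] H) (x : H ⊗[k] H) :
      ((TensorProduct.comm k H H).toLinearMap ∘ₗ f).lTensor H (TensorProduct.comm k H H x) =
      TensorProduct.assoc k H H H ((TensorProduct.comm k H H).toLinearMap.rTensor H
        (TensorProduct.comm k H (H ⊗[k] H) (TensorProduct.assoc k H H H (f.rTensor H x)))) := by
    induction x using TensorProduct.induction_on with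
    | zero => simp
    | add x y hx hy => simp only [map_add, hx, hy]
    | tmul a b =>
      simp only [TensorProduct.comm_tmul, LinearMap.lTensor_tmul, LinearMap.rTensor_tmul,
        LinearMap.comp_apply]
      generalize f a = y
      induction y using TensorProduct.induction_on with
      | zero => simp
      | add x y hx hy =>
        simp only [map_add, TensorProduct.add_tmul, TensorProduct.tmul_add, hx, hy]
      | tmul c d => simp
  rw [key, key', Coalgebra.coassoc_apply]

theorem cop_counit_left (h : H) : (Coalgebra.counit (R := k) (A := H)).rTensor H
    (TensorProduct.comm k H H (Coalgebra.comul h)) = (1 : k) ⊗ₜ h := by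
  have key (f : H →ₗ[k] k) (x : H ⊗[k] H) :
      f.rTensor H (TensorProduct.comm k H H x) = TensorProduct.comm k H k (f.lTensor H x) := by
    induction x using TensorProduct.induction_on with
    | zero => simp
    | add x y hx hy => simp only [map_add, hx, hy]
    | tmul a b => rfl
  rw [key, Coalgebra.lTensor_counit_comul]
  rfl

theorem cop_counit_right (h : H) : (Coalgebra.counit (R := k) (A := H)).lTensor H
    (TensorProduct.comm k H H (Coalgebra.comul h)) = h ⊗ₜ (1 : k) := by
  have key (f : H →ₗ[k] k) (x : H ⊗[k] H) :
      f.lTensor H (TensorProduct.comm k H H x) = TensorProduct.comm k k H (f.rTensor H x) := by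
    induction x using TensorProduct.induction_on with
    | zero => simp
    | add x y hx hy => simp only [map_add, hx, hy]
    | tmul a b => rfl
  rw [key, Coalgebra.rTensor_counit_comul]
  rfl

instance : Coalgebra k (Cop H) where
  comul := (TensorProduct.comm k H H).toLinearMap ∘ₗ Coalgebra.comul (R := k) (A := H)
  counit := Coalgebra.counit (R := k) (A := H)
  coassoc := LinearMap.ext fun h => cop_coassoc (k := k) (H := H) h
  rTensor_counit_comp_comul := LinearMap.ext fun h => cop_counit_left (k := k) (H := H) h
  lTensor_counit_comp_comul := LinearMap.ext fun h => cop_counit_right (k := k) (H := H) h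

instance : Bialgebra k (Cop H) :=
  Bialgebra.mk' k (Cop H) (Bialgebra.counit_one (R := k) (A := H))
    (fun {a b} => Bialgebra.counit_mul (R := k) (A := H) a b)
    (map_one ((Algebra.TensorProduct.comm k H H).toAlgHom.comp (Bialgebra.comulAlgHom k H)))
    (fun {a b} => map_mul
      ((Algebra.TensorProduct.comm k H H).toAlgHom.comp (Bialgebra.comulAlgHom k H)) a b)

end Cop

section Folding

variable {k : Type u} [Field k] {H₁ H₂ B : Type u} [Ring H₁] [Ring H₂] [Ring B]

section

variable [Algebra k H₁] [Algebra k H₂] [Algebra k B]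

variable (k H₁ H₂ B) in
/-- The algebra isomorphism `h ⊗ (b ⊗ g) ↦ (h ⊗ g) ⊗ b`. -/
def foldEquiv : H₁ ⊗[k] (B ⊗[k] H₂) ≃ₐ[k] (H₁ ⊗[k] Cop H₂) ⊗[k] B :=
  (Algebra.TensorProduct.congr AlgEquiv.refl
    ((Algebra.TensorProduct.comm k B H₂).trans
      (Algebra.TensorProduct.congr (toCop k H₂) AlgEquiv.refl))).trans
    (Algebra.TensorProduct.assoc k k k H₁ (Cop H₂) B).symm

@[simp]
theorem foldEquiv_tmul (h : H₁) (b : B) (g : H₂) :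
    foldEquiv k H₁ H₂ B (h ⊗ₜ (b ⊗ₜ g)) = (h ⊗ₜ toCop k H₂ g) ⊗ₜ b := rfl

end

variable [Bialgebra k H₁] [Bialgebra k H₂] [Algebra k B]
  [LeftComoduleAlgebra k H₁ B] [RightComoduleAlgebra k H₂ B]

variable (k H₁ H₂ B) in
/-- The folded coaction `b ↦ (b⁽⁻¹⁾ ⊗ b⁽¹⁾) ⊗ b⁽⁰⁾`. -/
def foldCoact : B →ₐ[k] (H₁ ⊗[k] Cop H₂) ⊗[k] B :=
  (foldEquiv k H₁ H₂ B).toAlgHom.comp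
    ((Algebra.TensorProduct.map (AlgHom.id k H₁) RightComoduleAlgebra.coact).comp
      LeftComoduleAlgebra.coact)

theorem foldCoact_apply (b : B) : foldCoact k H₁ H₂ B b =
    foldEquiv k H₁ H₂ B ((RightComoduleAlgebra.coact (k := k) (H := H₂) (A := B)).toLinearMap.lTensor
      H₁ (LeftComoduleAlgebra.coact (k := k) (H := H₁) b)) := rfl

theorem foldCoact_counit (b : B) :
    (Bialgebra.counitAlgHom k (H₁ ⊗[k] Cop H₂)).toLinearMap.rTensor B (foldCoact k H₁ H₂ B b) =
      1 ⊗ₜ b := by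
  have h₁ (y : B ⊗[k] H₂) (h : H₁) :
      (Bialgebra.counitAlgHom k (H₁ ⊗[k] Cop H₂)).toLinearMap.rTensor B
        (foldEquiv k H₁ H₂ B (h ⊗ₜ y)) =
      Coalgebra.counit (R := k) h ⊗ₜ TensorProduct.rid k B
        ((Bialgebra.counitAlgHom k H₂).toLinearMap.lTensor B y) := by
    induction y using TensorProduct.induction_on with
    | zero => simp
    | add x y hx hy => simp only [map_add, TensorProduct.tmul_add, hx, hy]
    | tmul c g =>
      have : Coalgebra.counit (R := k) (toCop k H₂ g) = Coalgebra.counit (R := k) g := rfl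
      simp [this, TensorProduct.tmul_smul, TensorProduct.smul_tmul']
  have h₂ (x : H₁ ⊗[k] B) :
      (Bialgebra.counitAlgHom k (H₁ ⊗[k] Cop H₂)).toLinearMap.rTensor B
        (foldEquiv k H₁ H₂ B
          ((RightComoduleAlgebra.coact (k := k) (H := H₂) (A := B)).toLinearMap.lTensor H₁ x)) =
      (Bialgebra.counitAlgHom k H₁).toLinearMap.rTensor B x := by
    induction x using TensorProduct.induction_on with
    | zero => simp
    | add x y hx hy => simp only [map_add, hx, hy]
    | tmul h c =>
      rw [LinearMap.lTensor_tmul, h₁]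
      simp only [AlgHom.toLinearMap_apply, RightComoduleAlgebra.counit_coact]
      simp
  rw [foldCoact_apply, h₂, LeftComoduleAlgebra.counit_coact]

/-- `h ⊗ (h' ⊗ ((b ⊗ g) ⊗ g')) ↦ (h ⊗ g') ⊗ ((h' ⊗ g) ⊗ b)`. -/
def foldTwice (k H₁ H₂ B : Type u) [Field k] [Ring H₁] [Ring H₂] [Ring B] [Algebra k H₁]
    [Algebra k H₂] [Algebra k B] : H₁ ⊗[k] (H₁ ⊗[k] ((B ⊗[k] H₂) ⊗[k] H₂)) →ₗ[k]
      (H₁ ⊗[k] Cop H₂) ⊗[k] ((H₁ ⊗[k] Cop H₂) ⊗[k] B) :=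
  (TensorProduct.assoc k H₁ (Cop H₂) ((H₁ ⊗[k] Cop H₂) ⊗[k] B)).symm.toLinearMap ∘ₗ
    ((TensorProduct.comm k ((H₁ ⊗[k] Cop H₂) ⊗[k] B) (Cop H₂)).toLinearMap ∘ₗ
      TensorProduct.map (foldEquiv k H₁ H₂ B).toLinearMap (toCop k H₂).toLinearMap ∘ₗ
        (TensorProduct.assoc k H₁ (B ⊗[k] H₂) H₂).symm.toLinearMap).lTensor H₁

theorem foldCoact_coassoc [BicomoduleAlgebra k H₁ H₂ B] (b : B) :
    TensorProduct.assoc k (H₁ ⊗[k] Cop H₂) (H₁ ⊗[k] Cop H₂) B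
      ((Bialgebra.comulAlgHom k (H₁ ⊗[k] Cop H₂)).toLinearMap.rTensor B
        (foldCoact k H₁ H₂ B b)) =
    (foldCoact k H₁ H₂ B).toLinearMap.lTensor (H₁ ⊗[k] Cop H₂) (foldCoact k H₁ H₂ B b) := by
  let L : B →ₗ[k] H₁ ⊗[k] B := (LeftComoduleAlgebra.coact (k := k) (H := H₁)).toLinearMap
  let R : B →ₗ[k] B ⊗[k] H₂ := (RightComoduleAlgebra.coact (k := k) (H := H₂)).toLinearMap
  let D₁ : H₁ →ₗ[k] H₁ ⊗[k] H₁ := Coalgebra.comul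
  let D₂ : H₂ →ₗ[k] H₂ ⊗[k] H₂ := Coalgebra.comul
  have hA (t : H₁ ⊗[k] (B ⊗[k] H₂)) :
      TensorProduct.assoc k (H₁ ⊗[k] Cop H₂) (H₁ ⊗[k] Cop H₂) B
        ((Bialgebra.comulAlgHom k (H₁ ⊗[k] Cop H₂)).toLinearMap.rTensor B
          (foldEquiv k H₁ H₂ B t)) =
      foldTwice k H₁ H₂ B (TensorProduct.assoc k H₁ H₁ ((B ⊗[k] H₂) ⊗[k] H₂)
        (TensorProduct.map D₁ ((TensorProduct.assoc k B H₂ H₂).symm.toLinearMap ∘ₗ D₂.lTensor B)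
          t)) := by
    induction t using TensorProduct.induction_on with
    | zero => simp
    | add x y hx hy => simp only [map_add, hx, hy]
    | tmul h t =>
      induction t using TensorProduct.induction_on with
      | zero => simp
      | add x y hx hy => simp only [map_add, TensorProduct.tmul_add, hx, hy]
      | tmul c g =>
        have hc : Coalgebra.comul (R := k) (toCop k H₂ g) =
            TensorProduct.map (toCop k H₂).toLinearMap (toCop k H₂).toLinearMap
              (TensorProduct.comm k H₂ H₂ (D₂ g)) := by
          exact (LinearMap.congr_fun (TensorProduct.map_id (R := k) (M := H₂) (N := H₂)) _).symm
        have hd : Coalgebra.comul (R := k) h = D₁ h := rfl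
        simp only [foldEquiv_tmul, LinearMap.rTensor_tmul, AlgHom.toLinearMap_apply,
          Bialgebra.comulAlgHom_apply, TensorProduct.comul_tmul, TensorProduct.map_tmul,
          LinearMap.comp_apply, LinearMap.lTensor_tmul, hc, hd]
        generalize D₁ h = x
        generalize D₂ g = y
        induction x using TensorProduct.induction_on with
        | zero => simp
        | add x y hx hy => simp only [map_add, TensorProduct.add_tmul, hx, hy]
        | tmul p q =>
          induction y using TensorProduct.induction_on with
          | zero => simp
          | add x y hx hy =>
            simp only [map_add, TensorProduct.add_tmul, TensorProduct.tmul_add, hx, hy]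
          | tmul r s => rfl
  have hC (s : H₁ ⊗[k] B) :
      foldTwice k H₁ H₂ B (((R.rTensor H₂).lTensor H₁ ∘ₗ
        (TensorProduct.assoc k H₁ B H₂).toLinearMap ∘ₗ L.rTensor H₂ ∘ₗ R).lTensor H₁ s) =
      (foldCoact k H₁ H₂ B).toLinearMap.lTensor (H₁ ⊗[k] Cop H₂)
        (foldEquiv k H₁ H₂ B (R.lTensor H₁ s)) := by
    induction s using TensorProduct.induction_on with
    | zero => simp
    | add x y hx hy => simp only [map_add, hx, hy]
    | tmul h c =>
      simp only [LinearMap.lTensor_tmul, LinearMap.comp_apply]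
      generalize R c = y
      induction y using TensorProduct.induction_on with
      | zero => simp
      | add x y hx hy => simp only [map_add, TensorProduct.tmul_add, hx, hy]
      | tmul d g =>
        have hf : foldCoact k H₁ H₂ B d = foldEquiv k H₁ H₂ B (R.lTensor H₁ (L d)) := rfl
        simp only [LinearMap.rTensor_tmul, foldEquiv_tmul, LinearMap.lTensor_tmul,
          AlgHom.toLinearMap_apply, hf]
        generalize L d = x
        induction x using TensorProduct.induction_on with
        | zero => simp
        | add x y hx hy => simp only [map_add, TensorProduct.add_tmul, TensorProduct.tmul_add, hx, hy]
        | tmul p q => rfl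
  have hL : (TensorProduct.assoc k H₁ H₁ B) (D₁.rTensor B (L b)) = L.lTensor H₁ (L b) :=
    LeftComoduleAlgebra.coassoc b
  have hR : (TensorProduct.assoc k B H₂ H₂).symm.toLinearMap ∘ₗ D₂.lTensor B ∘ₗ R =
      R.rTensor H₂ ∘ₗ R := by
    ext c
    exact (LinearEquiv.symm_apply_eq _).2 (RightComoduleAlgebra.coassoc (k := k) (H := H₂) c).symm
  have hLR : R.lTensor H₁ ∘ₗ L =
      (TensorProduct.assoc k H₁ B H₂).toLinearMap ∘ₗ L.rTensor H₂ ∘ₗ R := by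
    ext c
    exact (BicomoduleAlgebra.coact_comm (k := k) (H₁ := H₁) (H₂ := H₂) c).symm
  have hB (f : B →ₗ[k] (B ⊗[k] H₂) ⊗[k] H₂) (x : H₁ ⊗[k] B) :
      TensorProduct.assoc k H₁ H₁ ((B ⊗[k] H₂) ⊗[k] H₂) (TensorProduct.map D₁ f x) =
      (f.lTensor H₁).lTensor H₁ (TensorProduct.assoc k H₁ H₁ B (D₁.rTensor B x)) := by
    induction x using TensorProduct.induction_on with
    | zero => simp
    | add x y hx hy => simp only [map_add, hx, hy]
    | tmul h c =>
      simp only [TensorProduct.map_tmul, LinearMap.rTensor_tmul]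
      generalize D₁ h = x
      induction x using TensorProduct.induction_on with
      | zero => simp
      | add x y hx hy => simp only [map_add, TensorProduct.add_tmul, hx, hy]
      | tmul p q => rfl
  have e : foldCoact k H₁ H₂ B b = foldEquiv k H₁ H₂ B (R.lTensor H₁ (L b)) := rfl
  rw [e, hA, ← hC, ← hLR]
  have e' : TensorProduct.map D₁ ((TensorProduct.assoc k B H₂ H₂).symm.toLinearMap ∘ₗ D₂.lTensor B)
      (R.lTensor H₁ (L b)) = TensorProduct.map D₁ (R.rTensor H₂ ∘ₗ R) (L b) := by
    rw [← hR, ← LinearMap.comp_apply, LinearMap.map_comp_lTensor, LinearMap.comp_assoc]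
  rw [e', hB, hL, ← LinearMap.comp_assoc, ← LinearMap.lTensor_comp, LinearMap.lTensor_comp_apply H₁ _ L]

/-- Folding: an `H₁|H₂`-bicomodule algebra is a left `H₁ ⊗ H₂^cop`-comodule algebra. -/
instance foldComoduleAlgebra [BicomoduleAlgebra k H₁ H₂ B] :
    LeftComoduleAlgebra k (H₁ ⊗[k] Cop H₂) B where
  coact := foldCoact k H₁ H₂ B
  coassoc := foldCoact_coassoc
  counit_coact := foldCoact_counit

end Folding

/-! ### Categories of module functors and bimodule functors -/

open scoped MonoidalLeftAction MonoidalRightAction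

section Functors

open FDMod Functor.LaxLeftLinear Functor.LaxRightLinear

variable {k : Type u} [Field k]

section

variable {H A : Type u} [Ring H] [Bialgebra k H] [Ring A] [Algebra k A]

theorem actionHomRight_add [LeftComoduleAlgebra k H A] (X : FDMod k H) {M N : FDMod k A}
    (f g : M ⟶ N) : X ⊴ₗ (f + g) = X ⊴ₗ f + X ⊴ₗ g :=
  hom_ext (TensorProduct.map_add_right _ _ _)

theorem actionHomRight_smul [LeftComoduleAlgebra k H A] (X : FDMod k H) {M N : FDMod k A}
    (c : k) (f : M ⟶ N) : X ⊴ₗ (c • f) = c • X ⊴ₗ f :=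
  hom_ext (TensorProduct.map_smul_right _ _ _)

theorem actionHomLeft_add [RightComoduleAlgebra k H A] {M N : FDMod k A} (f g : M ⟶ N)
    (X : FDMod k H) : (f + g) ⊵ᵣ X = f ⊵ᵣ X + g ⊵ᵣ X :=
  hom_ext (TensorProduct.map_add_left _ _ _)

theorem actionHomLeft_smul [RightComoduleAlgebra k H A] {M N : FDMod k A} (c : k) (f : M ⟶ N)
    (X : FDMod k H) : (c • f) ⊵ᵣ X = c • f ⊵ᵣ X :=
  hom_ext (TensorProduct.map_smul_left _ _ _)

end

/-- A `Rep(H)`-module endofunctor of the category of modules over a left `H`-comodule algebra `A`: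
a right exact `k`-linear functor with coherent natural isomorphisms
`X ⊙ F(M) ≅ F(X ⊙ M)`. -/
structure ModuleFunctor (k H A : Type u) [Field k] [Ring H] [Bialgebra k H] [Ring A] [Algebra k A]
    [LeftComoduleAlgebra k H A] where
  functor : FDMod k A ⥤ FDMod k A
  [additive : functor.Additive]
  [linear : functor.Linear k]
  rightExact : RightExact functor
  [leftLinear : functor.LeftLinear (FDMod k H)]

namespace ModuleFunctor

attribute [instance] additive linear leftLinear

variable {H A : Type u} [Ring H] [Bialgebra k H] [Ring A] [Algebra k A] [LeftComoduleAlgebra k H A]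

/-- Morphisms of module functors: natural transformations that commute with the module
structures. -/
def homs (F G : ModuleFunctor k H A) : Submodule k (F.functor ⟶ G.functor) where
  carrier := {α | ∀ (X : FDMod k H) (M : FDMod k A),
    μₗ F.functor X M ≫ α.app (X ⊙ₗ M) = X ⊴ₗ α.app M ≫ μₗ G.functor X M}
  zero_mem' X M := by
    have : X ⊴ₗ (0 : F.functor.obj M ⟶ G.functor.obj M) = 0 :=
      hom_ext (TensorProduct.map_zero_right _)
    change _ ≫ 0 = X ⊴ₗ (0 : F.functor.obj M ⟶ G.functor.obj M) ≫ _
    rw [this, Limits.comp_zero, Limits.zero_comp]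
  add_mem' {α β} hα hβ X M := by
    change _ ≫ (α.app _ + β.app _) = X ⊴ₗ (α.app _ + β.app _) ≫ _
    rw [actionHomRight_add, Preadditive.comp_add, Preadditive.add_comp, hα, hβ]
  smul_mem' c α hα X M := by
    change _ ≫ (c • α.app _) = X ⊴ₗ (c • α.app _) ≫ _
    rw [actionHomRight_smul, Linear.comp_smul, Linear.smul_comp, hα]

instance : Category (ModuleFunctor k H A) where
  Hom F G := homs F G
  id F := ⟨𝟙 F.functor, fun X M => by simp⟩
  comp α β := ⟨α.1 ≫ β.1, fun X M => by
    rw [NatTrans.comp_app, ← Category.assoc, α.2 X M, Category.assoc, β.2 X M, NatTrans.comp_app,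
      MonoidalLeftAction.actionHomRight_comp, Category.assoc]⟩
  id_comp _ := Subtype.ext (Category.id_comp _)
  comp_id _ := Subtype.ext (Category.comp_id _)
  assoc _ _ _ := Subtype.ext (Category.assoc _ _ _)

instance : Preadditive (ModuleFunctor k H A) where
  homGroup F G := inferInstanceAs (AddCommGroup (homs F G))
  add_comp _ _ _ _ _ _ := Subtype.ext (Preadditive.add_comp _ _ _ _ _ _)
  comp_add _ _ _ _ _ _ := Subtype.ext (Preadditive.comp_add _ _ _ _ _ _)

instance : Linear k (ModuleFunctor k H A) where
  homModule F G := inferInstanceAs (Module k (homs F G))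
  smul_comp _ _ _ _ _ _ := Subtype.ext (Linear.smul_comp _ _ _ _ _ _)
  comp_smul _ _ _ _ _ _ := Subtype.ext (Linear.comp_smul _ _ _ _ _ _)

variable (k H A) in
/-- The functor that forgets the module structure of a module functor. -/
def forget : ModuleFunctor k H A ⥤ (FDMod k A ⥤ FDMod k A) where
  obj F := F.functor
  map α := α.1

end ModuleFunctor

/-- A `Rep(H₁)|Rep(H₂)`-bimodule endofunctor of the category of modules over an `H₁|H₂`-bicomodule
algebra `B`: a right exact `k`-linear functor with coherent natural isomorphisms
`X ⊙ F(M) ≅ F(X ⊙ M)` and `F(M) ⊙ Y ≅ F(M ⊙ Y)`, such that the two resulting isomorphisms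
`(X ⊙ F(M)) ⊙ Y ≅ F(X ⊙ (M ⊙ Y))` agree. -/
structure BimoduleFunctor (k H₁ H₂ B : Type u) [Field k] [Ring H₁] [Bialgebra k H₁] [Ring H₂]
    [Bialgebra k H₂] [Ring B] [Algebra k B] [LeftComoduleAlgebra k H₁ B]
    [RightComoduleAlgebra k H₂ B] [BicomoduleAlgebra k H₁ H₂ B] where
  functor : FDMod k B ⥤ FDMod k B
  [additive : functor.Additive]
  [linear : functor.Linear k]
  rightExact : RightExact functor
  [leftLinear : functor.LeftLinear (FDMod k H₁)]
  [rightLinear : functor.RightLinear (FDMod k H₂)]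
  compatible (X : FDMod k H₁) (M : FDMod k B) (Y : FDMod k H₂) :
    μₗ functor X M ⊵ᵣ Y ≫ μᵣ functor (X ⊙ₗ M) Y ≫ functor.map (middleAssoc X M Y).hom =
      (middleAssoc X (functor.obj M) Y).hom ≫ X ⊴ₗ μᵣ functor M Y ≫ μₗ functor X (M ⊙ᵣ Y)

namespace BimoduleFunctor

attribute [instance] additive linear leftLinear rightLinear

variable {H₁ H₂ B : Type u} [Ring H₁] [Bialgebra k H₁] [Ring H₂] [Bialgebra k H₂] [Ring B]
  [Algebra k B] [LeftComoduleAlgebra k H₁ B] [RightComoduleAlgebra k H₂ B]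
  [BicomoduleAlgebra k H₁ H₂ B]

/-- Morphisms of bimodule functors: natural transformations that commute with the left and the
right module structures. -/
def homs (F G : BimoduleFunctor k H₁ H₂ B) : Submodule k (F.functor ⟶ G.functor) where
  carrier := {α |
    (∀ (X : FDMod k H₁) (M : FDMod k B),
      μₗ F.functor X M ≫ α.app (X ⊙ₗ M) = X ⊴ₗ α.app M ≫ μₗ G.functor X M) ∧
    ∀ (M : FDMod k B) (Y : FDMod k H₂),
      μᵣ F.functor M Y ≫ α.app (M ⊙ᵣ Y) = α.app M ⊵ᵣ Y ≫ μᵣ G.functor M Y}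
  zero_mem' := by
    refine ⟨fun X M => ?_, fun M Y => ?_⟩
    · have : X ⊴ₗ (0 : F.functor.obj M ⟶ G.functor.obj M) = 0 :=
        hom_ext (TensorProduct.map_zero_right _)
      change _ ≫ 0 = X ⊴ₗ (0 : F.functor.obj M ⟶ G.functor.obj M) ≫ _
      rw [this, Limits.comp_zero, Limits.zero_comp]
    · have : (0 : F.functor.obj M ⟶ G.functor.obj M) ⊵ᵣ Y = 0 :=
        hom_ext (TensorProduct.map_zero_left _)
      change _ ≫ 0 = (0 : F.functor.obj M ⟶ G.functor.obj M) ⊵ᵣ Y ≫ _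
      rw [this, Limits.comp_zero, Limits.zero_comp]
  add_mem' {α β} hα hβ := by
    refine ⟨fun X M => ?_, fun M Y => ?_⟩
    · change _ ≫ (α.app _ + β.app _) = X ⊴ₗ (α.app _ + β.app _) ≫ _
      rw [actionHomRight_add, Preadditive.comp_add, Preadditive.add_comp, hα.1, hβ.1]
    · change _ ≫ (α.app _ + β.app _) = (α.app _ + β.app _) ⊵ᵣ Y ≫ _
      rw [actionHomLeft_add, Preadditive.comp_add, Preadditive.add_comp, hα.2, hβ.2]
  smul_mem' c α hα := by
    refine ⟨fun X M => ?_, fun M Y => ?_⟩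
    · change _ ≫ (c • α.app _) = X ⊴ₗ (c • α.app _) ≫ _
      rw [actionHomRight_smul, Linear.comp_smul, Linear.smul_comp, hα.1]
    · change _ ≫ (c • α.app _) = (c • α.app _) ⊵ᵣ Y ≫ _
      rw [actionHomLeft_smul, Linear.comp_smul, Linear.smul_comp, hα.2]

instance : Category (BimoduleFunctor k H₁ H₂ B) where
  Hom F G := homs F G
  id F := ⟨𝟙 F.functor, fun X M => by simp, fun M Y => by simp⟩
  comp α β := ⟨α.1 ≫ β.1, fun X M => by
      rw [NatTrans.comp_app, ← Category.assoc, α.2.1 X M, Category.assoc, β.2.1 X M,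
        NatTrans.comp_app, MonoidalLeftAction.actionHomRight_comp, Category.assoc],
    fun M Y => by
      rw [NatTrans.comp_app, ← Category.assoc, α.2.2 M Y, Category.assoc, β.2.2 M Y,
        NatTrans.comp_app, MonoidalRightAction.comp_actionHomLeft, Category.assoc]⟩
  id_comp _ := Subtype.ext (Category.id_comp _)
  comp_id _ := Subtype.ext (Category.comp_id _)
  assoc _ _ _ := Subtype.ext (Category.assoc _ _ _)

instance : Preadditive (BimoduleFunctor k H₁ H₂ B) where
  homGroup F G := inferInstanceAs (AddCommGroup (homs F G))
  add_comp _ _ _ _ _ _ := Subtype.ext (Preadditive.add_comp _ _ _ _ _ _)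
  comp_add _ _ _ _ _ _ := Subtype.ext (Preadditive.comp_add _ _ _ _ _ _)

instance : Linear k (BimoduleFunctor k H₁ H₂ B) where
  homModule F G := inferInstanceAs (Module k (homs F G))
  smul_comp _ _ _ _ _ _ := Subtype.ext (Linear.smul_comp _ _ _ _ _ _)
  comp_smul _ _ _ _ _ _ := Subtype.ext (Linear.comp_smul _ _ _ _ _ _)

variable (k H₁ H₂ B) in
/-- The functor that forgets the two module structures of a bimodule functor. -/
def forget : BimoduleFunctor k H₁ H₂ B ⥤ (FDMod k B ⥤ FDMod k B) where
  obj F := F.functor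
  map α := α.1

end BimoduleFunctor

end Functors

/-! ### Covariant bimodules -/

/-- An `H`-covariant `A|A`-bimodule, for a left `H`-comodule algebra `A`: a finite-dimensional
`A|A`-bimodule `Y` with a left `H`-coaction `Y → H ⊗ Y` that is a morphism of `A|A`-bimodules, where
`a · (h ⊗ y) · b = a⁽⁻¹⁾ h b⁽⁻¹⁾ ⊗ a⁽⁰⁾ y b⁽⁰⁾`. -/
structure CovariantBimodule (k H A : Type u) [Field k] [Ring H] [Bialgebra k H] [Ring A]
    [Algebra k A] [LeftComoduleAlgebra k H A] : Type (u + 1) where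
  carrier : Type u
  [addCommGroup : AddCommGroup carrier]
  [module : Module k carrier]
  [finite : FiniteDimensional k carrier]
  left : A →ₐ[k] Module.End k carrier
  right : A →ₗ[k] Module.End k carrier
  right_one : right 1 = 1
  right_mul (a b : A) : right (a * b) = right b * right a
  left_right (a b : A) : left a * right b = right b * left a
  coact : carrier →ₗ[k] H ⊗[k] carrier
  coassoc (y : carrier) : TensorProduct.assoc k H H carrier
      ((Bialgebra.comulAlgHom k H).toLinearMap.rTensor carrier (coact y)) =
    coact.lTensor H (coact y)
  counit_coact (y : carrier) :
    (Bialgebra.counitAlgHom k H).toLinearMap.rTensor carrier (coact y) = 1 ⊗ₜ y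
  coact_left (a : A) (y : carrier) : coact (left a y) =
    TensorProduct.homTensorHomMap (.id k) H carrier H carrier
      (TensorProduct.map (LinearMap.mul k H) left.toLinearMap (LeftComoduleAlgebra.coact a))
      (coact y)
  coact_right (a : A) (y : carrier) : coact (right a y) =
    TensorProduct.homTensorHomMap (.id k) H carrier H carrier
      (TensorProduct.map (LinearMap.mul k H).flip right (LeftComoduleAlgebra.coact a))
      (coact y)

namespace CovariantBimodule

attribute [instance] addCommGroup module finite

variable {k : Type u} [Field k] {H A : Type u} [Ring H] [Bialgebra k H] [Ring A] [Algebra k A]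
  [LeftComoduleAlgebra k H A]

/-- Morphisms of covariant bimodules: linear maps that commute with both actions and with the
coactions. -/
def homs (Y Z : CovariantBimodule k H A) : Submodule k (Y.carrier →ₗ[k] Z.carrier) where
  carrier := {f | (∀ a, f ∘ₗ Y.left a = Z.left a ∘ₗ f) ∧ (∀ a, f ∘ₗ Y.right a = Z.right a ∘ₗ f) ∧
    f.lTensor H ∘ₗ Y.coact = Z.coact ∘ₗ f}
  zero_mem' := by simp
  add_mem' hf hg := by
    refine ⟨fun a => ?_, fun a => ?_, ?_⟩
    · rw [LinearMap.add_comp, LinearMap.comp_add, hf.1, hg.1]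
    · rw [LinearMap.add_comp, LinearMap.comp_add, hf.2.1, hg.2.1]
    · rw [LinearMap.lTensor_add, LinearMap.add_comp, LinearMap.comp_add, hf.2.2, hg.2.2]
  smul_mem' c f hf := by
    refine ⟨fun a => ?_, fun a => ?_, ?_⟩
    · rw [LinearMap.smul_comp, LinearMap.comp_smul, hf.1]
    · rw [LinearMap.smul_comp, LinearMap.comp_smul, hf.2.1]
    · rw [LinearMap.lTensor_smul, LinearMap.smul_comp, LinearMap.comp_smul, hf.2.2]

instance : Category (CovariantBimodule k H A) where
  Hom Y Z := homs Y Z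
  id Y := ⟨LinearMap.id, fun _ => rfl, fun _ => rfl, by simp⟩
  comp f g := ⟨g.1 ∘ₗ f.1,
    fun a => by
      rw [LinearMap.comp_assoc, f.2.1 a, ← LinearMap.comp_assoc, g.2.1 a, LinearMap.comp_assoc],
    fun a => by
      rw [LinearMap.comp_assoc, f.2.2.1 a, ← LinearMap.comp_assoc, g.2.2.1 a,
        LinearMap.comp_assoc],
    by rw [LinearMap.lTensor_comp, LinearMap.comp_assoc, f.2.2.2, ← LinearMap.comp_assoc, g.2.2.2,
        LinearMap.comp_assoc]⟩

instance : Preadditive (CovariantBimodule k H A) where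
  homGroup Y Z := inferInstanceAs (AddCommGroup (homs Y Z))
  add_comp _ _ _ _ _ _ := Subtype.ext (LinearMap.comp_add _ _ _)
  comp_add _ _ _ _ _ _ := Subtype.ext (LinearMap.add_comp _ _ _)

instance : Linear k (CovariantBimodule k H A) where
  homModule Y Z := inferInstanceAs (Module k (homs Y Z))
  smul_comp _ _ _ _ _ _ := Subtype.ext (LinearMap.comp_smul _ _ _)
  comp_smul _ _ _ _ _ _ := Subtype.ext (LinearMap.smul_comp _ _ _)

variable (k H A) in
/-- The underlying left `A`-module of a covariant bimodule. -/
def toLeftModule : CovariantBimodule k H A ⥤ FDMod k A where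
  obj Y := { carrier := Y.carrier, act := Y.left }
  map f := FDMod.mkHom f.1 f.2.1

end CovariantBimodule

end HopfWall

end

/-! Evaluation at the regular module compares both kinds of functors with covariant bimodules: the
theorem is an equivariant form of the Eilenberg–Watts theorem. A right exact linear functor F on
finite-dimensional A-modules is F(A) ⊗_A -, because the bar presentation A ⊗ A ⊗ M → A ⊗ M → M → 0
consists of finite free modules (`evalMap_surjective`, `evalMap_exact`). Hence natural
transformations out of F are the same as bimodule maps out of F(A) (`natTrans_ext_of_rightExact`,
`exists_natTrans`).

Let H coact on A. The coaction is a morphism A → H ⊙ A of A-modules, so a module functor F yields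
F(A) → F(H ⊙ A) ≅ H ⊙ F(A), which is a coaction on F(A) (`coactMap`). It determines the whole module
structure: under F(M) = F(A) ⊗_A M, the map F(X ⊙ M) → X ⊙ F(M) is y ⊗ (x ⊗ m) ↦ y₍₋₁₎x ⊗ (y₍₀₎ ⊗ m)
(`map_orbit_comp_δₗ`). This gives full faithfulness over any finite-dimensional bialgebra. For
essential surjectivity the same formula must be invertible on Y ⊗_A -. That requires a skew
antipode, a map T with h₍₂₎T(h₍₁₎) = ε(h): moving X past Y is undone by x ⊗ y ↦ y₍₀₎ ⊗ T(y₍₋₁₎)x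
(`coactBraid_surjective`, `deltaLin_bijective`). For H₂^cop the antipode of H₂ is such a T. For H₁
it is the inverse of the antipode, which exists by the Larson–Sweedler theorem
(`antipode_injective`), proved here with Hopf modules.

For bimodule functors, the right action of Rep(H₂) is read through the flip as a left action of
Rep(H₂^cop), so F(B) carries coactions of H₁ and of H₂^cop. Compatibility of the two structures of F
makes these coactions commute (`compatible_iff`, `coactMap_comm`), and a pair of commuting coactions
is the same as a coaction of H₁ ⊗ H₂^cop (`pairCoact_coassoc`, `pairCoact_proj`, `proj_coact_comm`).
So bimodule functors are equivalent to covariant bimodules too, and the equivalence from (1) to (2)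
is the composite through (3). Thus a structure known on representations X₁ ⊗ X₂ never has to be
extended by hand to all representations of H₁ ⊗ H₂^cop. The underlying functor is preserved because
the bimodule F(B) determines F (`nonempty_natIso_of_rightExact`).

In the semisimple case right exact sequences split, and additive functors preserve the splitting
equations. -/

noncomputable section

namespace HopfWall

/-! ### Hopf modules and the injectivity of the antipode -/

section Antipode

open Coalgebra HopfAlgebra WithConv

variable {k : Type u} [Field k] {H : Type u} [Ring H] [HopfAlgebra k H]

/-- A convolution computation in Hom(H, H ⊗ H): with i₁, i₂ the two inclusions, i₁ * i₂ = Δ, i₂ *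
(i₂S) = 1 and (ΔS) * Δ = 1, so (ΔS) * i₁ = (ΔS) * i₁ * i₂ * (i₂S) = i₂S. This spares the fact that S
reverses the comultiplication. -/
theorem antipode_comul_mul (h : H) :
    LinearMap.mul' k (H ⊗[k] H)
      (TensorProduct.map (comul ∘ₗ antipode k)
        (Algebra.TensorProduct.includeLeft : H →ₐ[k] H ⊗[k] H).toLinearMap (comul (R := k) h)) =
      1 ⊗ₜ antipode k h := by
  let i₁ : H →ₗ[k] H ⊗[k] H := (Algebra.TensorProduct.includeLeft : H →ₐ[k] H ⊗[k] H).toLinearMap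
  let i₂ : H →ₗ[k] H ⊗[k] H := (Algebra.TensorProduct.includeRight : H →ₐ[k] H ⊗[k] H).toLinearMap
  have h12 : toConv i₁ * toConv i₂ = toConv (comul : H →ₗ[k] H ⊗[k] H) := by
    ext x
    rw [(ℛ k x).convMul_apply]
    simp [i₁, i₂, Coalgebra.Repr.eq]
  have h2 : toConv i₂ * toConv (i₂ ∘ₗ antipode k) = 1 := by
    ext x
    rw [(ℛ k x).convMul_apply]
    have := congrArg i₂ (sum_mul_antipode_eq_algebraMap_counit (ℛ k x))
    simpa [i₂, Algebra.TensorProduct.one_def, Algebra.algebraMap_eq_smul_one,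
      TensorProduct.tmul_sum] using this
  have h0 : toConv (comul ∘ₗ antipode k) * toConv (comul : H →ₗ[k] H ⊗[k] H) = 1 := by
    ext x
    rw [(ℛ k x).convMul_apply]
    have := congrArg (comul (R := k)) (sum_antipode_mul_eq_algebraMap_counit (ℛ k x))
    simpa [map_sum, Algebra.algebraMap_eq_smul_one] using this
  have key : toConv (comul ∘ₗ antipode k) * toConv i₁ = toConv (i₂ ∘ₗ antipode k) := by
    rw [← mul_one (toConv (comul ∘ₗ antipode k) * toConv i₁), ← h2, ← mul_assoc,
      mul_assoc _ (toConv i₁), h12, h0, one_mul]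
  exact congrArg (fun f => f.ofConv h) key

/-- A right Hopf module over `H`, given by its action and its coaction. -/
structure HopfModule (k H M : Type u) [Field k] [Ring H] [HopfAlgebra k H] [AddCommGroup M]
    [Module k M] where
  act : M →ₗ[k] H →ₗ[k] M
  act_one (m : M) : act m 1 = m
  act_mul (m : M) (g h : H) : act m (g * h) = act (act m g) h
  coact : M →ₗ[k] M ⊗[k] H
  coassoc (m : M) : TensorProduct.assoc k M H H (coact.rTensor H (coact m)) =
    (comul (R := k)).lTensor M (coact m)
  counit_coact (m : M) : (counit (R := k)).lTensor M (coact m) = m ⊗ₜ 1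
  coact_act (m : M) (h : H) :
    coact (act m h) = TensorProduct.map₂ act (LinearMap.mul k H) (coact m) (comul (R := k) h)

namespace HopfModule

variable {M : Type u} [AddCommGroup M] [Module k M] (N : HopfModule k H M)

/-- The projection `m ↦ m₍₀₎ S(m₍₁₎)` onto the coinvariants. -/
def proj : M →ₗ[k] M := TensorProduct.lift N.act ∘ₗ (antipode k).lTensor M ∘ₗ N.coact

/-- By coassociativity the left side is m₍₀₎S(m₍₁₎)m₍₂₎, which the antipode axiom collapses. So the
image of `proj` generates M under H. -/
theorem lift_proj_coact (m : M) :
    TensorProduct.lift N.act (N.proj.rTensor H (N.coact m)) = m := by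
  -- `G` is m ⊗ (a ⊗ b) ↦ mS(a)b.
  let G : M ⊗[k] (H ⊗[k] H) →ₗ[k] M :=
    TensorProduct.lift N.act ∘ₗ (LinearMap.mul' k H ∘ₗ (antipode k).rTensor H).lTensor M
  have h := congrArg G (N.coassoc m)
  have h1 (t : M ⊗[k] H) : G (TensorProduct.assoc k M H H (N.coact.rTensor H t)) =
      TensorProduct.lift N.act (N.proj.rTensor H t) := by
    induction t using TensorProduct.induction_on with
    | zero => simp
    | add x y hx hy => simp only [map_add, hx, hy]
    | tmul n a =>
      simp only [LinearMap.rTensor_tmul, TensorProduct.lift.tmul, proj, LinearMap.comp_apply]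
      generalize N.coact n = s
      induction s using TensorProduct.induction_on with
      | zero => simp
      | add x y hx hy => simp only [map_add, TensorProduct.add_tmul, LinearMap.add_apply, hx, hy]
      | tmul p b => simp [G, N.act_mul]
  have h2 (t : M ⊗[k] H) : G ((comul (R := k)).lTensor M t) =
      TensorProduct.rid k M ((counit (R := k)).lTensor M t) := by
    induction t using TensorProduct.induction_on with
    | zero => simp
    | add x y hx hy => simp only [map_add, hx, hy]
    | tmul n a => simp [G, Algebra.algebraMap_eq_smul_one, N.act_one]
  rw [h1, h2, N.counit_coact] at h
  simpa using h

/-- Write P for `proj` and ρ for the coaction. The maps f = ρP and f = P ⊗ 1 give the same value of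
f(m₍₀₎)Δ(m₍₁₎), and f can be recovered from that expression: f(m₍₀₎)Δ(m₍₁₎)Δ(S(m₍₂₎)) = f(m). -/
theorem coact_proj (m : M) : N.coact (N.proj m) = N.proj m ⊗ₜ 1 := by
  -- Both sides are ρ(n): the left one is ρ(P(n₍₀₎)n₍₁₎), the right one is P(n₍₀₎)n₍₁₎ ⊗ n₍₂₎, and
  -- `lift_proj_coact` applies to each.
  have key (n : M) : TensorProduct.lift (TensorProduct.map₂ N.act (LinearMap.mul k H))
      (TensorProduct.map (N.coact ∘ₗ N.proj) (comul (R := k)) (N.coact n)) =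
      TensorProduct.lift (TensorProduct.map₂ N.act (LinearMap.mul k H))
        (TensorProduct.map ((TensorProduct.mk k M H).flip 1 ∘ₗ N.proj) (comul (R := k))
          (N.coact n)) := by
    have h1 (t : M ⊗[k] H) : TensorProduct.lift (TensorProduct.map₂ N.act (LinearMap.mul k H))
        (TensorProduct.map (N.coact ∘ₗ N.proj) (comul (R := k)) t) =
        N.coact (TensorProduct.lift N.act (N.proj.rTensor H t)) := by
      induction t using TensorProduct.induction_on with
      | zero => simp
      | add x y hx hy => simp only [map_add, hx, hy]
      | tmul p a => simp [N.coact_act]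
    let G : M ⊗[k] (H ⊗[k] H) →ₗ[k] M ⊗[k] H :=
      (TensorProduct.lift N.act ∘ₗ N.proj.rTensor H).rTensor H ∘ₗ
        (TensorProduct.assoc k M H H).symm.toLinearMap
    have h2 (t : M ⊗[k] H) : TensorProduct.lift (TensorProduct.map₂ N.act (LinearMap.mul k H))
        (TensorProduct.map ((TensorProduct.mk k M H).flip 1 ∘ₗ N.proj) (comul (R := k)) t) =
        G ((comul (R := k)).lTensor M t) := by
      induction t using TensorProduct.induction_on with
      | zero => simp
      | add x y hx hy => simp only [map_add, hx, hy]
      | tmul p a =>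
        simp only [TensorProduct.map_tmul, LinearMap.lTensor_tmul, TensorProduct.lift.tmul]
        generalize comul (R := k) a = s
        induction s using TensorProduct.induction_on with
        | zero => simp
        | add x y hx hy => simp only [map_add, TensorProduct.tmul_add, hx, hy]
        | tmul b c => simp [G]
    have h3 (t : M ⊗[k] H) : G (TensorProduct.assoc k M H H (N.coact.rTensor H t)) = t := by
      induction t using TensorProduct.induction_on with
      | zero => simp
      | add x y hx hy => simp only [map_add, hx, hy]
      | tmul p a => simp [G, N.lift_proj_coact]
    rw [h1, h2, N.lift_proj_coact, ← N.coassoc, h3]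
  -- `Q f` is m ⊗ h ↦ f(m)Δ(h), and `G f` is m ⊗ (a ⊗ b) ↦ f(m)Δ(a)Δ(S(b)).
  let Q (f : M →ₗ[k] M ⊗[k] H) : M ⊗[k] H →ₗ[k] M ⊗[k] H :=
    TensorProduct.lift (TensorProduct.map₂ N.act (LinearMap.mul k H)) ∘ₗ
      TensorProduct.map f (comul (R := k))
  let G (f : M →ₗ[k] M ⊗[k] H) : M ⊗[k] (H ⊗[k] H) →ₗ[k] M ⊗[k] H :=
    TensorProduct.lift (TensorProduct.map₂ N.act (LinearMap.mul k H)) ∘ₗ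
      TensorProduct.map (Q f) (comul (R := k) ∘ₗ antipode k) ∘ₗ
        (TensorProduct.assoc k M H H).symm.toLinearMap
  have hmul (u : M ⊗[k] H) (a b : H ⊗[k] H) :
      TensorProduct.map₂ N.act (LinearMap.mul k H) (TensorProduct.map₂ N.act (LinearMap.mul k H) u a) b =
      TensorProduct.map₂ N.act (LinearMap.mul k H) u (a * b) := by
    induction u using TensorProduct.induction_on with
    | zero => simp
    | add x y hx hy => simp only [map_add, LinearMap.add_apply, hx, hy]
    | tmul m g =>
      induction a using TensorProduct.induction_on with
      | zero => simp
      | add x y hx hy => simp only [map_add, LinearMap.add_apply, add_mul, hx, hy]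
      | tmul a a' =>
        induction b using TensorProduct.induction_on with
        | zero => simp
        | add x y hx hy => simp only [map_add, mul_add, hx, hy]
        | tmul b b' => simp [N.act_mul, mul_assoc]
  have hone (u : M ⊗[k] H) : TensorProduct.map₂ N.act (LinearMap.mul k H) u 1 = u := by
    induction u using TensorProduct.induction_on with
    | zero => simp
    | add x y hx hy => simp only [map_add, LinearMap.add_apply, hx, hy]
    | tmul m g => simp [Algebra.TensorProduct.one_def, N.act_one]
  have hG (f : M →ₗ[k] M ⊗[k] H) (t : M ⊗[k] H) : G f ((comul (R := k)).lTensor M t) =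
      f (TensorProduct.rid k M ((counit (R := k)).lTensor M t)) := by
    induction t using TensorProduct.induction_on with
    | zero => simp
    | add x y hx hy => simp only [map_add, hx, hy]
    | tmul p a =>
      have h4 (s : H ⊗[k] H) : G f (p ⊗ₜ s) = TensorProduct.map₂ N.act (LinearMap.mul k H) (f p)
          (comul (R := k) (LinearMap.mul' k H ((antipode k).lTensor H s))) := by
        induction s using TensorProduct.induction_on with
        | zero => simp
        | add x y hx hy => simp only [map_add, TensorProduct.tmul_add, hx, hy]
        | tmul b c => simp [G, Q, hmul]
      rw [LinearMap.lTensor_tmul, h4, mul_antipode_lTensor_comul_apply,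
        Algebra.algebraMap_eq_smul_one, map_smul, Bialgebra.comul_one, map_smul, hone]
      simp
  have hA (t : M ⊗[k] H) : G (N.coact ∘ₗ N.proj)
        (TensorProduct.assoc k M H H (N.coact.rTensor H t)) =
      G ((TensorProduct.mk k M H).flip 1 ∘ₗ N.proj)
        (TensorProduct.assoc k M H H (N.coact.rTensor H t)) := by
    induction t using TensorProduct.induction_on with
    | zero => simp
    | add x y hx hy => simp only [map_add, hx, hy]
    | tmul p a =>
      simp only [G, Q, LinearMap.rTensor_tmul, LinearMap.comp_apply, LinearEquiv.coe_coe,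
        LinearEquiv.symm_apply_apply, TensorProduct.map_tmul, TensorProduct.lift.tmul]
      rw [key]
  have := hA (N.coact m)
  rw [N.coassoc, hG, hG, N.counit_coact] at this
  simpa using this

/-- For a coinvariant m the coaction turns mh = 0 into mh₍₁₎ ⊗ h₍₂₎ = 0. Hence mh₍₁₎S(h₍₂₎) ⊗ h₍₃₎ =
0, and this element is m ⊗ h. -/
theorem tmul_eq_zero_of_act_eq_zero {m : M} (hm : N.coact m = m ⊗ₜ 1) {h : H}
    (hh : N.act m h = 0) : m ⊗ₜ[k] h = 0 := by
  have h0 : TensorProduct.map₂ N.act (LinearMap.mul k H) (m ⊗ₜ 1) (comul (R := k) h) = 0 := by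
    rw [← hm, ← N.coact_act, hh, map_zero]
  have h1 (s : H ⊗[k] H) : TensorProduct.map₂ N.act (LinearMap.mul k H) (m ⊗ₜ 1) s =
      (N.act m).rTensor H s := by
    induction s using TensorProduct.induction_on with
    | zero => simp
    | add x y hx hy => simp only [map_add, hx, hy]
    | tmul a b => simp
  rw [h1] at h0
  -- `J` is a ⊗ (b ⊗ c) ↦ maS(b) ⊗ c.
  let J : H ⊗[k] (H ⊗[k] H) →ₗ[k] M ⊗[k] H :=
    (TensorProduct.lift N.act ∘ₗ TensorProduct.map (N.act m) (antipode k)).rTensor H ∘ₗ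
      (TensorProduct.assoc k H H H).symm.toLinearMap
  have h2 (s : H ⊗[k] H) : J ((comul (R := k)).lTensor H s) =
      (TensorProduct.lift N.act ∘ₗ (antipode k).lTensor M).rTensor H
        ((TensorProduct.assoc k M H H).symm ((comul (R := k)).lTensor M
          ((N.act m).rTensor H s))) := by
    induction s using TensorProduct.induction_on with
    | zero => simp
    | add x y hx hy => simp only [map_add, hx, hy]
    | tmul a b =>
      simp only [LinearMap.lTensor_tmul, LinearMap.rTensor_tmul]
      generalize comul (R := k) b = s
      induction s using TensorProduct.induction_on with
      | zero => simp
      | add x y hx hy => simp only [map_add, TensorProduct.tmul_add, hx, hy]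
      | tmul b c => simp [J]
  have h3 (s : H ⊗[k] H) :
      J (TensorProduct.assoc k H H H ((comul (R := k)).rTensor H s)) =
      m ⊗ₜ TensorProduct.lid k H ((counit (R := k)).rTensor H s) := by
    induction s using TensorProduct.induction_on with
    | zero => simp
    | add x y hx hy => simp only [map_add, TensorProduct.tmul_add, hx, hy]
    | tmul a b =>
      have h4 (s : H ⊗[k] H) : J (TensorProduct.assoc k H H H (s ⊗ₜ b)) =
          N.act m (LinearMap.mul' k H ((antipode k).lTensor H s)) ⊗ₜ b := by
        induction s using TensorProduct.induction_on with
        | zero => simp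
        | add x y hx hy => simp only [map_add, TensorProduct.add_tmul, hx, hy]
        | tmul b c => simp [J, N.act_mul]
      rw [LinearMap.rTensor_tmul, h4, mul_antipode_lTensor_comul_apply,
        Algebra.algebraMap_eq_smul_one, map_smul, N.act_one]
      simp [TensorProduct.smul_tmul]
  have := h2 (comul (R := k) h)
  rw [h0, ← Coalgebra.coassoc_apply, h3, Coalgebra.rTensor_counit_comul] at this
  simpa using this

end HopfModule

/-- The right coaction on the dual of a finite-dimensional Hopf algebra: `f₍₀₎(x) f₍₁₎` is
`x₍₁₎ f(x₍₂₎)`. -/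
def dualCoact (k H : Type u) [Field k] [Ring H] [HopfAlgebra k H] [FiniteDimensional k H] :
    Module.Dual k H →ₗ[k] Module.Dual k H ⊗[k] H :=
  (dualTensorHomEquiv k H H).symm.toLinearMap ∘ₗ
    { toFun := fun f => (TensorProduct.rid k H).toLinearMap ∘ₗ f.lTensor H ∘ₗ comul
      map_add' := fun f g => by
        rw [LinearMap.lTensor_add, LinearMap.add_comp, LinearMap.comp_add]
      map_smul' := fun c f => by
        rw [LinearMap.lTensor_smul, LinearMap.smul_comp, LinearMap.comp_smul]; rfl }

variable [FiniteDimensional k H]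

theorem dualTensorHom_dualCoact (f : Module.Dual k H) :
    dualTensorHom k H H (dualCoact k H f) =
      (TensorProduct.rid k H).toLinearMap ∘ₗ f.lTensor H ∘ₗ comul := by
  change dualTensorHom k H H ((dualTensorHomEquiv k H H).symm _) = _
  rw [dualTensorHomEquiv_eq_dualTensorHomEquivOfBasis (Module.finBasis k H),
    dualTensorHomEquivOfBasis_symm_cancel_right]
  rfl

/-- Lets identities in H* ⊗ V be checked after evaluating the first factor at each element of H. -/
theorem dualTensorHom_injective (V : Type u) [AddCommGroup V] [Module k V] :
    Function.Injective (dualTensorHom k H V) := fun a b h => by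
  rw [← dualTensorHomEquivOfBasis_apply (Module.finBasis k H),
    ← dualTensorHomEquivOfBasis_apply (Module.finBasis k H)] at h
  exact (dualTensorHomEquivOfBasis (Module.finBasis k H)).injective h

variable (k H) in
/-- The dual of a finite-dimensional Hopf algebra is a right Hopf module, with
`(f · h)(x) = f(x S(h))`. -/
def dualHopfModule : HopfModule k H (Module.Dual k H) where
  act := LinearMap.lcomp k (Module.Dual k H) ((LinearMap.mul k H).flip ∘ₗ antipode k) ∘ₗ
    LinearMap.llcomp k H H k
  act_one f := by ext x; simp
  act_mul f g h := by ext x; simp [antipode_mul_antidistrib, mul_assoc]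
  coact := dualCoact k H
  coassoc f := by
    apply dualTensorHom_injective
    ext x
    have h1 (t : Module.Dual k H ⊗[k] H) :
        dualTensorHom k H (H ⊗[k] H) ((comul (R := k)).lTensor _ t) x =
          comul (R := k) (dualTensorHom k H H t x) := by
      induction t using TensorProduct.induction_on with
      | zero => simp
      | add x y hx hy => simp only [map_add, LinearMap.add_apply, hx, hy]
      | tmul a b => simp
    have h2 (t : Module.Dual k H ⊗[k] H) :
        dualTensorHom k H (H ⊗[k] H)
          (TensorProduct.assoc k _ H H ((dualCoact k H).rTensor H t)) x =
          (dualTensorHom k H H t).lTensor H (comul (R := k) x) := by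
      induction t using TensorProduct.induction_on with
      | zero => simp
      | add x y hx hy => simp only [map_add, LinearMap.add_apply, LinearMap.lTensor_add, hx, hy]
      | tmul a b =>
        have h3 (s : Module.Dual k H ⊗[k] H) : dualTensorHom k H (H ⊗[k] H)
            (TensorProduct.assoc k _ H H (s ⊗ₜ b)) x = dualTensorHom k H H s x ⊗ₜ b := by
          induction s using TensorProduct.induction_on with
          | zero => simp
          | add x y hx hy =>
            simp only [map_add, TensorProduct.add_tmul, LinearMap.add_apply, hx, hy]
          | tmul c d => simp [TensorProduct.smul_tmul']
        rw [LinearMap.rTensor_tmul, h3, dualTensorHom_dualCoact]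
        simp only [LinearMap.comp_apply, LinearEquiv.coe_coe]
        generalize comul (R := k) x = s
        induction s using TensorProduct.induction_on with
        | zero => simp
        | add x y hx hy => simp only [map_add, TensorProduct.add_tmul, hx, hy]
        | tmul c d => simp [TensorProduct.smul_tmul]
    have h4 :
        comul (R := k) (TensorProduct.rid k H (f.lTensor H (comul (R := k) x))) =
        ((TensorProduct.rid k H).toLinearMap ∘ₗ f.lTensor H).lTensor H
          (TensorProduct.assoc k H H H ((comul (R := k)).rTensor H (comul (R := k) x))) := by
      generalize comul (R := k) x = s
      induction s using TensorProduct.induction_on with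
      | zero => simp
      | add x y hx hy => simp only [map_add, hx, hy]
      | tmul c d =>
        simp only [LinearMap.lTensor_tmul, LinearMap.rTensor_tmul, TensorProduct.rid_tmul, map_smul]
        generalize comul (R := k) c = s
        induction s using TensorProduct.induction_on with
        | zero => simp
        | add x y hx hy => simp only [map_add, smul_add, TensorProduct.add_tmul, hx, hy]
        | tmul c d => simp
    rw [h1, h2, dualTensorHom_dualCoact]
    change _ = comul (R := k) (TensorProduct.rid k H (f.lTensor H (comul (R := k) x)))
    rw [h4, Coalgebra.coassoc_apply, ← LinearMap.lTensor_comp_apply, LinearMap.comp_assoc]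
  counit_coact f := by
    apply dualTensorHom_injective
    ext x
    have h1 (t : Module.Dual k H ⊗[k] H) :
        dualTensorHom k H k ((counit (R := k)).lTensor _ t) x =
          counit (R := k) (dualTensorHom k H H t x) := by
      induction t using TensorProduct.induction_on with
      | zero => simp
      | add x y hx hy => simp only [map_add, LinearMap.add_apply, hx, hy]
      | tmul a b => simp
    have h2 (s : H ⊗[k] H) : counit (R := k) (TensorProduct.rid k H (f.lTensor H s)) =
        f (TensorProduct.lid k H ((counit (R := k)).rTensor H s)) := by
      induction s using TensorProduct.induction_on with
      | zero => simp
      | add x y hx hy => simp only [map_add, hx, hy]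
      | tmul a b => simp [mul_comm]
    rw [h1, dualTensorHom_dualCoact]
    change counit (R := k) (TensorProduct.rid k H (f.lTensor H (comul (R := k) x))) = _
    rw [h2, Coalgebra.rTensor_counit_comul]
    simp
  -- With R(x) = x₍₁₎f(x₍₂₎), the right side at x is R(xS(h₍₁₎))h₍₂₎. Expanding Δ(xS(h₍₁₎)) exposes
  -- Δ(S(h₍₁₎))(h₍₂₎ ⊗ 1), which `antipode_comul_mul` replaces by 1 ⊗ S(h); what remains is
  -- x₍₁₎f(x₍₂₎S(h)).
  coact_act f h := by
    apply dualTensorHom_injective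
    ext x
    let R : H →ₗ[k] H := (TensorProduct.rid k H).toLinearMap ∘ₗ f.lTensor H ∘ₗ comul
    have h1 (t : Module.Dual k H ⊗[k] H) (s : H ⊗[k] H) :
        dualTensorHom k H H (TensorProduct.map₂
          (LinearMap.lcomp k (Module.Dual k H) ((LinearMap.mul k H).flip ∘ₗ antipode k) ∘ₗ
            LinearMap.llcomp k H H k) (LinearMap.mul k H) t s) x =
        LinearMap.mul' k H ((dualTensorHom k H H t ∘ₗ LinearMap.mulLeft k x ∘ₗ
          antipode k).rTensor H s) := by
      induction t using TensorProduct.induction_on with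
      | zero => simp
      | add x y hx hy =>
        simp only [map_add, LinearMap.add_apply, LinearMap.add_comp, LinearMap.rTensor_add, hx, hy]
      | tmul a b =>
        induction s using TensorProduct.induction_on with
        | zero => simp
        | add x y hx hy => simp only [map_add, LinearMap.add_apply, hx, hy]
        | tmul c d => simp
    have h2 (s : H ⊗[k] H) : LinearMap.mul' k H ((R ∘ₗ LinearMap.mulLeft k x ∘ₗ
          antipode k).rTensor H s) =
        TensorProduct.rid k H (f.lTensor H (comul (R := k) x * LinearMap.mul' k (H ⊗[k] H)
          (TensorProduct.map (comul ∘ₗ antipode k)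
            (Algebra.TensorProduct.includeLeft : H →ₐ[k] H ⊗[k] H).toLinearMap s))) := by
      induction s using TensorProduct.induction_on with
      | zero => simp
      | add x y hx hy => simp only [map_add, mul_add, hx, hy]
      | tmul c d =>
        simp only [R, LinearMap.rTensor_tmul, LinearMap.comp_apply, LinearMap.mulLeft_apply,
          Bialgebra.comul_mul, TensorProduct.map_tmul, LinearMap.mul'_apply, ← mul_assoc]
        generalize comul (R := k) x * comul (R := k) (antipode k c) = t
        induction t using TensorProduct.induction_on with
        | zero => simp
        | add x y hx hy => simp only [map_add, add_mul, hx, hy]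
        | tmul a b => simp
    rw [h1, dualTensorHom_dualCoact, dualTensorHom_dualCoact]
    refine Eq.trans ?_ (h2 _).symm
    rw [antipode_comul_mul]
    simp only [LinearMap.comp_apply]
    generalize comul (R := k) x = t
    induction t using TensorProduct.induction_on with
    | zero => simp
    | add x y hx hy => simp only [map_add, add_mul, hx, hy]
    | tmul a b => simp

variable (k H) in
/-- The antipode of a finite-dimensional Hopf algebra is injective (Larson–Sweedler). -/
theorem antipode_injective : Function.Injective (antipode k : H → H) := by
  let N := dualHopfModule k H
  -- If the projection vanished, `lift_proj_coact` would force ε = 0, contrary to ε(1) = 1.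
  have hne : ∃ f, N.proj f ≠ 0 := by
    by_contra! h0
    have h1 : N.proj = 0 := LinearMap.ext h0
    have h2 := N.lift_proj_coact (counit : Module.Dual k H)
    rw [h1, LinearMap.rTensor_zero] at h2
    have h3 := LinearMap.congr_fun h2 (1 : H)
    simp at h3
  obtain ⟨f, hf⟩ := hne
  refine (injective_iff_map_eq_zero (antipode k : H →ₗ[k] H)).2 fun h hh => ?_
  -- The action of h on H* involves h only through S(h).
  have h0 : N.act (N.proj f) h = 0 := by
    change (N.proj f) ∘ₗ (LinearMap.mul k H).flip (antipode k h) = 0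
    rw [hh, map_zero, LinearMap.comp_zero]
  have h1 := N.tmul_eq_zero_of_act_eq_zero (N.coact_proj f) h0
  obtain ⟨φ, hφ⟩ : ∃ φ : Module.Dual k (Module.Dual k H), φ (N.proj f) ≠ 0 := by
    by_contra! h2
    exact hf ((Module.forall_dual_apply_eq_zero_iff k _).1 h2)
  have h2 := congrArg (TensorProduct.lid k H ∘ φ.rTensor H) h1
  simp only [Function.comp_apply, LinearMap.rTensor_tmul, TensorProduct.lid_tmul, map_zero] at h2
  exact (smul_eq_zero.1 h2).resolve_left hφ

end Antipode

/-! ### Skew antipodes -/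

section SkewAntipode

open Coalgebra HopfAlgebra

/-- A map `T` with `h₍₂₎ T(h₍₁₎) = ε(h)`. -/
def IsSkewAntipode {k H : Type u} [Field k] [Ring H] [Bialgebra k H] (T : H →ₗ[k] H) : Prop :=
  ∀ h : H, LinearMap.mul' k H (T.lTensor H (TensorProduct.comm k H H (comul (R := k) h))) =
    algebraMap k H (counit (R := k) h)

variable {k : Type u} [Field k] {H C : Type u} [Ring H] [HopfAlgebra k H] [Ring C] [Bialgebra k C]

variable (k H) in
-- The inverse of the antipode works: S sends h₍₂₎S⁻¹(h₍₁₎) to h₍₁₎S(h₍₂₎) = ε(h)1, and S is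
-- injective. Finite dimension makes the injective S bijective.
theorem exists_isSkewAntipode [FiniteDimensional k H] : ∃ T : H →ₗ[k] H, IsSkewAntipode T := by
  let e := LinearEquiv.ofInjectiveEndo (antipode k : H →ₗ[k] H) (antipode_injective k H)
  have he (x : H) : antipode k (e.symm x) = x := e.apply_symm_apply x
  refine ⟨e.symm.toLinearMap, fun h => antipode_injective k H ?_⟩
  have key (s : H ⊗[k] H) : antipode k (LinearMap.mul' k H (e.symm.toLinearMap.lTensor H
      (TensorProduct.comm k H H s))) = LinearMap.mul' k H ((antipode k).lTensor H s) := by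
    induction s using TensorProduct.induction_on with
    | zero => simp
    | add x y hx hy => simp only [map_add, hx, hy]
    | tmul a b => simp [antipode_mul_antidistrib, he]
  rw [key, mul_antipode_lTensor_comul_apply, Algebra.algebraMap_eq_smul_one, map_smul,
    antipode_one]

/-- The comultiplication of `Cop H` has its legs exchanged, so the skew identity there is the
antipode axiom h₍₁₎S(h₍₂₎) = ε(h) of H. No inverse of S is involved. -/
theorem isSkewAntipode_cop :
    IsSkewAntipode (k := k) (H := Cop H) (antipode k (A := H)) := fun h => by
  have h0 := mul_antipode_lTensor_comul_apply (R := k) (A := H) h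
  have h1 : TensorProduct.comm k (Cop H) (Cop H) (comul (R := k) h) =
      (comul (R := k) (A := H) h : H ⊗[k] H) :=
    (TensorProduct.comm k H H).symm_apply_apply _
  rw [h1]
  exact h0

theorem IsSkewAntipode.map {T : H →ₗ[k] H} {S : C →ₗ[k] C}
    (hT : IsSkewAntipode T) (hS : IsSkewAntipode S) :
    IsSkewAntipode (TensorProduct.map T S) := fun h => by
  induction h using TensorProduct.induction_on with
  | zero => simp
  | add x y hx hy => simp only [map_add, hx, hy]
  | tmul g h =>
    have key (s : H ⊗[k] H) (t : C ⊗[k] C) :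
        LinearMap.mul' k (H ⊗[k] C) ((TensorProduct.map T S).lTensor (H ⊗[k] C)
          (TensorProduct.comm k (H ⊗[k] C) (H ⊗[k] C)
            (TensorProduct.AlgebraTensorModule.tensorTensorTensorComm k k k k H H C C
              (s ⊗ₜ t)))) =
        LinearMap.mul' k H (T.lTensor H (TensorProduct.comm k H H s)) ⊗ₜ
          LinearMap.mul' k C (S.lTensor C (TensorProduct.comm k C C t)) := by
      induction s using TensorProduct.induction_on with
      | zero => simp
      | add x y hx hy => simp only [map_add, TensorProduct.add_tmul, hx, hy]
      | tmul a b =>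
        induction t using TensorProduct.induction_on with
        | zero => simp
        | add x y hx hy => simp only [map_add, TensorProduct.tmul_add, hx, hy]
        | tmul c d => simp
    rw [TensorProduct.comul_tmul, key, hT, hS]
    simp [Algebra.algebraMap_eq_smul_one, Algebra.TensorProduct.one_def, TensorProduct.smul_tmul',
      TensorProduct.tmul_smul, smul_smul, mul_comm]

end SkewAntipode

end HopfWall

namespace HopfWall

/-! ### Eilenberg–Watts: right exact functors and the bimodule F(A) -/

section Watts

open FDMod

variable {k : Type u} [Field k] {A C : Type u} [Ring A] [Algebra k A] [Ring C] [Algebra k C]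

namespace FDMod

@[simp]
theorem lin_add {X Y : FDMod k A} (f g : X ⟶ Y) : lin (f + g) = lin f + lin g := rfl

@[simp]
theorem lin_sub {X Y : FDMod k A} (f g : X ⟶ Y) : lin (f - g) = lin f - lin g := rfl

@[simp]
theorem lin_smul {X Y : FDMod k A} (c : k) (f : X ⟶ Y) : lin (c • f) = c • lin f := rfl

/-- The linear map underlying a morphism, as a linear function of the morphism. -/
def linₗ (X Y : FDMod k A) : (X ⟶ Y) →ₗ[k] (X.carrier →ₗ[k] Y.carrier) where
  toFun := lin
  map_add' _ _ := rfl
  map_smul' _ _ := rfl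

theorem lin_sum {X Y : FDMod k A} {ι : Type*} (s : Finset ι) (f : ι → (X ⟶ Y)) :
    lin (∑ i ∈ s, f i) = ∑ i ∈ s, lin (f i) :=
  map_sum (linₗ X Y) f s

theorem lin_comp_apply {X Y Z : FDMod k A} (f : X ⟶ Y) (g : Y ⟶ Z) (x : X.carrier) :
    lin (f ≫ g) x = lin g (lin f x) := rfl

theorem lin_act {X Y : FDMod k A} (f : X ⟶ Y) (a : A) (x : X.carrier) :
    lin f (X.act a x) = Y.act a (lin f x) :=
  LinearMap.congr_fun (lin_comm f a) x

variable [FiniteDimensional k A]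

/-- The morphism `a ↦ a m` from the regular module. -/
def orbit (M : FDMod k A) : M.carrier →ₗ[k] (regular k A ⟶ M) where
  toFun m := mkHom (M.act.toLinearMap.flip m) fun a => LinearMap.ext fun (b : A) => by
    change M.act (a * b) m = M.act a (M.act b m)
    rw [map_mul]; rfl
  map_add' m n := hom_ext (map_add _ m n)
  map_smul' c m := hom_ext (map_smul _ c m)

/-- Elements of M correspond to morphisms out of the regular module; this is the naturality of that
correspondence. -/
theorem orbit_comp {M N : FDMod k A} (m : M.carrier) (g : M ⟶ N) :
    orbit M m ≫ g = orbit N (lin g m) :=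
  hom_ext (LinearMap.ext fun a => lin_act g a m)

variable (k A) in
/-- The endomorphism `b ↦ ba` of the regular module. -/
def rightMul : A →ₗ[k] (regular k A ⟶ regular k A) := orbit (regular k A)

theorem rightMul_comp_orbit (M : FDMod k A) (a : A) (m : M.carrier) :
    rightMul k A a ≫ orbit M m = orbit M (M.act a m) :=
  orbit_comp (M := regular k A) a (orbit M m)

theorem rightMul_one : rightMul k A 1 = 𝟙 _ :=
  hom_ext (show (LinearMap.mul k A).flip 1 = LinearMap.id by ext; simp)

variable (k A) in
/-- The free module `A ⊗ V`. -/
abbrev free (V : Type u) [AddCommGroup V] [Module k V] [FiniteDimensional k V] : FDMod k A where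
  carrier := A ⊗[k] V
  act := (Module.End.rTensorAlgHom k A V).comp (Algebra.lmul k A)

variable (V : Type u) [AddCommGroup V] [Module k V] [FiniteDimensional k V]

/-- The morphism `a ↦ a ⊗ v`. -/
def freeInsert : V →ₗ[k] (regular k A ⟶ free k A V) where
  toFun v := mkHom (Y := free k A V) ((TensorProduct.mk k A V).flip v) fun _ =>
    LinearMap.ext fun _ => rfl
  map_add' m n := hom_ext (map_add _ m n)
  map_smul' c m := hom_ext (map_smul _ c m)

/-- The morphism `a ⊗ v ↦ φ(v) a`. -/
def freeCoord (φ : V →ₗ[k] k) : free k A V ⟶ regular k A :=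
  mkHom (X := free k A V) (Y := regular k A) ((TensorProduct.rid k A).toLinearMap ∘ₗ φ.lTensor A) fun a => by
    refine TensorProduct.ext' fun b v => ?_
    change φ v • (a * b) = a * (φ v • b)
    rw [mul_smul_comm]

/-- The action `A ⊗ M → M` as a morphism of modules. -/
def barAct (M : FDMod k A) : free k A M.carrier ⟶ M :=
  mkHom (X := free k A M.carrier) (TensorProduct.lift M.act.toLinearMap) fun a =>
    TensorProduct.ext' fun b m => by
      change M.act (a * b) m = M.act a (M.act b m)
      rw [map_mul]; rfl

/-- The morphism `a ⊗ (b ⊗ m) ↦ ab ⊗ m - a ⊗ bm`. -/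
def barDiff (M : FDMod k A) : free k A (A ⊗[k] M.carrier) ⟶ free k A M.carrier :=
  mkHom (X := free k A (A ⊗[k] M.carrier)) (Y := free k A M.carrier)
    ((LinearMap.mul' k A).rTensor M.carrier ∘ₗ (TensorProduct.assoc k A A M.carrier).symm -
      (TensorProduct.lift M.act.toLinearMap).lTensor A) fun a =>
    TensorProduct.ext_threefold' fun b c m => by
      change (a * b * c) ⊗ₜ[k] m - (a * b) ⊗ₜ[k] M.act c m =
        (Module.End.rTensorAlgHom k A M.carrier) (Algebra.lmul k A a)
          ((b * c) ⊗ₜ[k] m - b ⊗ₜ[k] M.act c m)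
      rw [map_sub, mul_assoc]
      rfl

/-- The k-linear map s ↦ 1 ⊗ s is a contracting homotopy: the differential sends 1 ⊗ s to s minus 1
⊗ (its image in M), so an s killed by the action is the boundary of 1 ⊗ s. -/
theorem bar_exact (M : FDMod k A) : Function.Exact (lin (barDiff M)) (lin (barAct M)) := by
  intro t
  constructor
  · intro ht
    refine ⟨(1 : A) ⊗ₜ[k] (show A ⊗[k] M.carrier from t), ?_⟩
    have key (s : A ⊗[k] M.carrier) : lin (barDiff M) ((1 : A) ⊗ₜ[k] s) =
        s - (1 : A) ⊗ₜ[k] (lin (barAct M) s) := by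
      induction s using TensorProduct.induction_on with
      | zero => rw [TensorProduct.tmul_zero, map_zero, map_zero, TensorProduct.tmul_zero, sub_zero]
      | add x y hx hy =>
        rw [TensorProduct.tmul_add, map_add, map_add, TensorProduct.tmul_add, hx, hy]
        abel
      | tmul a m =>
        change (1 * a) ⊗ₜ[k] m - (1 : A) ⊗ₜ[k] M.act a m = _
        rw [one_mul]; rfl
    rw [key, ht, TensorProduct.tmul_zero, sub_zero]
  · rintro ⟨s, rfl⟩
    have : barDiff M ≫ barAct M = 0 := by
      refine hom_ext (TensorProduct.ext_threefold' fun a b m => ?_)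
      change lin (barAct M) ((a * b) ⊗ₜ[k] m - a ⊗ₜ[k] M.act b m) = 0
      rw [map_sub]
      change M.act (a * b) m - M.act a (M.act b m) = 0
      rw [map_mul, sub_eq_zero]; rfl
    rw [← lin_comp_apply, this]; rfl

theorem barAct_surjective (M : FDMod k A) : Function.Surjective (lin (barAct M)) := fun m =>
  ⟨(1 : A) ⊗ₜ[k] m, by
    change M.act 1 m = m
    rw [map_one]; rfl⟩

section Functor

variable (F : FDMod k A ⥤ FDMod k C) [F.Additive] [F.Linear k]

/-- The linear map `F(X) ⊗ V → F(Y)` given by a linear family of morphisms `X ⟶ Y`. -/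
def pairing {X Y : FDMod k A} {V : Type u} [AddCommGroup V] [Module k V] (p : V →ₗ[k] (X ⟶ Y)) :
    (F.obj X).carrier ⊗[k] V →ₗ[k] (F.obj Y).carrier :=
  TensorProduct.lift (linₗ _ _ ∘ₗ F.mapLinearMap k ∘ₗ p).flip

omit [FiniteDimensional k A] in
@[simp]
theorem pairing_tmul {X Y : FDMod k A} {V : Type u} [AddCommGroup V] [Module k V]
    (p : V →ₗ[k] (X ⟶ Y)) (y : (F.obj X).carrier) (v : V) :
    pairing F p (y ⊗ₜ v) = lin (F.map (p v)) y := rfl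

/-- The linear map `F(A) ⊗ M → F(M)`, `y ⊗ m ↦ F(a ↦ am)(y)`. -/
def evalMap (M : FDMod k A) :
    (F.obj (regular k A)).carrier ⊗[k] M.carrier →ₗ[k] (F.obj M).carrier :=
  pairing F (orbit M)

@[simp]
theorem evalMap_tmul (M : FDMod k A) (y : (F.obj (regular k A)).carrier) (m : M.carrier) :
    evalMap F M (y ⊗ₜ m) = lin (F.map (orbit M m)) y := rfl

/-- The right action of `A` on `F(A)`. -/
def rightAct : A →ₗ[k] Module.End k (F.obj (regular k A)).carrier :=
  linₗ _ _ ∘ₗ F.mapLinearMap k ∘ₗ rightMul k A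

theorem rightAct_apply (a : A) : rightAct F a = lin (F.map (rightMul k A a)) := rfl

/-- The linear map `Y ⊗ (A ⊗ M) → Y ⊗ M`, `y ⊗ (a ⊗ m) ↦ ya ⊗ m - y ⊗ am`. -/
def balancing {Y : Type u} [AddCommGroup Y] [Module k Y] (r : A →ₗ[k] Module.End k Y)
    (M : FDMod k A) : Y ⊗[k] (A ⊗[k] M.carrier) →ₗ[k] Y ⊗[k] M.carrier :=
  (TensorProduct.lift r.flip).rTensor M.carrier ∘ₗ
      (TensorProduct.assoc k Y A M.carrier).symm.toLinearMap -
    (TensorProduct.lift M.act.toLinearMap).lTensor Y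

omit [FiniteDimensional k A] in
@[simp]
theorem balancing_tmul {Y : Type u} [AddCommGroup Y] [Module k Y] (r : A →ₗ[k] Module.End k Y)
    (M : FDMod k A) (y : Y) (a : A) (m : M.carrier) :
    balancing r M (y ⊗ₜ (a ⊗ₜ m)) = r a y ⊗ₜ m - y ⊗ₜ M.act a m := rfl

/-- A ⊗ V is a finite direct sum of copies of A, and an additive functor preserves biproducts. A
basis of V supplies the insertions and coordinates from which the inverse is built. -/
theorem pairing_freeInsert_bijective :
    Function.Bijective (pairing F (freeInsert (A := A) V)) := by
  let b := Module.finBasis k V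
  let inv : (F.obj (free k A V)).carrier →ₗ[k] (F.obj (regular k A)).carrier ⊗[k] V :=
    ∑ i, (TensorProduct.mk k _ V).flip (b i) ∘ₗ lin (F.map (freeCoord V (b.coord i)))
  have h1 (t) : inv (pairing F (freeInsert (A := A) V) t) = t := by
    induction t using TensorProduct.induction_on with
    | zero => simp
    | add x y hx hy => simp only [map_add, hx, hy]
    | tmul y v =>
      have h (i) : freeInsert (A := A) V v ≫ freeCoord V (b.coord i) = b.coord i v • 𝟙 _ :=
        hom_ext rfl
      simp only [inv, pairing_tmul, LinearMap.sum_apply, LinearMap.comp_apply]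
      simp only [← lin_comp_apply, ← F.map_comp, h, F.map_smul, F.map_id, lin_smul, lin_id,
        LinearMap.smul_apply, LinearMap.id_apply, map_smul, LinearMap.flip_apply,
        TensorProduct.mk_apply]
      simp only [← TensorProduct.tmul_smul, ← TensorProduct.tmul_sum, Module.Basis.coord_apply,
        b.sum_repr]
  have h2 (z) : pairing F (freeInsert (A := A) V) (inv z) = z := by
    have h : ∑ i, freeCoord V (b.coord i) ≫ freeInsert (A := A) V (b i) = 𝟙 _ := by
      refine hom_ext (TensorProduct.ext' fun a v => ?_)
      rw [lin_sum, LinearMap.sum_apply]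
      change ∑ i, (b.repr v i • a) ⊗ₜ[k] b i = a ⊗ₜ v
      simp only [TensorProduct.smul_tmul, ← TensorProduct.tmul_sum, b.sum_repr]
    simp only [inv, LinearMap.sum_apply, map_sum, LinearMap.comp_apply, LinearMap.flip_apply,
      TensorProduct.mk_apply, pairing_tmul]
    simp only [← lin_comp_apply, ← F.map_comp]
    rw [← LinearMap.sum_apply, ← lin_sum, ← F.map_sum, h, F.map_id]
    rfl
  exact Function.bijective_iff_has_inverse.2 ⟨inv, h1, h2⟩

/-- Under F(A) ⊗ M ≅ F(A ⊗ M) the evaluation becomes F of the last map of the bar presentation;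
`map_barDiff_pairing` treats the first map in the same way. -/
theorem evalMap_eq (M : FDMod k A) :
    evalMap F M = lin (F.map (barAct M)) ∘ₗ pairing F (freeInsert M.carrier) := by
  refine TensorProduct.ext' fun y m => ?_
  rw [LinearMap.comp_apply, pairing_tmul, ← lin_comp_apply, ← F.map_comp]
  rfl

theorem map_barDiff_pairing (M : FDMod k A) :
    lin (F.map (barDiff M)) ∘ₗ pairing F (freeInsert (A ⊗[k] M.carrier)) =
      pairing F (freeInsert M.carrier) ∘ₗ balancing (rightAct F) M := by
  refine TensorProduct.ext_threefold' fun y a m => ?_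
  have h : freeInsert (A ⊗[k] M.carrier) (a ⊗ₜ m) ≫ barDiff M =
      rightMul k A a ≫ freeInsert M.carrier m - freeInsert M.carrier (M.act a m) :=
    hom_ext rfl
  rw [LinearMap.comp_apply, LinearMap.comp_apply, pairing_tmul, ← lin_comp_apply, ← F.map_comp, h,
    F.map_sub, F.map_comp, balancing_tmul, map_sub, pairing_tmul, pairing_tmul]
  rfl

variable {F} (hF : RightExact F)
include hF

theorem evalMap_surjective (M : FDMod k A) : Function.Surjective (evalMap F M) := by
  rw [evalMap_eq, LinearMap.coe_comp]
  exact (hF _ _ (bar_exact M) (barAct_surjective M)).2.comp (pairing_freeInsert_bijective _ F).2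

/-- F keeps the bar presentation exact and takes its free terms to F(A) ⊗ (A ⊗ M) and F(A) ⊗ M.
Together with surjectivity this identifies F(M) with F(A) ⊗_A M. -/
theorem evalMap_exact (M : FDMod k A) :
    Function.Exact (balancing (rightAct F) M) (evalMap F M) := by
  have hE := (hF _ _ (bar_exact M) (barAct_surjective M)).1
  have hD := fun s => LinearMap.congr_fun (map_barDiff_pairing F M) s
  simp only [LinearMap.comp_apply] at hD
  intro t
  rw [evalMap_eq, LinearMap.comp_apply, hE]
  constructor
  · rintro ⟨s, hs⟩
    obtain ⟨s, rfl⟩ := (pairing_freeInsert_bijective _ F).2 s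
    rw [hD] at hs
    exact ⟨s, (pairing_freeInsert_bijective _ F).1 hs⟩
  · rintro ⟨s, rfl⟩
    exact ⟨_, hD s⟩

/-- The elements F(a ↦ am)(y) span F(M), because `evalMap` is surjective. They serve as generators
in every later check on F(M). -/
theorem ext_of_rightExact {M : FDMod k A} {W : Type u} [AddCommGroup W] [Module k W]
    {f g : (F.obj M).carrier →ₗ[k] W}
    (h : ∀ m y, f (lin (F.map (orbit M m)) y) = g (lin (F.map (orbit M m)) y)) : f = g := by
  have h' : f ∘ₗ evalMap F M = g ∘ₗ evalMap F M := TensorProduct.ext' fun y m => h m y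
  ext z
  obtain ⟨t, rfl⟩ := evalMap_surjective hF M z
  exact LinearMap.congr_fun h' t

omit [F.Additive] [F.Linear k] hF in
theorem natTrans_app_map_orbit {G : FDMod k A ⥤ FDMod k C} (α : F ⟶ G) (M : FDMod k A)
    (m : M.carrier) (y : (F.obj (regular k A)).carrier) :
    lin (α.app M) (lin (F.map (orbit M m)) y) =
      lin (G.map (orbit M m)) (lin (α.app (regular k A)) y) := by
  rw [← lin_comp_apply, ← lin_comp_apply, α.naturality]

theorem natTrans_ext_of_rightExact {G : FDMod k A ⥤ FDMod k C} {α β : F ⟶ G}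
    (h : α.app (regular k A) = β.app (regular k A)) : α = β := by
  ext M : 2
  refine hom_ext (ext_of_rightExact hF fun m y => ?_)
  rw [natTrans_app_map_orbit, natTrans_app_map_orbit, h]

/-- The component at M is forced to send F(a ↦ am)(y) to G(a ↦ am)(f(y)). This is well defined since
F(M) is F(A) ⊗ M modulo the balancing relations, which f respects. Right exactness of G plays no
role. -/
theorem exists_natTrans {G : FDMod k A ⥤ FDMod k C} [G.Additive] [G.Linear k]
    (f : F.obj (regular k A) ⟶ G.obj (regular k A))
    (hf : ∀ a, lin f ∘ₗ rightAct F a = rightAct G a ∘ₗ lin f) :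
    ∃ α : F ⟶ G, α.app (regular k A) = f := by
  have hb (M : FDMod k A) (t) : evalMap G M ((lin f).rTensor _ (balancing (rightAct F) M t)) = 0 := by
    rw [← LinearMap.comp_apply, ← LinearMap.comp_apply]
    refine LinearMap.congr_fun (f := _) (g := 0) (TensorProduct.ext_threefold' fun y a m => ?_) t
    have h1 := LinearMap.congr_fun (hf a) y
    simp only [LinearMap.comp_apply] at h1
    rw [LinearMap.comp_apply, LinearMap.comp_apply, balancing_tmul, map_sub, map_sub,
      LinearMap.rTensor_tmul, LinearMap.rTensor_tmul, h1, evalMap_tmul, evalMap_tmul,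
      rightAct_apply, ← lin_comp_apply, ← G.map_comp, rightMul_comp_orbit]
    exact sub_self _
  have hex (M : FDMod k A) : ∃ g : (F.obj M).carrier →ₗ[k] (G.obj M).carrier,
      ∀ t, g (evalMap F M t) = evalMap G M ((lin f).rTensor _ t) := by
    have hker : LinearMap.ker (evalMap F M) ≤
        LinearMap.ker (evalMap G M ∘ₗ (lin f).rTensor M.carrier) := by
      intro t ht
      obtain ⟨s, rfl⟩ := (evalMap_exact hF M t).1 ht
      exact hb M s
    refine ⟨(LinearMap.ker (evalMap F M)).liftQ _ hker ∘ₗ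
      ((evalMap F M).quotKerEquivOfSurjective (evalMap_surjective hF M)).symm.toLinearMap,
      fun t => ?_⟩
    have : ((evalMap F M).quotKerEquivOfSurjective (evalMap_surjective hF M)).symm
        (evalMap F M t) = Submodule.Quotient.mk t :=
      (LinearEquiv.symm_apply_eq _).2 rfl
    rw [LinearMap.comp_apply, LinearEquiv.coe_coe, this]
    rfl
  choose g hg using hex
  have hg' (M : FDMod k A) (m : M.carrier) (y) : g M (lin (F.map (orbit M m)) y) =
      lin (G.map (orbit M m)) (lin f y) := hg M (y ⊗ₜ m)
  refine ⟨{ app := fun M => mkHom (g M) fun c => ext_of_rightExact hF fun m y => ?_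
            naturality := fun M N h => hom_ext (ext_of_rightExact hF fun m y => ?_) }, ?_⟩
  · rw [LinearMap.comp_apply, ← lin_act, hg', LinearMap.comp_apply, hg', lin_act, lin_act]
  · rw [lin_comp_apply, lin_mkHom, ← lin_comp_apply, ← F.map_comp, orbit_comp, hg', lin_comp_apply,
      lin_mkHom, hg', ← lin_comp_apply (G.map (orbit M m)), ← G.map_comp, orbit_comp]
  -- On the regular module the orbit map of m is right multiplication by m, so `hf` identifies the
  -- component with f.
  · refine hom_ext (ext_of_rightExact hF fun m y => ?_)
    have h1 := LinearMap.congr_fun (hf m) y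
    rw [lin_mkHom, hg']
    exact h1.symm

end Functor

end FDMod

end Watts

end HopfWall

namespace HopfWall

open scoped MonoidalLeftAction MonoidalRightAction

/-! ### From module functors to covariant bimodules -/

section LeftLinear

open FDMod Functor.LaxLeftLinear Functor.OplaxLeftLinear

variable {k : Type u} [Field k] {H A : Type u} [Ring H] [Bialgebra k H] [Ring A] [Algebra k A]
  [LeftComoduleAlgebra k H A]

/-- Bridges the two notations for a factorwise action: the one in tensor products of modules and the
one in the definition of covariant bimodules. -/
theorem tensorAct_eq_homTensorHomMap {C D V W : Type u} [Ring C] [Algebra k C] [Ring D]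
    [Algebra k D] [AddCommGroup V] [Module k V] [AddCommGroup W] [Module k W]
    (f : C →ₐ[k] Module.End k V) (g : D →ₐ[k] Module.End k W) (t : C ⊗[k] D) :
    tensorAct f g t = TensorProduct.homTensorHomMap (.id k) V W V W
      (TensorProduct.map f.toLinearMap g.toLinearMap t) := by
  induction t using TensorProduct.induction_on with
  | zero => simp
  | add x y hx hy => simp only [map_add, hx, hy]
  | tmul a b => simp

section Structure

variable (F G : FDMod k A ⥤ FDMod k A) [F.LeftLinear (FDMod k H)] [G.LeftLinear (FDMod k H)]

theorem map_actionHom_comp_δₗ {X X' : FDMod k H} {M M' : FDMod k A} (f : X ⟶ X') (g : M ⟶ M') :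
    F.map (f ⊙ₗₘ g) ≫ δₗ F X' M' = δₗ F X M ≫ (f ⊙ₗₘ F.map g) := by
  rw [MonoidalLeftAction.actionHom_def, MonoidalLeftAction.actionHom_def, F.map_comp,
    Category.assoc, δₗ_naturality_right, δₗ_naturality_left_assoc]

variable {F G} in
-- Morphisms of module functors are defined through μ, whereas coactions are built from its inverse
-- δ.
theorem comp_δₗ_iff (α : F ⟶ G) (X : FDMod k H) (M : FDMod k A) :
    μₗ F X M ≫ α.app (X ⊙ₗ M) = X ⊴ₗ α.app M ≫ μₗ G X M ↔
      α.app (X ⊙ₗ M) ≫ δₗ G X M = δₗ F X M ≫ X ⊴ₗ α.app M := by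
  constructor
  · intro h
    rw [← cancel_epi (μₗ F X M), ← Category.assoc, h, Category.assoc,
      Functor.LeftLinear.μₗ_comp_δₗ, Category.comp_id, Functor.LeftLinear.μₗ_comp_δₗ_assoc]
  · intro h
    rw [← cancel_mono (δₗ G X M), Category.assoc, h, Category.assoc,
      Functor.LeftLinear.μₗ_comp_δₗ, Category.comp_id, Functor.LeftLinear.μₗ_comp_δₗ_assoc]

variable [FiniteDimensional k H] [FiniteDimensional k A]

variable (k H A) in
/-- The coaction of `A` as a morphism from the regular module. -/
def coactHom : regular k A ⟶ regular k H ⊙ₗ regular k A :=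
  mkHom (Y := regular k H ⊙ₗ regular k A)
    (LeftComoduleAlgebra.coact (k := k) (H := H) (A := A)).toLinearMap fun a => by
    refine LinearMap.ext fun (b : A) => ?_
    change LeftComoduleAlgebra.coact (k := k) (H := H) (a * b) =
      tensorAct (Algebra.lmul k H) (Algebra.lmul k A) (LeftComoduleAlgebra.coact a)
        (LeftComoduleAlgebra.coact b)
    rw [map_mul]
    generalize LeftComoduleAlgebra.coact (k := k) (H := H) a = s
    generalize LeftComoduleAlgebra.coact (k := k) (H := H) b = t
    induction s using TensorProduct.induction_on with
    | zero => simp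
    | add x y hx hy => simp only [map_add, add_mul, LinearMap.add_apply, hx, hy]
    | tmul c d =>
      induction t using TensorProduct.induction_on with
      | zero => simp
      | add x y hx hy => simp only [map_add, mul_add, hx, hy]
      | tmul e f => simp

variable (k H) in
/-- The comultiplication of `H` as a morphism of representations. -/
def comulHom : regular k H ⟶ regular k H ⊗ regular k H :=
  mkHom (Y := regular k H ⊗ regular k H) (Bialgebra.comulAlgHom k H).toLinearMap fun a => by
    refine LinearMap.ext fun (b : H) => ?_
    change Bialgebra.comulAlgHom k H (a * b) =
      tensorAct (Algebra.lmul k H) (Algebra.lmul k H) (Bialgebra.comulAlgHom k H a)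
        (Bialgebra.comulAlgHom k H b)
    rw [map_mul]
    generalize Bialgebra.comulAlgHom k H a = s
    generalize Bialgebra.comulAlgHom k H b = t
    induction s using TensorProduct.induction_on with
    | zero => simp
    | add x y hx hy => simp only [map_add, add_mul, LinearMap.add_apply, hx, hy]
    | tmul c d =>
      induction t using TensorProduct.induction_on with
      | zero => simp
      | add x y hx hy => simp only [map_add, mul_add, hx, hy]
      | tmul e f => simp

variable (k H) in
/-- The counit of `H` as a morphism of representations. -/
def counitHom : regular k H ⟶ 𝟙_ (FDMod k H) :=
  mkHom (Y := 𝟙_ (FDMod k H)) (Bialgebra.counitAlgHom k H).toLinearMap fun a => by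
    refine LinearMap.ext fun b => ?_
    exact map_mul (Bialgebra.counitAlgHom k H) a b

theorem coactHom_coassoc : coactHom k H A ≫ comulHom k H ⊵ₗ regular k A ≫ (αₗ _ _ _).hom =
    coactHom k H A ≫ regular k H ⊴ₗ coactHom k H A :=
  hom_ext (LinearMap.ext fun a => LeftComoduleAlgebra.coassoc (k := k) (H := H) (A := A) a)

theorem coactHom_counit : coactHom k H A ≫ counitHom k H ⊵ₗ regular k A ≫ (λₗ _).hom = 𝟙 _ := by
  refine hom_ext (LinearMap.ext fun a => ?_)
  refine Eq.trans (congrArg (TensorProduct.lid k A)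
    (LeftComoduleAlgebra.counit_coact (k := k) (H := H) (A := A) a)) ?_
  exact (TensorProduct.lid_tmul (R := k) (M := A) a 1).trans (one_smul k _)

/-- Since a acts on x ⊗ m as a₍₋₁₎x ⊗ a₍₀₎m, the orbit of a pure tensor factors through the coaction
of A. This reduces every structure map to the one at the regular modules. -/
theorem coactHom_comp_orbit (X : FDMod k H) (M : FDMod k A) (x : X.carrier) (m : M.carrier) :
    coactHom k H A ≫ (orbit X x ⊙ₗₘ orbit M m) = orbit (X ⊙ₗ M) (x ⊗ₜ[k] m) := by
  refine hom_ext (LinearMap.ext fun a => ?_)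
  change TensorProduct.map (X.act.toLinearMap.flip x) (M.act.toLinearMap.flip m)
    (LeftComoduleAlgebra.coact (k := k) (H := H) (A := A) a) =
    tensorAct X.act M.act (LeftComoduleAlgebra.coact a) (x ⊗ₜ m)
  generalize LeftComoduleAlgebra.coact (k := k) (H := H) (A := A) a = t
  induction t using TensorProduct.induction_on with
  | zero => simp
  | add x y hx hy => simp only [map_add, LinearMap.add_apply, hx, hy]
  | tmul h b => rfl

theorem rightMul_comp_coactHom (a : A) : rightMul k A a ≫ coactHom k H A =
    orbit (regular k H ⊙ₗ regular k A) (LeftComoduleAlgebra.coact (k := k) (H := H) (A := A) a) :=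
  orbit_comp (M := regular k A) a (coactHom k H A)

/-- The coaction of `H` on `F(A)` as a morphism of modules. -/
def coactMap : F.obj (regular k A) ⟶ regular k H ⊙ₗ F.obj (regular k A) :=
  F.map (coactHom k H A) ≫ δₗ F (regular k H) (regular k A)

/-- Naturality and associativity of δ move the identity inside F, where it is the coassociativity of
A. -/
theorem coactMap_coassoc :
    coactMap (H := H) F ≫ comulHom k H ⊵ₗ F.obj (regular k A) ≫ (αₗ _ _ _).hom =
      coactMap F ≫ regular k H ⊴ₗ coactMap F := by
  rw [coactMap, Category.assoc, ← δₗ_naturality_left_assoc, δₗ_associativity, ← F.map_comp_assoc,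
    ← F.map_comp_assoc, Category.assoc, coactHom_coassoc, F.map_comp_assoc, δₗ_naturality_right_assoc,
    MonoidalLeftAction.actionHomRight_comp, Category.assoc]

theorem coactMap_counit :
    coactMap (H := H) F ≫ counitHom k H ⊵ₗ F.obj (regular k A) ≫ (λₗ _).hom = 𝟙 _ := by
  rw [coactMap, Category.assoc, ← δₗ_naturality_left_assoc, δₗ_unitality_hom, ← F.map_comp,
    ← F.map_comp, coactHom_counit, F.map_id]

/-- The coaction on F(A) thus controls all of δ: on generators δ is y ⊗ (x ⊗ m) ↦ y₍₋₁₎x ⊗ (y₍₀₎ ⊗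
m), read through F(A) ⊗ M → F(M). The proof is naturality of δ in both variables. -/
theorem map_orbit_comp_δₗ (X : FDMod k H) (M : FDMod k A) (x : X.carrier) (m : M.carrier) :
    F.map (orbit (X ⊙ₗ M) (x ⊗ₜ[k] m)) ≫ δₗ F X M =
      coactMap F ≫ (orbit X x ⊙ₗₘ F.map (orbit M m)) := by
  rw [← coactHom_comp_orbit, F.map_comp, Category.assoc, map_actionHom_comp_δₗ, coactMap,
    Category.assoc]

theorem comp_coactMap (α : F ⟶ G)
    (hα : ∀ (X : FDMod k H) (M : FDMod k A), α.app (X ⊙ₗ M) ≫ δₗ G X M = δₗ F X M ≫ X ⊴ₗ α.app M) :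
    α.app (regular k A) ≫ coactMap (H := H) G =
      coactMap F ≫ regular k H ⊴ₗ α.app (regular k A) := by
  rw [coactMap, ← α.naturality_assoc, hα, coactMap, Category.assoc]

variable [F.Additive] [F.Linear k] {F G}

/-- F(X ⊙ M) is spanned by the images of orbit maps, and by linearity only orbits of pure tensors
matter. There `map_orbit_comp_δₗ` expresses both structure maps by the coactions. -/
theorem comp_δₗ_of_comp_coactMap (hF : RightExact F) (α : F ⟶ G)
    (hα : α.app (regular k A) ≫ coactMap (H := H) G =
      coactMap F ≫ regular k H ⊴ₗ α.app (regular k A)) (X : FDMod k H) (M : FDMod k A) :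
    α.app (X ⊙ₗ M) ≫ δₗ G X M = δₗ F X M ≫ X ⊴ₗ α.app M := by
  have hα' : α.app (regular k A) ≫ coactMap (H := H) G =
      coactMap F ≫ (𝟙 (regular k H) ⊙ₗₘ α.app (regular k A)) := by
    rw [MonoidalLeftAction.id_actionHom, hα]
  refine hom_ext (ext_of_rightExact hF fun t y => ?_)
  rw [← lin_comp_apply, ← lin_comp_apply]
  refine LinearMap.congr_fun (?_ : lin _ = lin _) y
  congr 1
  rw [← MonoidalLeftAction.id_actionHom]
  induction t using TensorProduct.induction_on with
  | zero =>
    erw [map_zero]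
    simp
  | add s t hs ht =>
    erw [map_add]
    rw [F.map_add, Preadditive.add_comp, Preadditive.add_comp, hs, ht]
  | tmul x m =>
    rw [← Category.assoc, α.naturality, Category.assoc, map_orbit_comp_δₗ, reassoc_of% hα',
      ← Category.assoc (F.map _), map_orbit_comp_δₗ, Category.assoc,
      ← MonoidalLeftAction.actionHom_comp, ← MonoidalLeftAction.actionHom_comp, α.naturality,
      Category.id_comp, Category.comp_id]

variable (F) (H) in
/-- The covariant bimodule `F(A)`. -/
def covariantBimodule : CovariantBimodule k H A where
  carrier := (F.obj (regular k A)).carrier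
  left := (F.obj (regular k A)).act
  right := rightAct F
  right_one := by
    rw [rightAct_apply, rightMul_one, F.map_id]; rfl
  right_mul a b := by
    have : rightMul k A (a * b) = rightMul k A a ≫ rightMul k A b :=
      (rightMul_comp_orbit (regular k A) a b).symm
    rw [rightAct_apply, this, F.map_comp]; rfl
  left_right a b := (lin_comm (F.map (rightMul k A b)) a).symm
  coact := lin (coactMap (H := H) F)
  coassoc y := LinearMap.congr_fun (congrArg lin (coactMap_coassoc (H := H) F)) y
  counit_coact y := by
    have h := LinearMap.congr_fun (congrArg lin (coactMap_counit (H := H) F)) y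
    exact (TensorProduct.lid k _).injective (h.trans (by simp))
  coact_left a y := by
    refine (lin_act (coactMap (H := H) F) a y).trans ?_
    exact LinearMap.congr_fun (tensorAct_eq_homTensorHomMap _ _ _) _
  -- Right multiplication by a followed by the coaction of A is the orbit map of a₍₋₁₎ ⊗ a₍₀₎. On
  -- each pure tensor h ⊗ b, `map_orbit_comp_δₗ` then yields y₍₋₁₎h ⊗ y₍₀₎b.
  coact_right a y := by
    have h : rightMul k A a ≫ coactHom k H A = _ := rightMul_comp_coactHom a
    change lin (coactMap (H := H) F) (lin (F.map (rightMul k A a)) y) = _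
    rw [← lin_comp_apply, coactMap, ← F.map_comp_assoc, h, ← coactMap]
    generalize LeftComoduleAlgebra.coact (k := k) (H := H) (A := A) a = t
    induction t using TensorProduct.induction_on with
    | zero =>
      erw [map_zero]
      simp
      rfl
    | add s t hs ht =>
      erw [map_add]
      rw [F.map_add, Preadditive.add_comp, lin_add, LinearMap.add_apply, hs, ht, map_add, map_add]
      rfl
    | tmul h b =>
      erw [map_orbit_comp_δₗ]
      rfl

end Structure

end LeftLinear

end HopfWall

/-! ### Invertible structure maps from a skew antipode -/

namespace HopfWall

open scoped MonoidalLeftAction MonoidalRightAction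

/-- An oplax linear functor whose structure maps are invertible is linear. -/
abbrev leftLinearOfIsIso {C D D' : Type*} [Category C] [Category D] [Category D']
    [MonoidalCategory C] [MonoidalLeftAction C D] [MonoidalLeftAction C D'] (F : D ⥤ D')
    [F.OplaxLeftLinear C] [h : ∀ (c : C) (d : D), IsIso (Functor.OplaxLeftLinear.δₗ F c d)] :
    F.LeftLinear C where
  μₗ c d := inv (Functor.OplaxLeftLinear.δₗ F c d)
  μₗ_naturality_left f d := by
    rw [IsIso.comp_inv_eq, Category.assoc, Functor.OplaxLeftLinear.δₗ_naturality_left,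
      IsIso.inv_hom_id_assoc]
  μₗ_naturality_right c _ _ f := by
    rw [IsIso.comp_inv_eq, Category.assoc, Functor.OplaxLeftLinear.δₗ_naturality_right,
      IsIso.inv_hom_id_assoc]
  μₗ_associativity c c' d := by
    rw [IsIso.inv_comp_eq, ← MonoidalLeftAction.inv_actionHomRight,
      Functor.OplaxLeftLinear.δₗ_associativity_assoc]
    simp
  μₗ_unitality d := by
    rw [IsIso.eq_inv_comp, Functor.OplaxLeftLinear.δₗ_unitality_hom]
  μₗ_comp_δₗ c d := IsIso.inv_hom_id _
  δₗ_comp_μₗ c d := IsIso.hom_inv_id _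

open FDMod

section Swap

variable {k : Type u} [Field k] {H : Type u} [Ring H] [Bialgebra k H]
  {Y X V : Type u} [AddCommGroup Y] [Module k Y] [AddCommGroup X] [Module k X] [AddCommGroup V]
  [Module k V]

/-- The map `y ⊗ x ↦ y₍₋₁₎ x ⊗ y₍₀₎`. -/
def coactBraid (ρ : Y →ₗ[k] H ⊗[k] Y) (σ : H →ₐ[k] Module.End k X) : Y ⊗[k] X →ₗ[k] X ⊗[k] Y :=
  (TensorProduct.lift σ.toLinearMap).rTensor Y ∘ₗ
    (TensorProduct.rightComm k H Y X).toLinearMap ∘ₗ ρ.rTensor X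

/-- The map `y ⊗ (x ⊗ v) ↦ y₍₋₁₎ x ⊗ (y₍₀₎ ⊗ v)`. -/
def coactSwap (ρ : Y →ₗ[k] H ⊗[k] Y) (σ : H →ₐ[k] Module.End k X) (V : Type u) [AddCommGroup V]
    [Module k V] : Y ⊗[k] (X ⊗[k] V) →ₗ[k] X ⊗[k] (Y ⊗[k] V) :=
  (TensorProduct.assoc k X Y V).toLinearMap ∘ₗ (coactBraid ρ σ).rTensor V ∘ₗ
    (TensorProduct.assoc k Y X V).symm.toLinearMap

theorem coactBraid_tmul (ρ : Y →ₗ[k] H ⊗[k] Y) (σ : H →ₐ[k] Module.End k X) (y : Y) (x : X) :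
    coactBraid ρ σ (y ⊗ₜ x) = (σ.toLinearMap.flip x).rTensor Y (ρ y) := by
  simp only [coactBraid, LinearMap.comp_apply, LinearMap.rTensor_tmul, LinearEquiv.coe_coe]
  generalize ρ y = t
  induction t using TensorProduct.induction_on with
  | zero => simp
  | add x y hx hy => simp only [map_add, TensorProduct.add_tmul, hx, hy]
  | tmul h y => simp

theorem coactSwap_tmul (ρ : Y →ₗ[k] H ⊗[k] Y) (σ : H →ₐ[k] Module.End k X) (y : Y) (x : X) (v : V) :
    coactSwap ρ σ V (y ⊗ₜ (x ⊗ₜ v)) =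
      TensorProduct.map (σ.toLinearMap.flip x) ((TensorProduct.mk k Y V).flip v) (ρ y) := by
  simp only [coactSwap, LinearMap.comp_apply, LinearEquiv.coe_coe, TensorProduct.assoc_symm_tmul,
    LinearMap.rTensor_tmul, coactBraid_tmul]
  generalize ρ y = t
  induction t using TensorProduct.induction_on with
  | zero => simp
  | add x y hx hy => simp only [map_add, TensorProduct.add_tmul, hx, hy]
  | tmul h y => simp

/-- A preimage of x ⊗ y is y₍₀₎ ⊗ T(y₍₋₁₎)x: by coassociativity it maps to y₍₋₁₎T(y₍₋₂₎)x ⊗ y₍₀₎,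
and the defining identity of T leaves x ⊗ y. -/
theorem coactBraid_surjective {T : H →ₗ[k] H} (hT : IsSkewAntipode T) (ρ : Y →ₗ[k] H ⊗[k] Y)
    (σ : H →ₐ[k] Module.End k X)
    (coassoc : ∀ y, TensorProduct.assoc k H H Y
      ((Bialgebra.comulAlgHom k H).toLinearMap.rTensor Y (ρ y)) = ρ.lTensor H (ρ y))
    (counit : ∀ y, (Bialgebra.counitAlgHom k H).toLinearMap.rTensor Y (ρ y) = 1 ⊗ₜ y) :
    Function.Surjective (coactBraid ρ σ) := by
  have key (x : X) (y : Y) : coactBraid ρ σ (TensorProduct.comm k X Y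
      ((σ.toLinearMap.flip x ∘ₗ T).rTensor Y (ρ y))) = x ⊗ₜ y := by
    -- `G` is a ⊗ (b ⊗ y) ↦ bT(a)x ⊗ y.
    let G : H ⊗[k] (H ⊗[k] Y) →ₗ[k] X ⊗[k] Y :=
      (σ.toLinearMap.flip x ∘ₗ LinearMap.mul' k H ∘ₗ T.lTensor H ∘ₗ
        (TensorProduct.comm k H H).toLinearMap).rTensor Y ∘ₗ
        (TensorProduct.assoc k H H Y).symm.toLinearMap
    have h1 (t : H ⊗[k] Y) : coactBraid ρ σ (TensorProduct.comm k X Y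
        ((σ.toLinearMap.flip x ∘ₗ T).rTensor Y t)) = G (ρ.lTensor H t) := by
      induction t using TensorProduct.induction_on with
      | zero => simp
      | add x y hx hy => simp only [map_add, hx, hy]
      | tmul h y =>
        simp only [LinearMap.rTensor_tmul, TensorProduct.comm_tmul, coactBraid_tmul,
          LinearMap.lTensor_tmul]
        generalize ρ y = t
        induction t using TensorProduct.induction_on with
        | zero => simp
        | add x y hx hy => simp only [map_add, TensorProduct.tmul_add, hx, hy]
        | tmul g y => simp [G]
    have h2 (t : H ⊗[k] Y) : G (TensorProduct.assoc k H H Y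
        ((Bialgebra.comulAlgHom k H).toLinearMap.rTensor Y t)) =
        x ⊗ₜ TensorProduct.lid k Y ((Bialgebra.counitAlgHom k H).toLinearMap.rTensor Y t) := by
      induction t using TensorProduct.induction_on with
      | zero => simp
      | add x y hx hy => simp only [map_add, TensorProduct.tmul_add, hx, hy]
      | tmul h y =>
        simp only [G, LinearMap.rTensor_tmul, LinearMap.comp_apply, LinearEquiv.coe_coe,
          LinearEquiv.symm_apply_apply, AlgHom.toLinearMap_apply, Bialgebra.comulAlgHom_apply,
          hT h, LinearMap.flip_apply, AlgHom.commutes]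
        simp [TensorProduct.smul_tmul, Algebra.algebraMap_eq_smul_one]
    rw [h1, ← coassoc, h2, counit]
    simp
  intro t
  induction t using TensorProduct.induction_on with
  | zero => exact ⟨0, map_zero _⟩
  | add x y hx hy =>
    obtain ⟨a, rfl⟩ := hx
    obtain ⟨b, rfl⟩ := hy
    exact ⟨a + b, map_add _ _ _⟩
  | tmul x y => exact ⟨_, key x y⟩

/-- Y ⊗ X and X ⊗ Y have the same finite dimension, so surjectivity is enough and the second inverse
identity is not needed. The factor V is only carried along and need not be finite-dimensional. -/
theorem coactSwap_bijective [FiniteDimensional k X] [FiniteDimensional k Y]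
    {T : H →ₗ[k] H} (hT : IsSkewAntipode T) (ρ : Y →ₗ[k] H ⊗[k] Y)
    (σ : H →ₐ[k] Module.End k X)
    (coassoc : ∀ y, TensorProduct.assoc k H H Y
      ((Bialgebra.comulAlgHom k H).toLinearMap.rTensor Y (ρ y)) = ρ.lTensor H (ρ y))
    (counit : ∀ y, (Bialgebra.counitAlgHom k H).toLinearMap.rTensor Y (ρ y) = 1 ⊗ₜ y) :
    Function.Bijective (coactSwap ρ σ V) := by
  have hs := coactBraid_surjective hT ρ σ coassoc counit
  have hi : Function.Injective (coactBraid ρ σ) :=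
    (LinearMap.injective_iff_surjective_of_finrank_eq_finrank
      (TensorProduct.comm k Y X).finrank_eq).2 hs
  have hb : Function.Bijective ((coactBraid ρ σ).rTensor V) :=
    ((LinearEquiv.ofBijective _ ⟨hi, hs⟩).rTensor V).bijective
  rw [coactSwap, LinearMap.coe_comp, LinearMap.coe_comp]
  exact (LinearEquiv.bijective _).comp (hb.comp (LinearEquiv.bijective _))

end Swap

end HopfWall

namespace HopfWall

open scoped MonoidalLeftAction MonoidalRightAction
open FDMod

/-! ### The functor Y ⊗_A - and its structure maps -/

namespace CovariantBimodule

variable {k : Type u} [Field k] {H A : Type u} [Ring H] [Bialgebra k H] [Ring A] [Algebra k A]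
  [LeftComoduleAlgebra k H A] (Y : CovariantBimodule k H A)

/-- The vector space `Y ⊗_A M`. -/
abbrev Balanced (M : FDMod k A) : Type u :=
  (Y.carrier ⊗[k] M.carrier) ⧸ LinearMap.range (balancing Y.right M)

/-- The projection `Y ⊗ M → Y ⊗_A M`. -/
def proj (M : FDMod k A) : Y.carrier ⊗[k] M.carrier →ₗ[k] Y.Balanced M := Submodule.mkQ _

theorem proj_surjective (M : FDMod k A) : Function.Surjective (Y.proj M) := Submodule.mkQ_surjective _

theorem exact_balancing_proj (M : FDMod k A) : Function.Exact (balancing Y.right M) (Y.proj M) :=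
  LinearMap.exact_map_mkQ_range _

theorem proj_balancing (M : FDMod k A) (t) : Y.proj M (balancing Y.right M t) = 0 :=
  (Y.exact_balancing_proj M).apply_apply_eq_zero t

theorem proj_right_tmul (M : FDMod k A) (y : Y.carrier) (a : A) (m : M.carrier) :
    Y.proj M (Y.right a y ⊗ₜ m) = Y.proj M (y ⊗ₜ M.act a m) := by
  rw [← sub_eq_zero, ← map_sub]
  exact Y.proj_balancing M (y ⊗ₜ (a ⊗ₜ m))

variable {W : Type u} [AddCommGroup W] [Module k W]

/-- The linear map from `Y ⊗_A M` induced by a balanced map. -/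
def desc {M : FDMod k A} (f : Y.carrier ⊗[k] M.carrier →ₗ[k] W)
    (hf : f ∘ₗ balancing Y.right M = 0) : Y.Balanced M →ₗ[k] W :=
  Submodule.liftQ _ f (LinearMap.range_le_ker_iff.2 hf)

@[simp]
theorem desc_proj {M : FDMod k A} (f : Y.carrier ⊗[k] M.carrier →ₗ[k] W)
    (hf : f ∘ₗ balancing Y.right M = 0) (t) : Y.desc f hf (Y.proj M t) = f t := rfl

theorem balanced_of_tmul {M : FDMod k A} (f : Y.carrier ⊗[k] M.carrier →ₗ[k] W)
    (h : ∀ y a m, f (Y.right a y ⊗ₜ m) = f (y ⊗ₜ M.act a m)) : f ∘ₗ balancing Y.right M = 0 := by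
  ext y a m
  exact (map_sub f _ _).trans (sub_eq_zero.2 (h y a m))

theorem balanced_ext {M : FDMod k A} {f g : Y.Balanced M →ₗ[k] W}
    (h : ∀ y m, f (Y.proj M (y ⊗ₜ m)) = g (Y.proj M (y ⊗ₜ m))) : f = g :=
  Submodule.linearMap_qext _ (TensorProduct.ext' h)

/-- The left `A`-module `Y ⊗_A M`. -/
abbrev tensorObj (M : FDMod k A) : FDMod k A where
  carrier := Y.Balanced M
  act := AlgHom.ofLinearMap
    { toFun := fun a => Y.desc (Y.proj M ∘ₗ (Y.left a).rTensor M.carrier)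
        (Y.balanced_of_tmul _ fun y b m => by
          have := LinearMap.congr_fun (Y.left_right a b) y
          simp only [Module.End.mul_apply] at this
          rw [LinearMap.comp_apply, LinearMap.comp_apply, LinearMap.rTensor_tmul, this,
            proj_right_tmul, LinearMap.rTensor_tmul])
      map_add' := fun a b => Y.balanced_ext fun y m => by simp
      map_smul' := fun c a => Y.balanced_ext fun y m => by
        simp }
    (Y.balanced_ext fun y m => by simp)
    (fun a b => Y.balanced_ext fun y m => by simp)

/-- The functor `Y ⊗_A -`. -/
def tensorFunctor : FDMod k A ⥤ FDMod k A where
  obj := Y.tensorObj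
  map {M N} g := mkHom (X := Y.tensorObj M) (Y := Y.tensorObj N)
    (Y.desc (Y.proj N ∘ₗ (lin g).lTensor Y.carrier) (Y.balanced_of_tmul _ fun y a m => by
      rw [LinearMap.comp_apply, LinearMap.comp_apply, LinearMap.lTensor_tmul, proj_right_tmul,
        LinearMap.lTensor_tmul, lin_act]))
    fun a => Y.balanced_ext fun y m => rfl
  map_id M := hom_ext (Y.balanced_ext fun y m => rfl)
  map_comp f g := hom_ext (Y.balanced_ext fun y m => rfl)

@[simp]
theorem lin_tensorFunctor_map_proj {M N : FDMod k A} (g : M ⟶ N) (t : Y.carrier ⊗[k] M.carrier) :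
    lin (Y.tensorFunctor.map g) (Y.proj M t) = Y.proj N ((lin g).lTensor Y.carrier t) := rfl

instance : Y.tensorFunctor.Additive where
  map_add {M N f g} := hom_ext (Y.balanced_ext fun y m => by
    change Y.proj N (y ⊗ₜ (lin f m + lin g m)) =
      Y.proj N (y ⊗ₜ lin f m) + Y.proj N (y ⊗ₜ lin g m)
    rw [TensorProduct.tmul_add, map_add])

instance : Y.tensorFunctor.Linear k where
  map_smul {M N} f c := hom_ext (Y.balanced_ext fun y m => by
    change Y.proj N (y ⊗ₜ (c • lin f m)) = c • Y.proj N (y ⊗ₜ lin f m)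
    rw [TensorProduct.tmul_smul, map_smul])

/-- A diagram chase: a balancing relation over N lifts to one over M, because tensoring over k keeps
surjections. Subtracting the lift leaves an element that comes from Y ⊗ L, by exactness over k. -/
theorem rightExact_tensorFunctor : RightExact Y.tensorFunctor := by
  intro L M N f g hfg hg
  refine ⟨fun z => ⟨fun hz => ?_, ?_⟩, fun z => ?_⟩
  · obtain ⟨t, rfl⟩ := Y.proj_surjective M z
    rw [lin_tensorFunctor_map_proj] at hz
    obtain ⟨s, hs⟩ := (Y.exact_balancing_proj N _).1 hz
    obtain ⟨s, rfl⟩ := LinearMap.lTensor_surjective _ (LinearMap.lTensor_surjective A hg) s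
    have h1 : balancing Y.right N (((lin g).lTensor A).lTensor Y.carrier s) =
        (lin g).lTensor Y.carrier (balancing Y.right M s) := by
      rw [← LinearMap.comp_apply, ← LinearMap.comp_apply]
      refine LinearMap.congr_fun (TensorProduct.ext_threefold' fun y a m => ?_) s
      simp [lin_act]
    rw [h1, eq_comm, ← sub_eq_zero, ← map_sub] at hs
    obtain ⟨u, hu⟩ := (lTensor_exact Y.carrier hfg hg _).1 hs
    refine ⟨Y.proj L u, ?_⟩
    rw [lin_tensorFunctor_map_proj, hu, map_sub, proj_balancing, sub_zero]
  · rintro ⟨w, rfl⟩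
    obtain ⟨t, rfl⟩ := Y.proj_surjective L w
    rw [lin_tensorFunctor_map_proj, lin_tensorFunctor_map_proj,
      (lTensor_exact Y.carrier hfg hg).apply_apply_eq_zero, map_zero]
    rfl
  · obtain ⟨t, rfl⟩ := Y.proj_surjective N z
    obtain ⟨s, rfl⟩ := LinearMap.lTensor_surjective Y.carrier hg t
    exact ⟨Y.proj M s, rfl⟩

/-- Moving X past Y carries the relations of Y ⊗_A (X ⊙ M) to X tensored with the relations of Y ⊗_A
M. This is covariance under the right action: both routes give y₍₋₁₎a₍₋₁₎x followed by y₍₀₎a₍₀₎ ⊗ m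
- y₍₀₎ ⊗ a₍₀₎m. The relations are indexed by A as well, so X also moves past A, through A's own
coaction. -/
theorem coactSwap_balancing (X : FDMod k H) (M : FDMod k A) :
    (balancing Y.right M).lTensor X.carrier ∘ₗ coactSwap Y.coact X.act (A ⊗[k] M.carrier) ∘ₗ
      (coactSwap (LeftComoduleAlgebra.coact (k := k) (H := H) (A := A)).toLinearMap X.act
        M.carrier).lTensor Y.carrier =
    coactSwap Y.coact X.act M.carrier ∘ₗ balancing Y.right (X ⊙ₗ M) := by
  refine TensorProduct.ext (LinearMap.ext fun y => TensorProduct.ext (LinearMap.ext fun a =>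
    TensorProduct.ext' fun x m => ?_))
  change (balancing Y.right M).lTensor X.carrier (coactSwap Y.coact X.act (A ⊗[k] M.carrier)
    (y ⊗ₜ coactSwap (LeftComoduleAlgebra.coact (k := k) (H := H) (A := A)).toLinearMap X.act
        M.carrier (a ⊗ₜ (x ⊗ₜ m)))) = coactSwap Y.coact X.act M.carrier
      (Y.right a y ⊗ₜ (x ⊗ₜ m) - y ⊗ₜ tensorAct X.act M.act (LeftComoduleAlgebra.coact a) (x ⊗ₜ m))
  rw [coactSwap_tmul, map_sub, coactSwap_tmul, Y.coact_right, AlgHom.toLinearMap_apply]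
  generalize LeftComoduleAlgebra.coact (k := k) (H := H) (A := A) a = t
  induction t using TensorProduct.induction_on with
  | zero => simp
  | add s t hs ht =>
    simp only [map_add, TensorProduct.tmul_add, LinearMap.add_apply, hs, ht]
    abel
  | tmul g b =>
    rw [TensorProduct.map_tmul, LinearMap.flip_apply, tensorAct_tmul, TensorProduct.map_tmul,
      TensorProduct.map_tmul, LinearMap.flip_apply, TensorProduct.mk_apply, coactSwap_tmul,
      coactSwap_tmul]
    generalize Y.coact y = s
    induction s using TensorProduct.induction_on with
    | zero => simp
    | add s t hs ht =>
      simp only [map_add, hs, ht]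
      abel
    | tmul h z => simp [TensorProduct.tmul_sub]

theorem coactSwap_balancing_apply (X : FDMod k H) (M : FDMod k A)
    (t : Y.carrier ⊗[k] (A ⊗[k] (X.carrier ⊗[k] M.carrier))) :
    coactSwap Y.coact X.act M.carrier (balancing Y.right (X ⊙ₗ M) t) =
      (balancing Y.right M).lTensor X.carrier (coactSwap Y.coact X.act (A ⊗[k] M.carrier)
        ((coactSwap (LeftComoduleAlgebra.coact (k := k) (H := H) (A := A)).toLinearMap X.act
          M.carrier).lTensor Y.carrier t)) :=
  (LinearMap.congr_fun (Y.coactSwap_balancing X M) t).symm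

/-- The map `Y ⊗_A (X ⊗ M) → X ⊗ (Y ⊗_A M)`, `y ⊗ (x ⊗ m) ↦ y₍₋₁₎ x ⊗ (y₍₀₎ ⊗ m)`. -/
def deltaLin (X : FDMod k H) (M : FDMod k A) :
    Y.Balanced (X ⊙ₗ M) →ₗ[k] X.carrier ⊗[k] Y.Balanced M :=
  Y.desc (M := X ⊙ₗ M) ((Y.proj M).lTensor X.carrier ∘ₗ coactSwap Y.coact X.act M.carrier)
    (LinearMap.ext fun t => (congrArg ((Y.proj M).lTensor X.carrier)
      (Y.coactSwap_balancing_apply X M t)).trans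
        ((lTensor_exact X.carrier (Y.exact_balancing_proj M)
          (Y.proj_surjective M)).apply_apply_eq_zero _))

theorem balanced_ext_act {X : FDMod k H} {M : FDMod k A} {f g : Y.Balanced (X ⊙ₗ M) →ₗ[k] W}
    (h : ∀ y x m, f (Y.proj (X ⊙ₗ M) (y ⊗ₜ[k] (x ⊗ₜ[k] m))) =
      g (Y.proj (X ⊙ₗ M) (y ⊗ₜ[k] (x ⊗ₜ[k] m)))) : f = g :=
  Submodule.linearMap_qext _ (TensorProduct.ext (LinearMap.ext fun y =>
    TensorProduct.ext' fun x m => h y x m))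

theorem deltaLin_proj (X : FDMod k H) (M : FDMod k A) (t : Y.carrier ⊗[k] (X.carrier ⊗[k] M.carrier)) :
    Y.deltaLin X M (Y.proj (X ⊙ₗ M) t) =
      (Y.proj M).lTensor X.carrier (coactSwap Y.coact X.act M.carrier t) := rfl

theorem deltaLin_proj_tmul (X : FDMod k H) (M : FDMod k A) (y : Y.carrier) (x : X.carrier)
    (m : M.carrier) : Y.deltaLin X M (Y.proj (X ⊙ₗ M) (y ⊗ₜ[k] (x ⊗ₜ[k] m))) =
      TensorProduct.map (X.act.toLinearMap.flip x)
        (Y.proj M ∘ₗ (TensorProduct.mk k Y.carrier M.carrier).flip m) (Y.coact y) := by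
  change (Y.proj M).lTensor X.carrier (coactSwap Y.coact X.act M.carrier (y ⊗ₜ (x ⊗ₜ m))) = _
  rw [coactSwap_tmul, ← LinearMap.comp_apply, LinearMap.lTensor_comp_map]

/-- All swaps in the square `coactSwap_balancing` are bijective, the one past A included, since A is
itself a finite-dimensional comodule. Hence the induced map on cokernels is bijective. -/
theorem deltaLin_bijective [FiniteDimensional k A] {T : H →ₗ[k] H} (hT : IsSkewAntipode T) (X : FDMod k H)
    (M : FDMod k A) : Function.Bijective (Y.deltaLin X M) := by
  have hb (V : Type u) [AddCommGroup V] [Module k V] :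
      Function.Bijective (coactSwap Y.coact X.act V) :=
    coactSwap_bijective hT Y.coact X.act Y.coassoc Y.counit_coact
  constructor
  · refine (injective_iff_map_eq_zero _).2 fun z hz => ?_
    obtain ⟨t, rfl⟩ := Y.proj_surjective (X ⊙ₗ M) z
    erw [deltaLin_proj] at hz
    obtain ⟨s, hs⟩ := (lTensor_exact X.carrier (Y.exact_balancing_proj M) (Y.proj_surjective M) _).1 hz
    obtain ⟨s, rfl⟩ := (hb _).2 s
    obtain ⟨s, rfl⟩ := LinearMap.lTensor_surjective Y.carrier (coactSwap_bijective hT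
      (LeftComoduleAlgebra.coact (k := k) (H := H) (A := A)).toLinearMap X.act
      LeftComoduleAlgebra.coassoc LeftComoduleAlgebra.counit_coact).2 s
    rw [← Y.coactSwap_balancing_apply X M s] at hs
    rw [← (hb _).1 hs]
    exact Y.proj_balancing (X ⊙ₗ M) s
  · intro z
    obtain ⟨t, rfl⟩ := LinearMap.lTensor_surjective X.carrier (Y.proj_surjective M) z
    obtain ⟨t, rfl⟩ := (hb _).2 t
    exact ⟨Y.proj (X ⊙ₗ M) t, rfl⟩

variable (H) in
instance oplaxLeftLinearTensorFunctor : Y.tensorFunctor.OplaxLeftLinear (FDMod k H) where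
  -- Linearity over A is covariance under the left action.
  δₗ X M := mkHom (X := Y.tensorObj (X ⊙ₗ M)) (Y := X ⊙ₗ Y.tensorObj M) (Y.deltaLin X M) fun a => by
    refine Y.balanced_ext_act fun y x m => ?_
    change Y.deltaLin X M (Y.proj (X ⊙ₗ M) (Y.left a y ⊗ₜ (x ⊗ₜ m))) =
      tensorAct X.act (Y.tensorObj M).act (LeftComoduleAlgebra.coact a)
        (Y.deltaLin X M (Y.proj (X ⊙ₗ M) (y ⊗ₜ (x ⊗ₜ m))))
    rw [deltaLin_proj_tmul, deltaLin_proj_tmul, Y.coact_left]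
    generalize LeftComoduleAlgebra.coact (k := k) (H := H) (A := A) a = t
    generalize Y.coact y = s
    induction t using TensorProduct.induction_on with
    | zero => simp
    | add t t' ht ht' => simp only [map_add, LinearMap.add_apply, ht, ht']
    | tmul g b =>
      induction s using TensorProduct.induction_on with
      | zero => simp
      | add s s' hs hs' => simp only [map_add, hs, hs']
      | tmul h z => simp
  δₗ_naturality_left {X X'} f M := by
    refine hom_ext (Y.balanced_ext_act fun y x m => ?_)
    change Y.deltaLin X' M (Y.proj (X' ⊙ₗ M) (y ⊗ₜ (lin f x ⊗ₜ m))) =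
      TensorProduct.map (lin f) .id (Y.deltaLin X M (Y.proj (X ⊙ₗ M) (y ⊗ₜ (x ⊗ₜ m))))
    rw [deltaLin_proj_tmul, deltaLin_proj_tmul]
    refine LinearMap.congr_fun (f := TensorProduct.map _ _) (g := TensorProduct.map _ _ ∘ₗ
      TensorProduct.map _ _) (TensorProduct.ext' fun h z => ?_) (Y.coact y)
    exact congrArg (· ⊗ₜ _) (lin_act f h x).symm
  δₗ_naturality_right X {M N} g := by
    refine hom_ext (Y.balanced_ext_act fun y x m => ?_)
    change Y.deltaLin X N (Y.proj (X ⊙ₗ N) (y ⊗ₜ (x ⊗ₜ lin g m))) =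
      TensorProduct.map .id (lin (Y.tensorFunctor.map g))
        (Y.deltaLin X M (Y.proj (X ⊙ₗ M) (y ⊗ₜ (x ⊗ₜ m))))
    rw [deltaLin_proj_tmul, deltaLin_proj_tmul]
    exact LinearMap.congr_fun (f := TensorProduct.map _ _) (g := TensorProduct.map _ _ ∘ₗ
      TensorProduct.map _ _) (TensorProduct.ext' fun h z => rfl) (Y.coact y)
  -- This is the coassociativity of Y: the two sides are `G` applied to the two iterated coactions
  -- of y.
  δₗ_associativity X X' M := by
    refine hom_ext (Submodule.linearMap_qext _ (TensorProduct.ext (LinearMap.ext fun y =>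
      TensorProduct.ext_threefold fun x x' m => ?_)))
    let G : H ⊗[k] (H ⊗[k] Y.carrier) →ₗ[k] X.carrier ⊗[k] (X'.carrier ⊗[k] Y.Balanced M) :=
      TensorProduct.map (X.act.toLinearMap.flip x) (TensorProduct.map (X'.act.toLinearMap.flip x')
        (Y.proj M ∘ₗ (TensorProduct.mk k Y.carrier M.carrier).flip m))
    change TensorProduct.assoc k X.carrier X'.carrier (Y.Balanced M)
        (Y.deltaLin (X ⊗ X') M (Y.proj ((X ⊗ X') ⊙ₗ M) (y ⊗ₜ ((x ⊗ₜ x') ⊗ₜ m)))) =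
      TensorProduct.map .id (Y.deltaLin X' M)
        (Y.deltaLin X (X' ⊙ₗ M) (Y.proj (X ⊙ₗ X' ⊙ₗ M) (y ⊗ₜ (x ⊗ₜ (x' ⊗ₜ m)))))
    have h1 : TensorProduct.map .id (Y.deltaLin X' M)
        (Y.deltaLin X (X' ⊙ₗ M) (Y.proj (X ⊙ₗ X' ⊙ₗ M) (y ⊗ₜ (x ⊗ₜ (x' ⊗ₜ m))))) =
        G (Y.coact.lTensor H (Y.coact y)) := by
      erw [deltaLin_proj_tmul]
      generalize Y.coact y = t
      induction t using TensorProduct.induction_on with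
      | zero => simp
      | add s t hs ht => simp only [map_add, hs, ht]
      | tmul h z =>
        change X.act h x ⊗ₜ Y.deltaLin X' M (Y.proj (X' ⊙ₗ M) (z ⊗ₜ (x' ⊗ₜ m))) = _
        rw [deltaLin_proj_tmul]
        rfl
    rw [h1, ← Y.coassoc]
    erw [deltaLin_proj_tmul]
    generalize Y.coact y = t
    induction t using TensorProduct.induction_on with
    | zero =>
      simp only [map_zero]
      exact map_zero (TensorProduct.assoc k X.carrier X'.carrier (Y.Balanced M))
    | add s t hs ht =>
      simp only [map_add]
      exact (map_add (TensorProduct.assoc k X.carrier X'.carrier (Y.Balanced M)) _ _).trans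
        (congrArg₂ (· + ·) hs ht)
    | tmul h z =>
      change TensorProduct.assoc k X.carrier X'.carrier (Y.Balanced M)
        (tensorAct X.act X'.act (Bialgebra.comulAlgHom k H h) (x ⊗ₜ x') ⊗ₜ Y.proj M (z ⊗ₜ m)) =
        G (TensorProduct.assoc k H H Y.carrier (Bialgebra.comulAlgHom k H h ⊗ₜ z))
      generalize Bialgebra.comulAlgHom k H h = s
      induction s using TensorProduct.induction_on with
      | zero => simp
      | add s t hs ht =>
        simp only [map_add, TensorProduct.add_tmul, LinearMap.add_apply, hs, ht]
      | tmul g h => rfl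
  δₗ_unitality_inv M := by
    refine hom_ext (Y.balanced_ext fun y m => ?_)
    change (1 : k) ⊗ₜ[k] Y.proj M (y ⊗ₜ m) = Y.deltaLin (𝟙_ (FDMod k H)) M
      (Y.proj (𝟙_ (FDMod k H) ⊙ₗ M) (y ⊗ₜ ((1 : k) ⊗ₜ[k] m)))
    erw [deltaLin_proj_tmul]
    have h1 := congrArg ((Y.proj M ∘ₗ (TensorProduct.mk k Y.carrier M.carrier).flip m).lTensor k)
      (Y.counit_coact y)
    refine h1.symm.trans ?_
    generalize Y.coact y = t
    induction t using TensorProduct.induction_on with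
    | zero => simp; rfl
    | add s t hs ht => rw [map_add, map_add, map_add, hs, ht]; rfl
    | tmul h z =>
      change (Bialgebra.counitAlgHom k H h) ⊗ₜ[k] Y.proj M (z ⊗ₜ m) =
        (Bialgebra.counitAlgHom k H h * 1) ⊗ₜ[k] Y.proj M (z ⊗ₜ m)
      rw [mul_one]

end CovariantBimodule

end HopfWall

/-! ### Module functors are equivalent to covariant bimodules -/

namespace HopfWall

open scoped MonoidalLeftAction MonoidalRightAction
open FDMod Functor.LaxLeftLinear Functor.OplaxLeftLinear

variable {k : Type u} [Field k] {H A : Type u} [Ring H] [Bialgebra k H] [Ring A] [Algebra k A]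
  [LeftComoduleAlgebra k H A]

namespace FDMod

theorem isIso_of_bijective {X Y : FDMod k A} (f : X ⟶ Y) (hf : Function.Bijective (lin f)) :
    IsIso f :=
  (mkIso (LinearEquiv.ofBijective (lin f) hf) (lin_comm f)).isIso_hom

end FDMod

namespace CovariantBimodule

section

/-- An isomorphism of covariant bimodules from a bijective morphism. -/
def isoOfBijective {Y Z : CovariantBimodule k H A} (f : Y ⟶ Z) (hf : Function.Bijective f.1) :
    Y ≅ Z where
  hom := f
  inv :=
    have h (z : Z.carrier) : f.1 ((LinearEquiv.ofBijective f.1 hf).symm z) = z :=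
      LinearEquiv.apply_symm_apply (LinearEquiv.ofBijective f.1 hf) z
    ⟨(LinearEquiv.ofBijective f.1 hf).symm.toLinearMap,
      fun a => LinearMap.ext fun z => hf.1 <| (h _).trans <|
        ((LinearMap.congr_fun (f.2.1 a) _).trans (congrArg (Z.left a) (h z))).symm,
      fun a => LinearMap.ext fun z => hf.1 <| (h _).trans <|
        ((LinearMap.congr_fun (f.2.2.1 a) _).trans (congrArg (Z.right a) (h z))).symm, by
      refine LinearMap.ext fun z => ?_
      obtain ⟨y, rfl⟩ := hf.2 z
      have h' (y : Y.carrier) : (LinearEquiv.ofBijective f.1 hf).symm (f.1 y) = y :=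
        LinearEquiv.symm_apply_apply (LinearEquiv.ofBijective f.1 hf) y
      have h1 : (LinearEquiv.ofBijective f.1 hf).symm.toLinearMap ∘ₗ f.1 = .id :=
        LinearMap.ext h'
      have h2 : Z.coact (f.1 y) = f.1.lTensor H (Y.coact y) :=
        (LinearMap.congr_fun f.2.2.2 y).symm
      rw [LinearMap.comp_apply, LinearMap.comp_apply, h2, ← LinearMap.lTensor_comp_apply, h1,
        LinearMap.lTensor_id]
      exact congrArg Y.coact (h' y).symm⟩
  hom_inv_id := Subtype.ext (LinearMap.ext fun y =>
    LinearEquiv.symm_apply_apply (LinearEquiv.ofBijective f.1 hf) y)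
  inv_hom_id := Subtype.ext (LinearMap.ext fun z =>
    LinearEquiv.apply_symm_apply (LinearEquiv.ofBijective f.1 hf) z)

end

variable [FiniteDimensional k A]

/-- The module functor `Y ⊗_A -`. -/
def tensorModuleFunctor (Y : CovariantBimodule k H A) {T : H →ₗ[k] H} (hT : IsSkewAntipode T) :
    ModuleFunctor k H A where
  functor := Y.tensorFunctor
  rightExact := Y.rightExact_tensorFunctor
  leftLinear :=
    have (X : FDMod k H) (M : FDMod k A) : IsIso (δₗ Y.tensorFunctor X M) :=
      isIso_of_bijective _ (Y.deltaLin_bijective hT X M)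
    leftLinearOfIsIso Y.tensorFunctor

variable [FiniteDimensional k H]

/-- The isomorphism `Y ≅ Y ⊗_A A`. -/
def isoTensorRegular (Y : CovariantBimodule k H A) {T : H →ₗ[k] H} (hT : IsSkewAntipode T) :
    Y ≅ covariantBimodule H (Y.tensorModuleFunctor hT).functor := by
  let f : Y.carrier →ₗ[k] Y.Balanced (regular k A) :=
    Y.proj (regular k A) ∘ₗ (TensorProduct.mk k Y.carrier A).flip 1
  have hf (y : Y.carrier) : f y = Y.proj (regular k A) (y ⊗ₜ[k] (1 : A)) := rfl
  have hr (a : A) (y : Y.carrier) : Y.proj (regular k A) (y ⊗ₜ[k] (a : A)) = f (Y.right a y) := by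
    refine (congrArg (fun b : A => Y.proj (regular k A) (y ⊗ₜ[k] b)) (mul_one a).symm).trans ?_
    exact (Y.proj_right_tmul (regular k A) y a (1 : A)).symm
  refine isoOfBijective (Z := covariantBimodule H (Y.tensorModuleFunctor hT).functor)
    ⟨f, fun a => rfl, fun a => LinearMap.ext fun y => ?_, LinearMap.ext fun y => ?_⟩ ⟨?_, ?_⟩
  · refine (hr a y).symm.trans ?_
    exact congrArg (fun b : A => Y.proj (regular k A) (y ⊗ₜ[k] b)) (one_mul a).symm
  -- The coaction of A preserves 1, so the coaction of y ⊗ 1 is δ applied to y ⊗ (1 ⊗ 1).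
  · change f.lTensor H (Y.coact y) = Y.deltaLin (regular k H) (regular k A) (Y.proj
      (regular k H ⊙ₗ regular k A) (y ⊗ₜ (LeftComoduleAlgebra.coact (k := k) (H := H) (A := A) 1)))
    rw [map_one (LeftComoduleAlgebra.coact (k := k) (H := H) (A := A))]
    refine Eq.trans ?_ (Y.deltaLin_proj_tmul (regular k H) (regular k A) y (1 : H) (1 : A)).symm
    refine LinearMap.congr_fun (f := LinearMap.lTensor H f) (g := TensorProduct.map _ _)
      (TensorProduct.ext' fun h z => ?_) (Y.coact y)
    exact congrArg (fun g : H => g ⊗ₜ[k] f z) (mul_one h).symm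
  -- The left inverse is y ⊗ a ↦ ya, balanced because the right action is associative.
  · let g : Y.Balanced (regular k A) →ₗ[k] Y.carrier :=
      Y.desc (M := regular k A) (TensorProduct.lift Y.right.flip) <|
        Y.balanced_of_tmul _ fun y a (b : A) =>
          (LinearMap.congr_fun (Y.right_mul a b) y).symm
    exact Function.LeftInverse.injective (g := g) fun y => LinearMap.congr_fun Y.right_one y
  · intro z
    obtain ⟨t, rfl⟩ := Y.proj_surjective (regular k A) z
    induction t using TensorProduct.induction_on with
    | zero => exact ⟨0, (map_zero f).trans (map_zero _).symm⟩
    | add s t hs ht =>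
      obtain ⟨a, ha⟩ := hs
      obtain ⟨b, hb⟩ := ht
      exact ⟨a + b, (map_add f a b).trans ((congrArg₂ (· + ·) ha hb).trans (map_add _ _ _).symm)⟩
    | tmul y a => exact ⟨Y.right a y, (hr a y).symm⟩

end CovariantBimodule

variable [FiniteDimensional k H] [FiniteDimensional k A]

namespace ModuleFunctor

variable (k H A) in
/-- The functor that sends a module functor `F` to the covariant bimodule `F(A)`. -/
def toCovariant : ModuleFunctor k H A ⥤ CovariantBimodule k H A where
  obj F := covariantBimodule H F.functor
  map {F G} α := ⟨lin (α.1.app (regular k A)), fun a => lin_comm _ a,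
    fun a => (congrArg lin (α.1.naturality (rightMul k A a)).symm).symm,
    (congrArg lin (comp_coactMap F.functor G.functor α.1
      fun X M => (comp_δₗ_iff α.1 X M).1 (α.2 X M))).symm⟩

instance : (toCovariant k H A).Additive where

instance : (toCovariant k H A).Linear k where

instance : (toCovariant k H A).Faithful where
  map_injective {F G α β} h :=
    have h' : lin (α.1.app (regular k A)) = lin (β.1.app (regular k A)) :=
      congrArg (fun f : (toCovariant k H A).obj F ⟶ (toCovariant k H A).obj G => f.1) h
    Subtype.ext (natTrans_ext_of_rightExact F.rightExact (hom_ext h'))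

/-- Compatibility with the two actions extends f to a natural transformation; compatibility with the
coaction makes this transformation a morphism of module functors. -/
instance : (toCovariant k H A).Full where
  map_surjective {F G} f := by
    obtain ⟨α, hα⟩ := exists_natTrans F.rightExact (G := G.functor)
      (mkHom (X := F.functor.obj (regular k A)) (Y := G.functor.obj (regular k A)) f.1 f.2.1) f.2.2.1
    refine ⟨⟨α, fun X M => (comp_δₗ_iff α X M).2
      (comp_δₗ_of_comp_coactMap F.rightExact α ?_ X M)⟩, Subtype.ext (congrArg lin hα)⟩
    rw [hα]
    exact hom_ext f.2.2.2.symm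

/-- The skew antipode makes the structure maps of Y ⊗_A - invertible; full faithfulness does without
it. -/
theorem essSurj_toCovariant {T : H →ₗ[k] H} (hT : IsSkewAntipode T) :
    (toCovariant k H A).EssSurj where
  mem_essImage Y := ⟨Y.tensorModuleFunctor hT, ⟨(Y.isoTensorRegular hT).symm⟩⟩

theorem isEquivalence_toCovariant {T : H →ₗ[k] H} (hT : IsSkewAntipode T) :
    (toCovariant k H A).IsEquivalence :=
  have := essSurj_toCovariant (A := A) hT
  { }

variable (k H A) in
/-- The left module underlying the covariant bimodule `F(A)` is `F(A)`. -/
def toCovariantCompToLeftModule : toCovariant k H A ⋙ CovariantBimodule.toLeftModule k H A ≅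
    forget k H A ⋙ (evaluation _ _).obj (regular k A) :=
  NatIso.ofComponents fun _ => Iso.refl _

end ModuleFunctor

end HopfWall

namespace HopfWall

open scoped MonoidalLeftAction MonoidalRightAction
open FDMod

/-! ### Right actions of Rep(H) as left actions of Rep(H^cop) -/

section CopAction

variable {k : Type u} [Field k] {H A : Type u} [Ring H] [Bialgebra k H] [Ring A] [Algebra k A]

/-- The module over `H^cop` given by a module over `H`. -/
abbrev toCopMod (X : FDMod k H) : FDMod k (Cop H) where
  carrier := X.carrier
  act := X.act.comp (toCop k H).symm.toAlgHom

/-- The module over `H` given by a module over `H^cop`. -/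
abbrev ofCopMod (X : FDMod k (Cop H)) : FDMod k H where
  carrier := X.carrier
  act := X.act.comp (toCop k H).toAlgHom

variable [RightComoduleAlgebra k H A]

variable (k H A) in
/-- The algebra homomorphism `a ↦ a⁽¹⁾ ⊗ a⁽⁰⁾`. -/
def copCoact : A →ₐ[k] Cop H ⊗[k] A :=
  ((Algebra.TensorProduct.comm k A H).trans
    (Algebra.TensorProduct.congr (toCop k H) AlgEquiv.refl)).toAlgHom.comp
      RightComoduleAlgebra.coact

theorem copCoact_apply (a : A) : copCoact k H A a = (toCop k H).toLinearMap.rTensor A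
    (TensorProduct.comm k A H (RightComoduleAlgebra.coact a)) := rfl

/-- A right `H`-comodule algebra is a left `H^cop`-comodule algebra. -/
instance copComoduleAlgebra : LeftComoduleAlgebra k (Cop H) A where
  coact := copCoact k H A
  coassoc a := by
    let e : (A ⊗[k] H) ⊗[k] H →ₗ[k] Cop H ⊗[k] (Cop H ⊗[k] A) :=
      TensorProduct.map (toCop k H).toLinearMap ((toCop k H).toLinearMap.rTensor A ∘ₗ
        (TensorProduct.comm k A H).toLinearMap) ∘ₗ (TensorProduct.comm k (A ⊗[k] H) H).toLinearMap
    have h1 (t : A ⊗[k] H) : TensorProduct.assoc k (Cop H) (Cop H) A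
        ((Bialgebra.comulAlgHom k (Cop H)).toLinearMap.rTensor A ((toCop k H).toLinearMap.rTensor A
          (TensorProduct.comm k A H t))) = e ((TensorProduct.assoc k A H H).symm
            ((Bialgebra.comulAlgHom k H).toLinearMap.lTensor A t)) := by
      induction t using TensorProduct.induction_on with
      | zero => simp
      | add x y hx hy => simp only [map_add, hx, hy]
      | tmul a h =>
        have hc : Bialgebra.comulAlgHom k (Cop H) (toCop k H h) =
            TensorProduct.map (toCop k H).toLinearMap (toCop k H).toLinearMap
              (TensorProduct.comm k H H (Bialgebra.comulAlgHom k H h)) :=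
          (LinearMap.congr_fun (TensorProduct.map_id (R := k) (M := H) (N := H)) _).symm
        simp only [TensorProduct.comm_tmul, LinearMap.rTensor_tmul, LinearMap.lTensor_tmul,
          AlgHom.toLinearMap_apply, AlgEquiv.toLinearMap_apply, hc]
        generalize Bialgebra.comulAlgHom k H h = s
        induction s using TensorProduct.induction_on with
        | zero => simp
        | add x y hx hy =>
          simp only [map_add, TensorProduct.add_tmul, TensorProduct.tmul_add, hx, hy]
        | tmul p q => rfl
    have h2 (t : A ⊗[k] H) : (copCoact k H A).toLinearMap.lTensor (Cop H)
        ((toCop k H).toLinearMap.rTensor A (TensorProduct.comm k A H t)) =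
        e ((RightComoduleAlgebra.coact (k := k) (H := H) (A := A)).toLinearMap.rTensor H t) := by
      induction t using TensorProduct.induction_on with
      | zero => simp
      | add x y hx hy => simp only [map_add, hx, hy]
      | tmul a h => rfl
    rw [copCoact_apply, h1, h2, ← RightComoduleAlgebra.coassoc, LinearEquiv.symm_apply_apply]
  counit_coact a := by
    have h1 (t : A ⊗[k] H) : (Bialgebra.counitAlgHom k (Cop H)).toLinearMap.rTensor A
        ((toCop k H).toLinearMap.rTensor A (TensorProduct.comm k A H t)) = TensorProduct.comm k A k
          ((Bialgebra.counitAlgHom k H).toLinearMap.lTensor A t) := by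
      induction t using TensorProduct.induction_on with
      | zero => simp
      | add x y hx hy => simp only [map_add, hx, hy]
      | tmul a h => rfl
    rw [copCoact_apply, h1, RightComoduleAlgebra.counit_coact, TensorProduct.comm_tmul]

theorem tensorAct_comm {C D V W : Type u} [Ring C] [Algebra k C] [Ring D] [Algebra k D]
    [AddCommGroup V] [Module k V] [AddCommGroup W] [Module k W]
    (f : C →ₐ[k] Module.End k V) (g : D →ₐ[k] Module.End k W) (t : C ⊗[k] D) :
    (TensorProduct.comm k V W).toLinearMap ∘ₗ tensorAct f g t =
      tensorAct g f (TensorProduct.comm k C D t) ∘ₗ (TensorProduct.comm k V W).toLinearMap := by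
  induction t using TensorProduct.induction_on with
  | zero => simp
  | add x y hx hy => simp only [map_add, LinearMap.comp_add, LinearMap.add_comp, hx, hy]
  | tmul c d => exact TensorProduct.ext' fun v w => rfl

/-- The isomorphism `M ⊙ X ≅ X ⊙ M`, `m ⊗ x ↦ x ⊗ m`, of modules over `A`. -/
def copSwap (M : FDMod k A) (X : FDMod k H) : M ⊙ᵣ X ≅ toCopMod X ⊙ₗ M :=
  mkIso (X := M ⊙ᵣ X) (Y := toCopMod X ⊙ₗ M) (TensorProduct.comm k M.carrier X.carrier) fun a => by
    refine (tensorAct_comm M.act X.act (RightComoduleAlgebra.coact a)).trans ?_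
    refine congrArg (· ∘ₗ (TensorProduct.comm k M.carrier X.carrier).toLinearMap) ?_
    change _ = tensorAct (X.act.comp (toCop k H).symm.toAlgHom) M.act (copCoact k H A a)
    rw [copCoact_apply]
    generalize TensorProduct.comm k A H (RightComoduleAlgebra.coact a) = t
    induction t using TensorProduct.induction_on with
    | zero => simp
    | add x y hx hy => simp only [map_add, hx, hy]
    | tmul c d => rfl

theorem actionHomLeft_comp_copSwap {M N : FDMod k A} (f : M ⟶ N) (X : FDMod k H) :
    f ⊵ᵣ X ≫ (copSwap N X).hom = (copSwap M X).hom ≫ toCopMod X ⊴ₗ f :=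
  hom_ext (TensorProduct.ext' fun _ _ => rfl)

/-- f and f' are one linear map regarded over H and over H^cop. Keeping both lets the lemma serve
morphisms given on either side. -/
theorem actionHomRight_comp_copSwap (M : FDMod k A) {X Y : FDMod k H} (f : X ⟶ Y)
    (f' : toCopMod X ⟶ toCopMod Y) (hf : lin f = lin f') :
    M ⊴ᵣ f ≫ (copSwap M Y).hom = (copSwap M X).hom ≫ f' ⊵ₗ M := by
  refine hom_ext (TensorProduct.ext' fun m x => ?_)
  exact congrArg (· ⊗ₜ[k] m) (LinearMap.congr_fun hf x)

/-- The flip `X ⊗ Y ≅ Y ⊗ X`, from representations of `H` to representations of `H^cop`. -/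
def copTensor (X Y : FDMod k H) : toCopMod (X ⊗ Y) ≅ toCopMod Y ⊗ toCopMod X :=
  mkIso (X := toCopMod (X ⊗ Y)) (Y := toCopMod Y ⊗ toCopMod X)
    (TensorProduct.comm k X.carrier Y.carrier) fun (h : H) => by
    exact tensorAct_comm X.act Y.act (Bialgebra.comulAlgHom k H h)

/-- Passing to H^cop reverses tensor products: moving X and then Y to the left of M puts Y in front
of X, which the flip `copTensor` accounts for. -/
theorem copSwap_associator (M : FDMod k A) (X Y : FDMod k H) :
    (αᵣ M X Y).hom ≫ (copSwap M X).hom ⊵ᵣ Y ≫ (copSwap (toCopMod X ⊙ₗ M) Y).hom =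
      (copSwap M (X ⊗ Y)).hom ≫ (copTensor X Y).hom ⊵ₗ M ≫ (αₗ _ _ _).hom :=
  hom_ext (TensorProduct.ext (LinearMap.ext fun _ => TensorProduct.ext' fun _ _ => rfl))

end CopAction

end HopfWall

/-! ### Right linear functors over H as left linear functors over H^cop -/

namespace HopfWall

open scoped MonoidalLeftAction MonoidalRightAction

/-- An oplax right linear functor whose structure maps are invertible is right linear. -/
abbrev rightLinearOfIsIso {C D D' : Type*} [Category C] [Category D] [Category D']
    [MonoidalCategory C] [MonoidalRightAction C D] [MonoidalRightAction C D'] (F : D ⥤ D')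
    [F.OplaxRightLinear C]
    [h : ∀ (d : D) (c : C), IsIso (Functor.OplaxRightLinear.δᵣ F d c)] :
    F.RightLinear C where
  μᵣ d c := inv (Functor.OplaxRightLinear.δᵣ F d c)
  μᵣ_naturality_right d _ _ f := by
    rw [IsIso.comp_inv_eq, Category.assoc, Functor.OplaxRightLinear.δᵣ_naturality_right,
      IsIso.inv_hom_id_assoc]
  μᵣ_naturality_left f c := by
    rw [IsIso.comp_inv_eq, Category.assoc, Functor.OplaxRightLinear.δᵣ_naturality_left,
      IsIso.inv_hom_id_assoc]
  μᵣ_associativity d c c' := by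
    rw [IsIso.inv_comp_eq, ← MonoidalRightAction.inv_actionHomLeft,
      Functor.OplaxRightLinear.δᵣ_associativity_assoc]
    simp
  μᵣ_unitality d := by
    rw [IsIso.eq_inv_comp, Functor.OplaxRightLinear.δᵣ_unitality_hom]
  μᵣ_comp_δᵣ c d := IsIso.inv_hom_id _
  δᵣ_comp_μᵣ c d := IsIso.hom_inv_id _

section CopLinear

open FDMod Functor.LaxLeftLinear Functor.OplaxLeftLinear Functor.LaxRightLinear
  Functor.OplaxRightLinear

variable {k : Type u} [Field k] {H A : Type u} [Ring H] [Bialgebra k H] [Ring A] [Algebra k A]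
  [RightComoduleAlgebra k H A] (F : FDMod k A ⥤ FDMod k A)

/-- The structure map `F(X ⊙ M) ⟶ X ⊙ F(M)` given by `F(M ⊙ X) ⟶ F(M) ⊙ X`. -/
def copδₗ [F.RightLinear (FDMod k H)] (X : FDMod k (Cop H)) (M : FDMod k A) :
    F.obj (X ⊙ₗ M) ⟶ X ⊙ₗ F.obj M :=
  F.map (copSwap M (ofCopMod X)).inv ≫ δᵣ F M (ofCopMod X) ≫
    (copSwap (F.obj M) (ofCopMod X)).hom

/-- The structure map `F(M ⊙ X) ⟶ F(M) ⊙ X` given by `F(X ⊙ M) ⟶ X ⊙ F(M)`. -/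
def copδᵣ [F.LeftLinear (FDMod k (Cop H))] (M : FDMod k A) (X : FDMod k H) :
    F.obj (M ⊙ᵣ X) ⟶ F.obj M ⊙ᵣ X :=
  F.map (copSwap M X).hom ≫ δₗ F (toCopMod X) M ≫ (copSwap (F.obj M) X).inv

/-- The rule that reduces coherence of `copδₗ` to that of δᵣ: precompose with the invertible F(swap)
and push it through. -/
theorem map_copSwap_comp_copδₗ [F.RightLinear (FDMod k H)] (X : FDMod k H) (M : FDMod k A) :
    F.map (copSwap M X).hom ≫ copδₗ F (toCopMod X) M = δᵣ F M X ≫ (copSwap (F.obj M) X).hom := by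
  change F.map (copSwap M X).hom ≫ F.map (copSwap M X).inv ≫ δᵣ F M X ≫
    (copSwap (F.obj M) X).hom = _
  rw [← F.map_comp_assoc, Iso.hom_inv_id, F.map_id, Category.id_comp]

theorem copδᵣ_comp_copSwap [F.LeftLinear (FDMod k (Cop H))] (M : FDMod k A) (X : FDMod k H) :
    copδᵣ F M X ≫ (copSwap (F.obj M) X).hom = F.map (copSwap M X).hom ≫ δₗ F (toCopMod X) M := by
  simp [copδᵣ]

theorem rightUnitor_inv_comp_copSwap (M : FDMod k A) :
    (ρᵣ M).inv ≫ (copSwap M (𝟙_ (FDMod k H))).hom = (λₗ[FDMod k (Cop H)] M).inv :=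
  hom_ext (LinearMap.ext fun _ => rfl)

theorem leftUnitor_inv_comp_copSwap (M : FDMod k A) :
    (λₗ[FDMod k (Cop H)] M).inv ≫ (copSwap M (𝟙_ (FDMod k H))).inv = (ρᵣ M).inv :=
  hom_ext (LinearMap.ext fun _ => rfl)

theorem copδₗ_naturality_left [F.RightLinear (FDMod k H)] {X Y : FDMod k (Cop H)} (f : X ⟶ Y)
    (M : FDMod k A) : F.map (f ⊵ₗ M) ≫ copδₗ F Y M = copδₗ F X M ≫ f ⊵ₗ F.obj M := by
  let f' : ofCopMod X ⟶ ofCopMod Y := mkHom (lin f) fun h => lin_comm f (toCop k H h)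
  -- The swap with its target written as X ⊙ N; this is legitimate because passing from H^cop to H
  -- and back is definitionally the identity.
  let s (X : FDMod k (Cop H)) (N : FDMod k A) : N ⊙ᵣ ofCopMod X ≅ X ⊙ₗ N :=
    copSwap N (ofCopMod X)
  have h1 (N : FDMod k A) : N ⊴ᵣ f' ≫ (s Y N).hom = (s X N).hom ≫ f ⊵ₗ N :=
    actionHomRight_comp_copSwap N f' f rfl
  have h2 (Z : FDMod k (Cop H)) :
      F.map (s Z M).hom ≫ copδₗ F Z M = δᵣ F M (ofCopMod Z) ≫ (s Z (F.obj M)).hom :=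
    map_copSwap_comp_copδₗ F (ofCopMod Z) M
  rw [← cancel_epi (F.map (s X M).hom), reassoc_of% h2 X, ← h1, ← δᵣ_naturality_right_assoc, ← h2,
    ← F.map_comp_assoc, ← F.map_comp_assoc, h1]

theorem copδₗ_naturality_right [F.RightLinear (FDMod k H)] (X : FDMod k H) {M N : FDMod k A}
    (g : M ⟶ N) : F.map (toCopMod X ⊴ₗ g) ≫ copδₗ F (toCopMod X) N =
      copδₗ F (toCopMod X) M ≫ toCopMod X ⊴ₗ F.map g := by
  rw [← cancel_epi (F.map (copSwap M X).hom), reassoc_of% map_copSwap_comp_copδₗ,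
    ← actionHomLeft_comp_copSwap, ← δᵣ_naturality_left_assoc, ← map_copSwap_comp_copδₗ,
    ← F.map_comp_assoc, ← F.map_comp_assoc, actionHomLeft_comp_copSwap]

/-- Precomposition with the swap of Y ⊗ X past M and the flip turns this into associativity of δᵣ;
`copSwap_associator` is used once outside F and once inside. -/
theorem copδₗ_associativity [F.RightLinear (FDMod k H)] (X Y : FDMod k H) (M : FDMod k A) :
    copδₗ F (toCopMod X ⊗ toCopMod Y) M ≫ (αₗ _ _ _).hom = F.map (αₗ _ _ _).hom ≫
      copδₗ F (toCopMod X) (toCopMod Y ⊙ₗ M) ≫ toCopMod X ⊴ₗ copδₗ F (toCopMod Y) M := by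
  rw [← cancel_epi (F.map ((copSwap M (Y ⊗ X)).hom ≫ (copTensor Y X).hom ⊵ₗ M)), F.map_comp,
    Category.assoc, reassoc_of% copδₗ_naturality_left, reassoc_of% map_copSwap_comp_copδₗ,
    ← copSwap_associator, δᵣ_associativity_assoc, Category.assoc, ← F.map_comp_assoc,
    ← F.map_comp_assoc, Category.assoc, ← copSwap_associator, F.map_comp_assoc, F.map_comp_assoc,
    reassoc_of% map_copSwap_comp_copδₗ, δᵣ_naturality_left_assoc, ← actionHomLeft_comp_copSwap,
    ← MonoidalRightAction.comp_actionHomLeft_assoc, ← MonoidalRightAction.comp_actionHomLeft_assoc,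
    map_copSwap_comp_copδₗ]

theorem copδₗ_unitality_inv [F.RightLinear (FDMod k H)] (M : FDMod k A) :
    (λₗ (F.obj M)).inv = F.map (λₗ M).inv ≫ copδₗ F (𝟙_ (FDMod k (Cop H))) M := by
  refine Eq.trans ?_ (F.map_comp_assoc (λₗ[FDMod k (Cop H)] M).inv
    (copSwap M (𝟙_ (FDMod k H))).inv (δᵣ F M (𝟙_ (FDMod k H)) ≫
      (copSwap (F.obj M) (𝟙_ (FDMod k H))).hom))
  rw [leftUnitor_inv_comp_copSwap, ← δᵣ_unitality_inv_assoc, rightUnitor_inv_comp_copSwap]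

theorem copδᵣ_unitality_inv [F.LeftLinear (FDMod k (Cop H))] (M : FDMod k A) :
    (ρᵣ (F.obj M)).inv = F.map (ρᵣ M).inv ≫ copδᵣ F M (𝟙_ (FDMod k H)) := by
  refine Eq.trans ?_ (F.map_comp_assoc (ρᵣ M).inv (copSwap M (𝟙_ (FDMod k H))).hom
    (δₗ F (𝟙_ (FDMod k (Cop H))) M ≫ (copSwap (F.obj M) (𝟙_ (FDMod k H))).inv))
  rw [rightUnitor_inv_comp_copSwap]
  refine Eq.trans ?_ (δₗ_unitality_inv_assoc F M _)
  exact (leftUnitor_inv_comp_copSwap (F.obj M)).symm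

variable (H) in
/-- A right `Rep(H)`-linear functor is left `Rep(H^cop)`-linear. -/
abbrev leftLinearOfRightLinear [F.RightLinear (FDMod k H)] : F.LeftLinear (FDMod k (Cop H)) :=
  letI : F.OplaxLeftLinear (FDMod k (Cop H)) :=
    { δₗ := copδₗ F
      δₗ_naturality_left := copδₗ_naturality_left F
      δₗ_naturality_right := fun X => copδₗ_naturality_right F (ofCopMod X)
      δₗ_associativity := fun X Y => copδₗ_associativity F (ofCopMod X) (ofCopMod Y)
      δₗ_unitality_inv := copδₗ_unitality_inv F }
  have (X : FDMod k (Cop H)) (M : FDMod k A) : IsIso (δₗ F X M) :=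
    IsIso.comp_isIso' (F.mapIso (copSwap M (ofCopMod X))).isIso_inv (IsIso.comp_isIso' inferInstance
      (Iso.isIso_hom (copSwap (F.obj M) (ofCopMod X))))
  leftLinearOfIsIso F

variable (H) in
/-- A left `Rep(H^cop)`-linear functor is right `Rep(H)`-linear. -/
abbrev rightLinearOfLeftLinear [F.LeftLinear (FDMod k (Cop H))] : F.RightLinear (FDMod k H) :=
  letI : F.OplaxRightLinear (FDMod k H) :=
    { δᵣ := copδᵣ F
      δᵣ_naturality_right := fun M X Y f => by
        rw [← cancel_mono (copSwap _ _).hom, Category.assoc, Category.assoc, copδᵣ_comp_copSwap,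
          actionHomRight_comp_copSwap _ f (f' := mkHom (lin f) fun h : H => lin_comm f h) rfl,
          reassoc_of% copδᵣ_comp_copSwap, ← F.map_comp_assoc,
          actionHomRight_comp_copSwap _ f (f' := mkHom (lin f) fun h : H => lin_comm f h) rfl,
          F.map_comp_assoc, δₗ_naturality_left]
      δᵣ_naturality_left := fun f X => by
        rw [← cancel_mono (copSwap _ _).hom, Category.assoc, Category.assoc, copδᵣ_comp_copSwap,
          actionHomLeft_comp_copSwap, reassoc_of% copδᵣ_comp_copSwap, ← F.map_comp_assoc,
          actionHomLeft_comp_copSwap, F.map_comp_assoc, δₗ_naturality_right]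
      δᵣ_associativity := fun M X Y => by
        rw [← cancel_mono ((copSwap (F.obj M) X).hom ⊵ᵣ Y ≫ (copSwap _ Y).hom)]
        simp only [Category.assoc]
        rw [copSwap_associator, reassoc_of% copδᵣ_comp_copSwap,
          ← MonoidalRightAction.comp_actionHomLeft_assoc, copδᵣ_comp_copSwap,
          actionHomLeft_comp_copSwap, reassoc_of% copδᵣ_comp_copSwap, ← δₗ_naturality_left_assoc,
          δₗ_associativity, ← F.map_comp_assoc, ← F.map_comp_assoc, Category.assoc,
          ← copSwap_associator, MonoidalLeftAction.actionHomRight_comp,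
          ← δₗ_naturality_right_assoc, ← F.map_comp_assoc, ← F.map_comp_assoc,
          actionHomLeft_comp_copSwap]
        simp only [Category.assoc]
      δᵣ_unitality_inv := copδᵣ_unitality_inv F }
  have (M : FDMod k A) (X : FDMod k H) : IsIso (δᵣ F M X) := by
    change IsIso (_ ≫ _ ≫ _); infer_instance
  rightLinearOfIsIso F

end CopLinear

end HopfWall

namespace HopfWall

/-! ### Coactions of H ⊗ C and pairs of commuting coactions -/

section PairCoact

variable {k : Type u} [Field k] {H C : Type u} [Ring H] [Bialgebra k H] [Ring C] [Bialgebra k C]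

variable (k H C) in
/-- The bialgebra map `h ⊗ c ↦ h ε(c)`. -/
def projLeft : H ⊗[k] C →ₐc[k] H :=
  (Bialgebra.TensorProduct.rid k k H : H ⊗[k] k →ₐc[k] H).comp
    (Bialgebra.TensorProduct.map (.id k H) (Bialgebra.counitBialgHom k C))

variable (k H C) in
/-- The bialgebra map `h ⊗ c ↦ ε(h) c`. -/
def projRight : H ⊗[k] C →ₐc[k] C :=
  (Bialgebra.TensorProduct.lid k C : k ⊗[k] C →ₐc[k] C).comp
    (Bialgebra.TensorProduct.map (Bialgebra.counitBialgHom k H) (.id k C))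

theorem projLeft_tmul (h : H) (c : C) :
    (projLeft k H C).toLinearMap (h ⊗ₜ c) = Coalgebra.counit (R := k) c • h := rfl

theorem projRight_tmul (h : H) (c : C) :
    (projRight k H C).toLinearMap (h ⊗ₜ c) = Coalgebra.counit (R := k) h • c := rfl

variable {Y : Type u} [AddCommGroup Y] [Module k Y]

/-- The map `y ↦ (y₍₋₁₎ ⊗ y₍₀₎₍₋₁₎) ⊗ y₍₀₎₍₀₎` for two coactions. -/
def pairCoact (τ : Y →ₗ[k] H ⊗[k] Y) (ρ : Y →ₗ[k] C ⊗[k] Y) : Y →ₗ[k] (H ⊗[k] C) ⊗[k] Y :=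
  (TensorProduct.assoc k H C Y).symm.toLinearMap ∘ₗ ρ.lTensor H ∘ₗ τ

theorem projLeft_pairCoact (τ : Y →ₗ[k] H ⊗[k] Y) (ρ : Y →ₗ[k] C ⊗[k] Y)
    (hρ : ∀ y, (Bialgebra.counitAlgHom k C).toLinearMap.rTensor Y (ρ y) = 1 ⊗ₜ y) (y : Y) :
    (projLeft k H C).toLinearMap.rTensor Y (pairCoact τ ρ y) = τ y := by
  have h1 (h : H) (t : C ⊗[k] Y) : (projLeft k H C).toLinearMap.rTensor Y
      ((TensorProduct.assoc k H C Y).symm (h ⊗ₜ t)) = h ⊗ₜ TensorProduct.lid k Y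
        ((Bialgebra.counitAlgHom k C).toLinearMap.rTensor Y t) := by
    induction t using TensorProduct.induction_on with
    | zero => simp
    | add x y hx hy => simp only [map_add, TensorProduct.tmul_add, hx, hy]
    | tmul c y =>
      rw [TensorProduct.assoc_symm_tmul, LinearMap.rTensor_tmul, projLeft_tmul,
        LinearMap.rTensor_tmul, TensorProduct.lid_tmul, TensorProduct.smul_tmul]
      rfl
  change (projLeft k H C).toLinearMap.rTensor Y
    ((TensorProduct.assoc k H C Y).symm (ρ.lTensor H (τ y))) = τ y
  induction τ y using TensorProduct.induction_on with
  | zero => simp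
  | add x y hx hy => simp only [map_add, hx, hy]
  | tmul h y => rw [LinearMap.lTensor_tmul, h1, hρ, TensorProduct.lid_tmul, one_smul]

theorem projRight_pairCoact (τ : Y →ₗ[k] H ⊗[k] Y) (ρ : Y →ₗ[k] C ⊗[k] Y)
    (hτ : ∀ y, (Bialgebra.counitAlgHom k H).toLinearMap.rTensor Y (τ y) = 1 ⊗ₜ y) (y : Y) :
    (projRight k H C).toLinearMap.rTensor Y (pairCoact τ ρ y) = ρ y := by
  have h1 (t : H ⊗[k] Y) : (projRight k H C).toLinearMap.rTensor Y
      ((TensorProduct.assoc k H C Y).symm (ρ.lTensor H t)) = ρ (TensorProduct.lid k Y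
        ((Bialgebra.counitAlgHom k H).toLinearMap.rTensor Y t)) := by
    induction t using TensorProduct.induction_on with
    | zero => simp
    | add x y hx hy => simp only [map_add, hx, hy]
    | tmul h y =>
      simp only [LinearMap.lTensor_tmul, LinearMap.rTensor_tmul, TensorProduct.lid_tmul, map_smul,
        AlgHom.toLinearMap_apply, Bialgebra.counitAlgHom_apply]
      induction ρ y using TensorProduct.induction_on with
      | zero => simp
      | add x y hx hy => simp only [map_add, TensorProduct.tmul_add, smul_add, hx, hy]
      | tmul c y =>
        rw [TensorProduct.assoc_symm_tmul, LinearMap.rTensor_tmul, projRight_tmul,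
          TensorProduct.smul_tmul']
  exact (h1 _).trans (by rw [hτ, TensorProduct.lid_tmul, one_smul])

theorem pairCoact_counit (τ : Y →ₗ[k] H ⊗[k] Y) (ρ : Y →ₗ[k] C ⊗[k] Y)
    (hτ : ∀ y, (Bialgebra.counitAlgHom k H).toLinearMap.rTensor Y (τ y) = 1 ⊗ₜ y)
    (hρ : ∀ y, (Bialgebra.counitAlgHom k C).toLinearMap.rTensor Y (ρ y) = 1 ⊗ₜ y) (y : Y) :
    (Bialgebra.counitAlgHom k (H ⊗[k] C)).toLinearMap.rTensor Y (pairCoact τ ρ y) = 1 ⊗ₜ y := by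
  have h1 : (Bialgebra.counitAlgHom k (H ⊗[k] C)).toLinearMap =
      (Bialgebra.counitAlgHom k H).toLinearMap ∘ₗ (projLeft k H C).toLinearMap :=
    TensorProduct.ext' fun h c => by simp [mul_comm]
  rw [h1, LinearMap.rTensor_comp_apply, projLeft_pairCoact τ ρ hρ, hτ]

/-- Coassociativity of τ and ρ turns the left side into coactions taken in the order τ, τ, ρ, ρ,
while the iterated paired coaction takes them in the order τ, ρ, τ, ρ. The hypothesis `comm`
exchanges the middle two. -/
theorem pairCoact_coassoc (τ : Y →ₗ[k] H ⊗[k] Y) (ρ : Y →ₗ[k] C ⊗[k] Y)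
    (hτ : ∀ y, TensorProduct.assoc k H H Y
      ((Bialgebra.comulAlgHom k H).toLinearMap.rTensor Y (τ y)) = τ.lTensor H (τ y))
    (hρ : ∀ y, TensorProduct.assoc k C C Y
      ((Bialgebra.comulAlgHom k C).toLinearMap.rTensor Y (ρ y)) = ρ.lTensor C (ρ y))
    (comm : ∀ y, ρ.lTensor H (τ y) = TensorProduct.leftComm k C H Y (τ.lTensor C (ρ y))) (y : Y) :
    TensorProduct.assoc k (H ⊗[k] C) (H ⊗[k] C) Y
      ((Bialgebra.comulAlgHom k (H ⊗[k] C)).toLinearMap.rTensor Y (pairCoact τ ρ y)) =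
      (pairCoact τ ρ).lTensor (H ⊗[k] C) (pairCoact τ ρ y) := by
  -- `Φ` is h ⊗ (h' ⊗ (c ⊗ (c' ⊗ y))) ↦ (h ⊗ c) ⊗ ((h' ⊗ c') ⊗ y).
  let Φ : H ⊗[k] (H ⊗[k] (C ⊗[k] (C ⊗[k] Y))) →ₗ[k] (H ⊗[k] C) ⊗[k] ((H ⊗[k] C) ⊗[k] Y) :=
    ((TensorProduct.assoc k H C Y).symm.toLinearMap.lTensor (H ⊗[k] C)) ∘ₗ
    (TensorProduct.assoc k H C (H ⊗[k] (C ⊗[k] Y))).symm.toLinearMap ∘ₗ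
      (TensorProduct.leftComm k H C (C ⊗[k] Y)).toLinearMap.lTensor H
  have h1 (t : H ⊗[k] (C ⊗[k] Y)) : TensorProduct.assoc k (H ⊗[k] C) (H ⊗[k] C) Y
      ((Bialgebra.comulAlgHom k (H ⊗[k] C)).toLinearMap.rTensor Y
        ((TensorProduct.assoc k H C Y).symm t)) =
      Φ (TensorProduct.assoc k H H _ (TensorProduct.map (Bialgebra.comulAlgHom k H).toLinearMap
        ((TensorProduct.assoc k C C Y).toLinearMap ∘ₗ
          (Bialgebra.comulAlgHom k C).toLinearMap.rTensor Y) t)) := by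
    induction t using TensorProduct.induction_on with
    | zero => simp
    | add x y hx hy => simp only [map_add, hx, hy]
    | tmul h t =>
      induction t using TensorProduct.induction_on with
      | zero => simp
      | add x y hx hy => simp only [map_add, TensorProduct.tmul_add, hx, hy]
      | tmul c y =>
        simp only [TensorProduct.assoc_symm_tmul, LinearMap.rTensor_tmul,
          AlgHom.toLinearMap_apply, Bialgebra.comulAlgHom_apply, TensorProduct.comul_tmul,
          TensorProduct.map_tmul, LinearMap.comp_apply, LinearEquiv.coe_coe]
        generalize Coalgebra.comul (R := k) h = s
        generalize Coalgebra.comul (R := k) c = t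
        induction s using TensorProduct.induction_on with
        | zero => simp
        | add x y hx hy => simp only [map_add, TensorProduct.add_tmul, hx, hy]
        | tmul p q =>
          induction t using TensorProduct.induction_on with
          | zero => simp
          | add x y hx hy =>
            simp only [map_add, TensorProduct.add_tmul, TensorProduct.tmul_add, hx, hy]
          | tmul r s => rfl
  have h2 : (TensorProduct.assoc k C C Y).toLinearMap ∘ₗ
      (Bialgebra.comulAlgHom k C).toLinearMap.rTensor Y ∘ₗ ρ = ρ.lTensor C ∘ₗ ρ :=
    LinearMap.ext hρ
  have h3 (t : H ⊗[k] Y) : TensorProduct.assoc k H H (C ⊗[k] (C ⊗[k] Y)) (TensorProduct.map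
      (Bialgebra.comulAlgHom k H).toLinearMap (ρ.lTensor C ∘ₗ ρ) t) =
      ((ρ.lTensor C ∘ₗ ρ).lTensor H).lTensor H (TensorProduct.assoc k H H Y
        ((Bialgebra.comulAlgHom k H).toLinearMap.rTensor Y t)) := by
    induction t using TensorProduct.induction_on with
    | zero => simp
    | add x y hx hy => simp only [map_add, hx, hy]
    | tmul h y =>
      simp only [TensorProduct.map_tmul, LinearMap.rTensor_tmul]
      induction (Bialgebra.comulAlgHom k H).toLinearMap h using TensorProduct.induction_on with
      | zero => simp
      | add x y hx hy => simp only [map_add, TensorProduct.add_tmul, hx, hy]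
      | tmul p q => rfl
  have h4 : (ρ.lTensor C ∘ₗ ρ).lTensor H ∘ₗ τ =
      (TensorProduct.leftComm k C H (C ⊗[k] Y)).toLinearMap ∘ₗ
        (ρ.lTensor H ∘ₗ τ).lTensor C ∘ₗ ρ := by
    refine LinearMap.ext fun y => ?_
    simp only [LinearMap.lTensor_comp, LinearMap.comp_apply, comm, LinearEquiv.coe_coe]
    exact LinearMap.congr_fun (f := (ρ.lTensor C).lTensor H ∘ₗ
      (TensorProduct.leftComm k C H Y).toLinearMap) (g :=
      (TensorProduct.leftComm k C H (C ⊗[k] Y)).toLinearMap ∘ₗ (ρ.lTensor H).lTensor C)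
      (TensorProduct.ext_threefold' fun c h y => rfl) (τ.lTensor C (ρ y))
  have h5 (t : H ⊗[k] (C ⊗[k] Y)) : Φ (((TensorProduct.leftComm k C H (C ⊗[k] Y)).toLinearMap ∘ₗ
        (ρ.lTensor H ∘ₗ τ).lTensor C).lTensor H t) =
      (pairCoact τ ρ).lTensor (H ⊗[k] C) ((TensorProduct.assoc k H C Y).symm t) := by
    induction t using TensorProduct.induction_on with
    | zero => simp
    | add x y hx hy => simp only [map_add, hx, hy]
    | tmul h t =>
      induction t using TensorProduct.induction_on with
      | zero => simp
      | add x y hx hy => simp only [map_add, TensorProduct.tmul_add, hx, hy]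
      | tmul c y =>
        simp only [Φ, pairCoact, LinearMap.comp_apply, LinearMap.lTensor_tmul, LinearEquiv.coe_coe,
          TensorProduct.assoc_symm_tmul]
        generalize ρ.lTensor H (τ y) = s
        induction s using TensorProduct.induction_on with
        | zero => simp
        | add x y hx hy => simp only [map_add, TensorProduct.tmul_add, hx, hy]
        | tmul p q => rfl
  change TensorProduct.assoc k (H ⊗[k] C) (H ⊗[k] C) Y
      ((Bialgebra.comulAlgHom k (H ⊗[k] C)).toLinearMap.rTensor Y
        ((TensorProduct.assoc k H C Y).symm (ρ.lTensor H (τ y)))) =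
      (pairCoact τ ρ).lTensor (H ⊗[k] C) ((TensorProduct.assoc k H C Y).symm (ρ.lTensor H (τ y)))
  rw [h1, ← h5, ← LinearMap.comp_apply (TensorProduct.map _ _), LinearMap.map_comp_lTensor,
    LinearMap.comp_assoc, h2, h3, hτ, ← LinearMap.lTensor_comp_apply, h4,
    ← LinearMap.lTensor_comp_apply, LinearMap.comp_assoc]

/-- The maps mH, mC and mK stand for left multiplications or for right multiplications, so one
computation covers both actions of a covariant bimodule. -/
theorem pairCoact_act {A : Type u} [AddCommGroup A] [Module k A] (τ : Y →ₗ[k] H ⊗[k] Y)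
    (ρ : Y →ₗ[k] C ⊗[k] Y) (σ : A →ₗ[k] H ⊗[k] A) (π : A →ₗ[k] C ⊗[k] A)
    (L : A →ₗ[k] Module.End k Y) (mH : H →ₗ[k] Module.End k H) (mC : C →ₗ[k] Module.End k C)
    (mK : H ⊗[k] C →ₗ[k] Module.End k (H ⊗[k] C))
    (hm : ∀ h c, mK (h ⊗ₜ c) = TensorProduct.map (mH h) (mC c))
    (hτ : ∀ a y, τ (L a y) =
      TensorProduct.homTensorHomMap (.id k) H Y H Y (TensorProduct.map mH L (σ a)) (τ y))
    (hρ : ∀ a y, ρ (L a y) =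
      TensorProduct.homTensorHomMap (.id k) C Y C Y (TensorProduct.map mC L (π a)) (ρ y))
    (a : A) (y : Y) : pairCoact τ ρ (L a y) =
      TensorProduct.homTensorHomMap (.id k) (H ⊗[k] C) Y (H ⊗[k] C) Y
        (TensorProduct.map mK L (pairCoact σ π a)) (pairCoact τ ρ y) := by
  simp only [pairCoact, LinearMap.comp_apply, LinearEquiv.coe_coe, hτ]
  generalize σ a = s
  generalize τ y = t
  induction s using TensorProduct.induction_on with
  | zero => simp
  | add x y hx hy => simp only [map_add, LinearMap.add_apply, hx, hy]
  | tmul h b =>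
    induction t using TensorProduct.induction_on with
    | zero => simp
    | add x y hx hy => simp only [map_add, hx, hy]
    | tmul g z =>
      simp only [TensorProduct.map_tmul, TensorProduct.homTensorHomMap_apply,
        LinearMap.lTensor_tmul, hρ]
      generalize π b = s
      generalize ρ z = t
      induction s using TensorProduct.induction_on with
      | zero => simp
      | add x y hx hy =>
        simp only [map_add, TensorProduct.tmul_add, LinearMap.add_apply, hx, hy]
      | tmul c b =>
        induction t using TensorProduct.induction_on with
        | zero => simp
        | add x y hx hy => simp only [map_add, TensorProduct.tmul_add, hx, hy]
        | tmul d z => simp [hm]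

/-- The counits erase c₍₁₎ and h₍₂₎. This recovers a coaction of H ⊗ C from its two components; the
mirror image `map_projRight_projLeft_comp_comul` gives the flip, and comparing the two shows that
the components commute. -/
theorem map_projLeft_projRight_comp_comul :
    TensorProduct.map (projLeft k H C).toLinearMap (projRight k H C).toLinearMap ∘ₗ
      (Bialgebra.comulAlgHom k (H ⊗[k] C)).toLinearMap = .id := by
  have h1 (s : H ⊗[k] H) (t : C ⊗[k] C) :
      TensorProduct.map (projLeft k H C).toLinearMap (projRight k H C).toLinearMap
        (TensorProduct.AlgebraTensorModule.tensorTensorTensorComm k k k k H H C C (s ⊗ₜ t)) =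
      TensorProduct.rid k H (Coalgebra.counit.lTensor H s) ⊗ₜ
        TensorProduct.lid k C (Coalgebra.counit.rTensor C t) := by
    induction s using TensorProduct.induction_on with
    | zero => simp
    | add x y hx hy => simp only [map_add, TensorProduct.add_tmul, hx, hy]
    | tmul p q =>
      induction t using TensorProduct.induction_on with
      | zero => simp
      | add x y hx hy => simp only [map_add, TensorProduct.tmul_add, hx, hy]
      | tmul r s =>
        change (Coalgebra.counit (R := k) r • p) ⊗ₜ[k] (Coalgebra.counit (R := k) q • s) =
          (Coalgebra.counit (R := k) q • p) ⊗ₜ[k] (Coalgebra.counit (R := k) r • s)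
        rw [TensorProduct.smul_tmul_smul, TensorProduct.smul_tmul_smul, mul_comm]
  refine TensorProduct.ext' fun h c => ?_
  change TensorProduct.map _ _ (Coalgebra.comul (h ⊗ₜ[k] c)) = _
  rw [TensorProduct.comul_tmul, h1, Coalgebra.lTensor_counit_comul, Coalgebra.rTensor_counit_comul]
  simp

theorem map_projRight_projLeft_comp_comul :
    TensorProduct.map (projRight k H C).toLinearMap (projLeft k H C).toLinearMap ∘ₗ
      (Bialgebra.comulAlgHom k (H ⊗[k] C)).toLinearMap = (TensorProduct.comm k H C).toLinearMap := by
  have h1 (s : H ⊗[k] H) (t : C ⊗[k] C) :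
      TensorProduct.map (projRight k H C).toLinearMap (projLeft k H C).toLinearMap
        (TensorProduct.AlgebraTensorModule.tensorTensorTensorComm k k k k H H C C (s ⊗ₜ t)) =
      TensorProduct.rid k C (Coalgebra.counit.lTensor C t) ⊗ₜ
        TensorProduct.lid k H (Coalgebra.counit.rTensor H s) := by
    induction s using TensorProduct.induction_on with
    | zero => simp
    | add x y hx hy => simp only [map_add, TensorProduct.add_tmul, TensorProduct.tmul_add, hx, hy]
    | tmul p q =>
      induction t using TensorProduct.induction_on with
      | zero => simp
      | add x y hx hy =>
        simp only [map_add, TensorProduct.add_tmul, TensorProduct.tmul_add, hx, hy]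
      | tmul r s =>
        change (Coalgebra.counit (R := k) p • r) ⊗ₜ[k] (Coalgebra.counit (R := k) s • q) =
          (Coalgebra.counit (R := k) s • r) ⊗ₜ[k] (Coalgebra.counit (R := k) p • q)
        rw [TensorProduct.smul_tmul_smul, TensorProduct.smul_tmul_smul, mul_comm]
  refine TensorProduct.ext' fun h c => ?_
  change TensorProduct.map _ _ (Coalgebra.comul (h ⊗ₜ[k] c)) = _
  rw [TensorProduct.comul_tmul, h1, Coalgebra.lTensor_counit_comul, Coalgebra.rTensor_counit_comul]
  simp

section

variable {K : Type u} [Ring K] [Bialgebra k K] (ρ : Y →ₗ[k] K ⊗[k] Y)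
  (hρ : ∀ y, TensorProduct.assoc k K K Y
    ((Bialgebra.comulAlgHom k K).toLinearMap.rTensor Y (ρ y)) = ρ.lTensor _ (ρ y))

include hρ

/-- Coassociativity: coacting twice and pushing the two legs along f and g is coacting once and
applying (f ⊗ g)Δ. -/
theorem map_comp_lTensor_coact {V W : Type u} [AddCommGroup V] [Module k V] [AddCommGroup W]
    [Module k W] (f : K →ₗ[k] V) (g : K →ₗ[k] W) (y : Y) :
    (g.rTensor Y ∘ₗ ρ).lTensor V (f.rTensor Y (ρ y)) = TensorProduct.assoc k V W Y
      ((TensorProduct.map f g ∘ₗ (Bialgebra.comulAlgHom k K).toLinearMap).rTensor Y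
        (ρ y)) := by
  rw [LinearMap.rTensor_comp_apply]
  have h1 (t : (K ⊗[k] K) ⊗[k] Y) : TensorProduct.assoc k V W Y
      ((TensorProduct.map f g).rTensor Y t) = TensorProduct.map f (g.rTensor Y)
        (TensorProduct.assoc k _ _ Y t) :=
    LinearMap.congr_fun (f := (TensorProduct.assoc k V W Y).toLinearMap ∘ₗ
      (TensorProduct.map f g).rTensor Y) (g := TensorProduct.map f (g.rTensor Y) ∘ₗ
        (TensorProduct.assoc k _ _ Y).toLinearMap) (TensorProduct.ext_threefold fun _ _ _ => rfl) t
  rw [h1, hρ]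
  generalize ρ y = t
  exact LinearMap.congr_fun (f := (g.rTensor Y ∘ₗ ρ).lTensor V ∘ₗ f.rTensor Y)
    (g := TensorProduct.map f (g.rTensor Y) ∘ₗ ρ.lTensor _) (TensorProduct.ext' fun x y => rfl) t

end

section Restrict

variable (ρ : Y →ₗ[k] (H ⊗[k] C) ⊗[k] Y)
  (hρ : ∀ y, TensorProduct.assoc k (H ⊗[k] C) (H ⊗[k] C) Y
    ((Bialgebra.comulAlgHom k (H ⊗[k] C)).toLinearMap.rTensor Y (ρ y)) = ρ.lTensor _ (ρ y))

include hρ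

theorem pairCoact_proj (y : Y) :
    pairCoact ((projLeft k H C).toLinearMap.rTensor Y ∘ₗ ρ)
      ((projRight k H C).toLinearMap.rTensor Y ∘ₗ ρ) y = ρ y := by
  change (TensorProduct.assoc k H C Y).symm (((projRight k H C).toLinearMap.rTensor Y ∘ₗ ρ).lTensor H
    ((projLeft k H C).toLinearMap.rTensor Y (ρ y))) = _
  rw [map_comp_lTensor_coact ρ hρ, map_projLeft_projRight_comp_comul, LinearMap.rTensor_id,
    LinearEquiv.symm_apply_apply, LinearMap.id_apply]

theorem proj_coact_comm (y : Y) :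
    ((projRight k H C).toLinearMap.rTensor Y ∘ₗ ρ).lTensor H
      ((projLeft k H C).toLinearMap.rTensor Y (ρ y)) = TensorProduct.leftComm k C H Y
    (((projLeft k H C).toLinearMap.rTensor Y ∘ₗ ρ).lTensor C
      ((projRight k H C).toLinearMap.rTensor Y (ρ y))) := by
  rw [map_comp_lTensor_coact ρ hρ, map_comp_lTensor_coact ρ hρ, map_projLeft_projRight_comp_comul,
    map_projRight_projLeft_comp_comul]
  exact LinearMap.congr_fun (f := (TensorProduct.assoc k H C Y).toLinearMap ∘ₗ .rTensor Y .id)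
    (g := (TensorProduct.leftComm k C H Y).toLinearMap ∘ₗ
      (TensorProduct.assoc k C H Y).toLinearMap ∘ₗ
        (TensorProduct.comm k H C).toLinearMap.rTensor Y)
    (TensorProduct.ext_threefold fun _ _ _ => rfl) (ρ y)

end Restrict

end PairCoact

end HopfWall

/-! ### Covariant bimodules over H₁ ⊗ H₂^cop and their two components -/

namespace HopfWall

open scoped MonoidalLeftAction MonoidalRightAction
open FDMod

variable {k : Type u} [Field k]

namespace CovariantBimodule

section Restrict

variable {K H A : Type u} [Ring K] [Bialgebra k K] [Ring H] [Bialgebra k H] [Ring A] [Algebra k A]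
  [LeftComoduleAlgebra k K A] [LeftComoduleAlgebra k H A]

omit [LeftComoduleAlgebra k K A] [LeftComoduleAlgebra k H A] in
-- Covariance survives corestriction because φ is multiplicative. With mK and mH arbitrary, the
-- lemma serves the left action and, with flipped products, the right one.
theorem homTensorHomMap_rTensor {V : Type u} [AddCommGroup V] [Module k V] (φ : K →ₗ[k] H)
    (mK : K →ₗ[k] Module.End k K) (mH : H →ₗ[k] Module.End k H)
    (hm : ∀ x y, φ (mK x y) = mH (φ x) (φ y)) (L : A →ₗ[k] Module.End k V) (s : K ⊗[k] A)
    (t : K ⊗[k] V) :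
    φ.rTensor V (TensorProduct.homTensorHomMap (.id k) K V K V (TensorProduct.map mK L s) t) =
      TensorProduct.homTensorHomMap (.id k) H V H V (TensorProduct.map mH L (φ.rTensor A s))
        (φ.rTensor V t) := by
  induction s using TensorProduct.induction_on with
  | zero => simp
  | add x y hx hy => simp only [map_add, LinearMap.add_apply, hx, hy]
  | tmul x a =>
    induction t using TensorProduct.induction_on with
    | zero => simp
    | add x y hx hy => simp only [map_add, hx, hy]
    | tmul y v => simp [hm]

/-- The corestriction of a covariant bimodule along a map of bialgebras. -/
abbrev corestrict (φ : K →ₐc[k] H)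
    (hφ : ∀ a : A, LeftComoduleAlgebra.coact (k := k) (H := H) a =
      φ.toLinearMap.rTensor A (LeftComoduleAlgebra.coact (k := k) (H := K) a))
    (Y : CovariantBimodule k K A) : CovariantBimodule k H A where
  carrier := Y.carrier
  left := Y.left
  right := Y.right
  right_one := Y.right_one
  right_mul := Y.right_mul
  left_right := Y.left_right
  coact := φ.toLinearMap.rTensor Y.carrier ∘ₗ Y.coact
  coassoc y := by
    have h : (Bialgebra.comulAlgHom k H).toLinearMap ∘ₗ φ.toLinearMap =
        TensorProduct.map φ.toLinearMap φ.toLinearMap ∘ₗ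
          (Bialgebra.comulAlgHom k K).toLinearMap := φ.map_comp_comul.symm
    rw [LinearMap.comp_apply, map_comp_lTensor_coact Y.coact Y.coassoc, ← h,
      LinearMap.rTensor_comp_apply]
  counit_coact y := by
    have h : (Bialgebra.counitAlgHom k H).toLinearMap ∘ₗ φ.toLinearMap =
        (Bialgebra.counitAlgHom k K).toLinearMap := φ.counit_comp
    rw [LinearMap.comp_apply, ← LinearMap.rTensor_comp_apply, h, Y.counit_coact]
  coact_left a y := by
    rw [LinearMap.comp_apply, Y.coact_left, hφ, homTensorHomMap_rTensor _ _ (LinearMap.mul k H) (map_mul φ)]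
    rfl
  coact_right a y := by
    rw [LinearMap.comp_apply, Y.coact_right, hφ,
      homTensorHomMap_rTensor _ _ (LinearMap.mul k H).flip fun x y => map_mul φ y x]
    rfl

end Restrict

end CovariantBimodule

section Pair

variable {H₁ H₂ B : Type u} [Ring H₁] [Bialgebra k H₁] [Ring H₂] [Bialgebra k H₂] [Ring B]
  [Algebra k B] [LeftComoduleAlgebra k H₁ B] [RightComoduleAlgebra k H₂ B]

/-- The folded coaction of B is itself a paired one, so covariance over H₁ ⊗ H₂^cop can be assembled
from the factors and projected back to them. -/
theorem foldCoact_eq_pairCoact : (foldCoact k H₁ H₂ B).toLinearMap =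
    pairCoact (LeftComoduleAlgebra.coact (k := k) (H := H₁) (A := B)).toLinearMap
      (LeftComoduleAlgebra.coact (k := k) (H := Cop H₂) (A := B)).toLinearMap := by
  refine LinearMap.ext fun b => ?_
  change foldEquiv k H₁ H₂ B ((RightComoduleAlgebra.coact (k := k) (H := H₂)
      (A := B)).toLinearMap.lTensor H₁ (LeftComoduleAlgebra.coact (k := k) (H := H₁) b)) =
    (TensorProduct.assoc k H₁ (Cop H₂) B).symm ((copCoact k H₂ B).toLinearMap.lTensor H₁
      (LeftComoduleAlgebra.coact (k := k) (H := H₁) b))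
  induction LeftComoduleAlgebra.coact (k := k) (H := H₁) b using TensorProduct.induction_on with
  | zero => simp
  | add x y hx hy => simp only [map_add, hx, hy]
  | tmul h b =>
    simp only [LinearMap.lTensor_tmul, AlgHom.toLinearMap_apply, copCoact_apply]
    induction RightComoduleAlgebra.coact (k := k) (H := H₂) b using TensorProduct.induction_on with
    | zero => simp
    | add x y hx hy => simp only [map_add, TensorProduct.tmul_add, hx, hy]
    | tmul b g => rfl

variable [BicomoduleAlgebra k H₁ H₂ B]

/-- The bicomodule axiom, with the right coaction read as a left coaction of H₂^cop. -/
theorem coact_copCoact_comm (b : B) :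
    (LeftComoduleAlgebra.coact (k := k) (H := Cop H₂) (A := B)).toLinearMap.lTensor H₁
      (LeftComoduleAlgebra.coact (k := k) (H := H₁) b) = TensorProduct.leftComm k (Cop H₂) H₁ B
    ((LeftComoduleAlgebra.coact (k := k) (H := H₁) (A := B)).toLinearMap.lTensor (Cop H₂)
      (LeftComoduleAlgebra.coact (k := k) (H := Cop H₂) b)) := by
  have h1 : (LeftComoduleAlgebra.coact (k := k) (H := Cop H₂) (A := B)).toLinearMap =
      (toCop k H₂).toLinearMap.rTensor B ∘ₗ (TensorProduct.comm k B H₂).toLinearMap ∘ₗ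
        (RightComoduleAlgebra.coact (k := k) (H := H₂) (A := B)).toLinearMap := rfl
  have h2 : LeftComoduleAlgebra.coact (k := k) (H := Cop H₂) b =
      (toCop k H₂).toLinearMap.rTensor B (TensorProduct.comm k B H₂
        (RightComoduleAlgebra.coact (k := k) (H := H₂) b)) := rfl
  rw [h1, h2, ← LinearMap.comp_assoc, LinearMap.lTensor_comp_apply,
    ← BicomoduleAlgebra.coact_comm (k := k) (H₁ := H₁) (H₂ := H₂) b]
  induction RightComoduleAlgebra.coact (k := k) (H := H₂) b using TensorProduct.induction_on with
  | zero => simp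
  | add x y hx hy => simp only [map_add, hx, hy]
  | tmul b g =>
    simp only [LinearMap.rTensor_tmul, TensorProduct.comm_tmul, LinearMap.lTensor_tmul,
      AlgHom.toLinearMap_apply]
    induction LeftComoduleAlgebra.coact (k := k) (H := H₁) b using TensorProduct.induction_on with
    | zero => simp
    | add x y hx hy => simp only [map_add, TensorProduct.add_tmul, TensorProduct.tmul_add, hx, hy]
    | tmul h b => rfl

namespace CovariantBimodule

/-- The covariant bimodule over `H₁ ⊗ H₂^cop` given by two commuting coactions. -/
abbrev pair (Y : CovariantBimodule k H₁ B) (ρ : Y.carrier →ₗ[k] Cop H₂ ⊗[k] Y.carrier)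
    (coassoc : ∀ y, TensorProduct.assoc k (Cop H₂) (Cop H₂) Y.carrier
      ((Bialgebra.comulAlgHom k (Cop H₂)).toLinearMap.rTensor Y.carrier (ρ y)) =
        ρ.lTensor (Cop H₂) (ρ y))
    (counit_coact : ∀ y,
      (Bialgebra.counitAlgHom k (Cop H₂)).toLinearMap.rTensor Y.carrier (ρ y) = 1 ⊗ₜ y)
    (coact_left : ∀ a y, ρ (Y.left a y) =
      TensorProduct.homTensorHomMap (.id k) (Cop H₂) Y.carrier (Cop H₂) Y.carrier
        (TensorProduct.map (LinearMap.mul k (Cop H₂)) Y.left.toLinearMap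
          (LeftComoduleAlgebra.coact a)) (ρ y))
    (coact_right : ∀ a y, ρ (Y.right a y) =
      TensorProduct.homTensorHomMap (.id k) (Cop H₂) Y.carrier (Cop H₂) Y.carrier
        (TensorProduct.map (LinearMap.mul k (Cop H₂)).flip Y.right
          (LeftComoduleAlgebra.coact a)) (ρ y))
    (comm : ∀ y, ρ.lTensor H₁ (Y.coact y) =
      TensorProduct.leftComm k (Cop H₂) H₁ Y.carrier (Y.coact.lTensor (Cop H₂) (ρ y))) :
    CovariantBimodule k (H₁ ⊗[k] Cop H₂) B where
  carrier := Y.carrier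
  left := Y.left
  right := Y.right
  right_one := Y.right_one
  right_mul := Y.right_mul
  left_right := Y.left_right
  coact := pairCoact Y.coact ρ
  coassoc := pairCoact_coassoc _ _ Y.coassoc coassoc comm
  counit_coact := pairCoact_counit _ _ Y.counit_coact counit_coact
  coact_left a y := by
    refine (pairCoact_act Y.coact ρ
      (LeftComoduleAlgebra.coact (k := k) (H := H₁) (A := B)).toLinearMap
      (LeftComoduleAlgebra.coact (k := k) (H := Cop H₂) (A := B)).toLinearMap Y.left.toLinearMap
      (LinearMap.mul k H₁) (LinearMap.mul k (Cop H₂))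
      (LinearMap.mul k (H₁ ⊗[k] Cop H₂)) (fun h c => TensorProduct.ext' fun _ _ =>
        Algebra.TensorProduct.tmul_mul_tmul _ _ _ _)
      Y.coact_left coact_left a y).trans ?_
    rw [← foldCoact_eq_pairCoact]
    rfl
  coact_right a y := by
    refine (pairCoact_act Y.coact ρ
      (LeftComoduleAlgebra.coact (k := k) (H := H₁) (A := B)).toLinearMap
      (LeftComoduleAlgebra.coact (k := k) (H := Cop H₂) (A := B)).toLinearMap Y.right
      (LinearMap.mul k H₁).flip (LinearMap.mul k (Cop H₂)).flip
      (LinearMap.mul k (H₁ ⊗[k] Cop H₂)).flip (fun h c => TensorProduct.ext' fun _ _ =>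
        Algebra.TensorProduct.tmul_mul_tmul _ _ _ _)
      Y.coact_right coact_right a y).trans ?_
    rw [← foldCoact_eq_pairCoact]
    rfl

variable (Y : CovariantBimodule k (H₁ ⊗[k] Cop H₂) B)

/-- The left component of the coaction of `H₁ ⊗ H₂^cop`. -/
abbrev fst : CovariantBimodule k H₁ B :=
  Y.corestrict (projLeft k H₁ (Cop H₂)) fun b => by
    have h := projLeft_pairCoact (LeftComoduleAlgebra.coact (k := k) (H := H₁) (A := B)).toLinearMap
      (LeftComoduleAlgebra.coact (k := k) (H := Cop H₂) (A := B)).toLinearMap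
      LeftComoduleAlgebra.counit_coact b
    rw [← foldCoact_eq_pairCoact] at h
    exact h.symm

/-- The right component of the coaction of `H₁ ⊗ H₂^cop`. -/
abbrev snd : CovariantBimodule k (Cop H₂) B :=
  Y.corestrict (projRight k H₁ (Cop H₂)) fun b => by
    have h := projRight_pairCoact
      (LeftComoduleAlgebra.coact (k := k) (H := H₁) (A := B)).toLinearMap
      (LeftComoduleAlgebra.coact (k := k) (H := Cop H₂) (A := B)).toLinearMap
      LeftComoduleAlgebra.counit_coact b
    rw [← foldCoact_eq_pairCoact] at h
    exact h.symm

theorem pairCoact_fst_snd (y : Y.carrier) : pairCoact Y.fst.coact Y.snd.coact y = Y.coact y :=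
  pairCoact_proj Y.coact Y.coassoc y

theorem fst_snd_comm (y : Y.carrier) : Y.snd.coact.lTensor H₁ (Y.fst.coact y) =
    TensorProduct.leftComm k (Cop H₂) H₁ Y.carrier
      (Y.fst.coact.lTensor (Cop H₂) (Y.snd.coact y)) :=
  proj_coact_comm Y.coact Y.coassoc y

end CovariantBimodule

end Pair

end HopfWall

/-! ### Compatible module structures and commuting coactions -/

namespace HopfWall

open scoped MonoidalLeftAction MonoidalRightAction
open FDMod Functor.LaxLeftLinear Functor.OplaxLeftLinear Functor.LaxRightLinear
  Functor.OplaxRightLinear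

variable {k : Type u} [Field k]

instance {H : Type u} [Ring H] [Algebra k H] [FiniteDimensional k H] :
    FiniteDimensional k (Cop H) :=
  inferInstanceAs (FiniteDimensional k H)

variable {H₁ H₂ B : Type u} [Ring H₁] [Bialgebra k H₁] [Ring H₂] [Bialgebra k H₂] [Ring B]
  [Algebra k B] [LeftComoduleAlgebra k H₁ B] [RightComoduleAlgebra k H₂ B]

section Naturality

variable {F G : FDMod k B ⥤ FDMod k B} [F.RightLinear (FDMod k H₂)] [G.RightLinear (FDMod k H₂)]
  [F.LeftLinear (FDMod k (Cop H₂))] [G.LeftLinear (FDMod k (Cop H₂))]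

/-- The hypotheses tie the left structures over H₂^cop to the right structures over H₂ through the
swap. Swaps and structure maps are invertible, so cancelling them matches the two squares. -/
theorem comp_μᵣ_iff
    (hF : ∀ (M : FDMod k B) (Y : FDMod k H₂), F.map (copSwap M Y).hom ≫ δₗ F (toCopMod Y) M =
      δᵣ F M Y ≫ (copSwap (F.obj M) Y).hom)
    (hG : ∀ (M : FDMod k B) (Y : FDMod k H₂), G.map (copSwap M Y).hom ≫ δₗ G (toCopMod Y) M =
      δᵣ G M Y ≫ (copSwap (G.obj M) Y).hom) (α : F ⟶ G) (M : FDMod k B) (Y : FDMod k H₂) :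
    μᵣ F M Y ≫ α.app (M ⊙ᵣ Y) = α.app M ⊵ᵣ Y ≫ μᵣ G M Y ↔
      α.app (toCopMod Y ⊙ₗ M) ≫ δₗ G (toCopMod Y) M =
        δₗ F (toCopMod Y) M ≫ toCopMod Y ⊴ₗ α.app M := by
  rw [← cancel_epi (F.map (copSwap M Y).hom), α.naturality_assoc, hG, reassoc_of% hF,
    ← actionHomLeft_comp_copSwap, ← cancel_epi (μᵣ F M Y),
    ← cancel_mono (δᵣ G M Y ≫ (copSwap (G.obj M) Y).hom)]
  simp

end Naturality

variable [BicomoduleAlgebra k H₁ H₂ B]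

/-- The map `y ⊗ (x ⊗ m) ↦ x ⊗ (y ⊗ m)`. -/
def actionSwap (X : FDMod k H₁) (Y : FDMod k H₂) (M : FDMod k B) :
    toCopMod Y ⊙ₗ X ⊙ₗ M ⟶ X ⊙ₗ toCopMod Y ⊙ₗ M :=
  (copSwap (X ⊙ₗ M) Y).inv ≫ (middleAssoc X M Y).hom ≫ X ⊴ₗ (copSwap M Y).hom

theorem lin_actionSwap (X : FDMod k H₁) (Y : FDMod k H₂) (M : FDMod k B) :
    lin (actionSwap X Y M) = (TensorProduct.leftComm k Y.carrier X.carrier M.carrier).toLinearMap :=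
  TensorProduct.ext_threefold' fun _ _ _ => rfl

/-- All maps are invertible, so the identity for the μ's can be inverted into one for the δ's;
conjugation by swaps then replaces the right structure by a left one. In this form both structures
can be translated into coactions. -/
theorem compatible_iff (F : FDMod k B ⥤ FDMod k B) [F.LeftLinear (FDMod k H₁)]
    [F.RightLinear (FDMod k H₂)] [F.LeftLinear (FDMod k (Cop H₂))]
    (hF : ∀ (M : FDMod k B) (Y : FDMod k H₂), F.map (copSwap M Y).hom ≫ δₗ F (toCopMod Y) M =
      δᵣ F M Y ≫ (copSwap (F.obj M) Y).hom)
    (X : FDMod k H₁) (M : FDMod k B) (Y : FDMod k H₂) :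
    μₗ F X M ⊵ᵣ Y ≫ μᵣ F (X ⊙ₗ M) Y ≫ F.map (middleAssoc X M Y).hom =
      (middleAssoc X (F.obj M) Y).hom ≫ X ⊴ₗ μᵣ F M Y ≫ μₗ F X (M ⊙ᵣ Y) ↔
    F.map (actionSwap X Y M) ≫ δₗ F X (toCopMod Y ⊙ₗ M) ≫ X ⊴ₗ δₗ F (toCopMod Y) M =
      δₗ F (toCopMod Y) (X ⊙ₗ M) ≫ toCopMod Y ⊴ₗ δₗ F X M ≫ actionSwap X Y (F.obj M) := by
  have h1 : F.map (copSwap (X ⊙ₗ M) Y).hom ≫ F.map (actionSwap X Y M) ≫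
      δₗ F X (toCopMod Y ⊙ₗ M) ≫ X ⊴ₗ δₗ F (toCopMod Y) M =
      (F.map (middleAssoc X M Y).hom ≫ δₗ F X (M ⊙ᵣ Y) ≫ X ⊴ₗ δᵣ F M Y) ≫
        X ⊴ₗ (copSwap (F.obj M) Y).hom := by
    rw [actionSwap, ← F.map_comp_assoc, Iso.hom_inv_id_assoc, F.map_comp, Category.assoc,
      δₗ_naturality_right_assoc, ← MonoidalLeftAction.actionHomRight_comp, hF,
      MonoidalLeftAction.actionHomRight_comp]
    simp only [Category.assoc]
  have h2 : F.map (copSwap (X ⊙ₗ M) Y).hom ≫ δₗ F (toCopMod Y) (X ⊙ₗ M) ≫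
      toCopMod Y ⊴ₗ δₗ F X M ≫ actionSwap X Y (F.obj M) =
      (δᵣ F (X ⊙ₗ M) Y ≫ δₗ F X M ⊵ᵣ Y ≫ (middleAssoc X (F.obj M) Y).hom) ≫
        X ⊴ₗ (copSwap (F.obj M) Y).hom := by
    rw [reassoc_of% hF, ← reassoc_of% actionHomLeft_comp_copSwap, actionSwap,
      Iso.hom_inv_id_assoc]
    simp only [Category.assoc]
  rw [← cancel_epi (F.map (copSwap (X ⊙ₗ M) Y).hom), h1, h2, cancel_mono,
    ← cancel_mono (δₗ F X (M ⊙ᵣ Y) ≫ X ⊴ₗ δᵣ F M Y),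
    ← cancel_epi (δᵣ F (X ⊙ₗ M) Y ≫ δₗ F X M ⊵ᵣ Y)]
  have h3 : X ⊴ₗ μᵣ F M Y ≫ X ⊴ₗ δᵣ F M Y = 𝟙 _ := by
    rw [← MonoidalLeftAction.actionHomRight_comp, Functor.RightLinear.μᵣ_comp_δᵣ,
      MonoidalLeftAction.actionHomRight_id]
  have h4 : δₗ F X M ⊵ᵣ Y ≫ μₗ F X M ⊵ᵣ Y = 𝟙 _ := by
    rw [← MonoidalRightAction.comp_actionHomLeft, Functor.LeftLinear.δₗ_comp_μₗ,
      MonoidalRightAction.id_actionHomLeft]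
  simp [reassoc_of% h4, h3]

variable [FiniteDimensional k H₁] [FiniteDimensional k H₂] [FiniteDimensional k B]

variable (k H₁ H₂) in
/-- The map `y ⊗ (x ⊗ m) ↦ x ⊗ (y ⊗ m)` on regular representations. -/
def regularSwap (M : FDMod k B) : regular k (Cop H₂) ⊙ₗ regular k H₁ ⊙ₗ M ⟶
    regular k H₁ ⊙ₗ regular k (Cop H₂) ⊙ₗ M :=
  actionSwap (regular k H₁) (regular k H₂) M

omit [FiniteDimensional k B] in
theorem lin_regularSwap (M : FDMod k B) : lin (regularSwap k H₁ H₂ M) =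
    (TensorProduct.leftComm k (Cop H₂) H₁ M.carrier).toLinearMap :=
  lin_actionSwap (regular k H₁) (regular k H₂) M

theorem coactHom_comm : coactHom k H₁ B ≫ regular k H₁ ⊴ₗ coactHom k (Cop H₂) B =
    coactHom k (Cop H₂) B ≫ regular k (Cop H₂) ⊴ₗ coactHom k H₁ B ≫
      regularSwap k H₁ H₂ (regular k B) := by
  refine hom_ext (LinearMap.ext fun (b : B) => ?_)
  refine (coact_copCoact_comm (k := k) (H₁ := H₁) (H₂ := H₂) b).trans ?_
  exact (LinearMap.congr_fun (lin_regularSwap (H₂ := H₂) (regular k B)) _).symm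

/-- Naturality collects the two coactions of B inside F, where they commute; what is left is the
commutation of the δ's, needed only at the regular modules. -/
theorem coactMap_comm (F : FDMod k B ⥤ FDMod k B) [F.LeftLinear (FDMod k H₁)]
    [F.LeftLinear (FDMod k (Cop H₂))]
    (h : F.map (regularSwap k H₁ H₂ (regular k B)) ≫
      δₗ F (regular k H₁) (regular k (Cop H₂) ⊙ₗ regular k B) ≫
        regular k H₁ ⊴ₗ δₗ F (regular k (Cop H₂)) (regular k B) =
      δₗ F (regular k (Cop H₂)) (regular k H₁ ⊙ₗ regular k B) ≫
        regular k (Cop H₂) ⊴ₗ δₗ F (regular k H₁) (regular k B) ≫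
          regularSwap k H₁ H₂ (F.obj (regular k B))) :
    coactMap (H := H₁) F ≫ regular k H₁ ⊴ₗ coactMap (H := Cop H₂) F =
      coactMap (H := Cop H₂) F ≫ regular k (Cop H₂) ⊴ₗ coactMap (H := H₁) F ≫
        regularSwap k H₁ H₂ (F.obj (regular k B)) := by
  simp only [coactMap, Category.assoc, MonoidalLeftAction.actionHomRight_comp]
  rw [← δₗ_naturality_right_assoc, ← F.map_comp_assoc, coactHom_comm, ← δₗ_naturality_right_assoc,
    F.map_comp_assoc, F.map_comp_assoc, h]

end HopfWall

/-! ### Bimodule functors: the bimodule F(B) and full faithfulness -/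

namespace HopfWall

open scoped MonoidalLeftAction MonoidalRightAction
open FDMod Functor.LaxLeftLinear Functor.OplaxLeftLinear Functor.LaxRightLinear
  Functor.OplaxRightLinear

variable {k : Type u} [Field k]

theorem pairCoact_comp {H C Y Z : Type u} [Ring H] [Bialgebra k H] [Ring C] [Bialgebra k C]
    [AddCommGroup Y] [Module k Y] [AddCommGroup Z] [Module k Z] {τ : Y →ₗ[k] H ⊗[k] Y}
    {ρ : Y →ₗ[k] C ⊗[k] Y} {τ' : Z →ₗ[k] H ⊗[k] Z} {ρ' : Z →ₗ[k] C ⊗[k] Z} {f : Y →ₗ[k] Z}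
    (hτ : f.lTensor H ∘ₗ τ = τ' ∘ₗ f) (hρ : f.lTensor C ∘ₗ ρ = ρ' ∘ₗ f) :
    f.lTensor (H ⊗[k] C) ∘ₗ pairCoact τ ρ = pairCoact τ' ρ' ∘ₗ f := by
  have h1 : f.lTensor (H ⊗[k] C) ∘ₗ (TensorProduct.assoc k H C Y).symm.toLinearMap =
      (TensorProduct.assoc k H C Z).symm.toLinearMap ∘ₗ (f.lTensor C).lTensor H :=
    TensorProduct.ext_threefold' fun _ _ _ => rfl
  rw [pairCoact, pairCoact, LinearMap.comp_assoc, LinearMap.comp_assoc, ← hτ,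
    ← LinearMap.comp_assoc, h1, LinearMap.comp_assoc, ← LinearMap.comp_assoc τ,
    ← LinearMap.lTensor_comp, hρ, LinearMap.lTensor_comp, LinearMap.comp_assoc]

variable {H₁ H₂ B : Type u} [Ring H₁] [Bialgebra k H₁] [Ring H₂] [Bialgebra k H₂] [Ring B]
  [Algebra k B] [LeftComoduleAlgebra k H₁ B] [RightComoduleAlgebra k H₂ B]
  [BicomoduleAlgebra k H₁ H₂ B]

namespace BimoduleFunctor

/-- Makes the results on left linear functors applicable to both structures of a bimodule functor.
-/
instance (F : BimoduleFunctor k H₁ H₂ B) : F.functor.LeftLinear (FDMod k (Cop H₂)) :=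
  leftLinearOfRightLinear H₂ F.functor

theorem map_copSwap_comp_δₗ (F : BimoduleFunctor k H₁ H₂ B) (M : FDMod k B) (Y : FDMod k H₂) :
    F.functor.map (copSwap M Y).hom ≫ δₗ F.functor (toCopMod Y) M =
      δᵣ F.functor M Y ≫ (copSwap (F.functor.obj M) Y).hom :=
  map_copSwap_comp_copδₗ F.functor Y M

variable [FiniteDimensional k H₁] [FiniteDimensional k H₂] [FiniteDimensional k B]

/-- The covariant bimodule `F(B)` given by a bimodule functor `F`. -/
abbrev covariantBimodule (F : BimoduleFunctor k H₁ H₂ B) :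
    CovariantBimodule k (H₁ ⊗[k] Cop H₂) B :=
  (HopfWall.covariantBimodule H₁ F.functor).pair
    (HopfWall.covariantBimodule (Cop H₂) F.functor).coact
    (HopfWall.covariantBimodule (Cop H₂) F.functor).coassoc
    (HopfWall.covariantBimodule (Cop H₂) F.functor).counit_coact
    (HopfWall.covariantBimodule (Cop H₂) F.functor).coact_left
    (HopfWall.covariantBimodule (Cop H₂) F.functor).coact_right fun y => by
      have h := coactMap_comm F.functor ((compatible_iff F.functor F.map_copSwap_comp_δₗ
        (regular k H₁) (regular k B) (regular k H₂)).1 (F.compatible _ _ _))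
      refine (LinearMap.congr_fun (congrArg lin h) y).trans ?_
      exact LinearMap.congr_fun (lin_regularSwap (F.functor.obj (regular k B))) _

variable (k H₁ H₂ B) in
/-- The functor that sends a bimodule functor `F` to the covariant bimodule `F(B)`. -/
def toCovariant : BimoduleFunctor k H₁ H₂ B ⥤ CovariantBimodule k (H₁ ⊗[k] Cop H₂) B where
  obj F := F.covariantBimodule
  map {F G} α := ⟨lin (α.1.app (regular k B)), fun a => lin_comm _ a,
    fun a => (congrArg lin (α.1.naturality (rightMul k B a)).symm).symm,
    pairCoact_comp
      (congrArg lin (comp_coactMap (H := H₁) F.functor G.functor α.1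
        fun X M => (comp_δₗ_iff α.1 X M).1 (α.2.1 X M))).symm
      (congrArg lin (comp_coactMap (H := Cop H₂) F.functor G.functor α.1
        fun X M => (comp_μᵣ_iff F.map_copSwap_comp_δₗ G.map_copSwap_comp_δₗ α.1 M
          (ofCopMod X)).1 (α.2.2 M (ofCopMod X)))).symm⟩

instance : (toCovariant k H₁ H₂ B).Additive where

instance : (toCovariant k H₁ H₂ B).Linear k where

instance : (toCovariant k H₁ H₂ B).Faithful where
  map_injective {F G α β} h :=
    have h' : lin (α.1.app (regular k B)) = lin (β.1.app (regular k B)) :=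
      congrArg (fun f : (toCovariant k H₁ H₂ B).obj F ⟶ (toCovariant k H₁ H₂ B).obj G => f.1) h
    Subtype.ext (natTrans_ext_of_rightExact F.rightExact (hom_ext h'))

theorem projLeft_covariantBimodule_coact (F : BimoduleFunctor k H₁ H₂ B)
    (y : F.covariantBimodule.carrier) :
    (projLeft k H₁ (Cop H₂)).toLinearMap.rTensor _ (F.covariantBimodule.coact y) =
      lin (coactMap (H := H₁) F.functor) y :=
  projLeft_pairCoact _ _ (HopfWall.covariantBimodule (Cop H₂) F.functor).counit_coact y

theorem projRight_covariantBimodule_coact (F : BimoduleFunctor k H₁ H₂ B)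
    (y : F.covariantBimodule.carrier) :
    (projRight k H₁ (Cop H₂)).toLinearMap.rTensor _ (F.covariantBimodule.coact y) =
      lin (coactMap (H := Cop H₂) F.functor) y :=
  projRight_pairCoact _ _ (HopfWall.covariantBimodule H₁ F.functor).counit_coact y

theorem rTensor_coact_comp {K H : Type u} [Ring K] [Bialgebra k K] [AddCommGroup H] [Module k H]
    {Y Z : Type u} [AddCommGroup Y] [Module k Y] [AddCommGroup Z] [Module k Z]
    {ρ : Y →ₗ[k] K ⊗[k] Y} {ρ' : Z →ₗ[k] K ⊗[k] Z} {f : Y →ₗ[k] Z}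
    (h : f.lTensor K ∘ₗ ρ = ρ' ∘ₗ f) (φ : K →ₗ[k] H) (y : Y) :
    φ.rTensor Z (ρ' (f y)) = f.lTensor H (φ.rTensor Y (ρ y)) := by
  have h' : φ.rTensor Z ∘ₗ f.lTensor K = f.lTensor H ∘ₗ φ.rTensor Y := by
    rw [LinearMap.rTensor_comp_lTensor, LinearMap.lTensor_comp_rTensor]
  rw [← LinearMap.comp_apply ρ', ← h]
  exact LinearMap.congr_fun h' (ρ y)

/-- A map compatible with the coaction of H₁ ⊗ H₂^cop respects each component, because the
projections recover the components. -/
theorem coactMap_left_apply {F G : BimoduleFunctor k H₁ H₂ B}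
    (f : F.covariantBimodule ⟶ G.covariantBimodule) (y : F.covariantBimodule.carrier) :
    lin (coactMap (H := H₁) G.functor) (f.1 y) =
      f.1.lTensor H₁ (lin (coactMap (H := H₁) F.functor) y) :=
  (G.projLeft_covariantBimodule_coact (f.1 y)).symm.trans <|
    (rTensor_coact_comp f.2.2.2 _ y).trans <|
      congrArg (f.1.lTensor H₁) (F.projLeft_covariantBimodule_coact y)

theorem coactMap_right_apply {F G : BimoduleFunctor k H₁ H₂ B}
    (f : F.covariantBimodule ⟶ G.covariantBimodule) (y : F.covariantBimodule.carrier) :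
    lin (coactMap (H := Cop H₂) G.functor) (f.1 y) =
      f.1.lTensor (Cop H₂) (lin (coactMap (H := Cop H₂) F.functor) y) :=
  (G.projRight_covariantBimodule_coact (f.1 y)).symm.trans <|
    (rTensor_coact_comp f.2.2.2 _ y).trans <|
      congrArg (f.1.lTensor (Cop H₂)) (F.projRight_covariantBimodule_coact y)

theorem exists_natTrans_of_covariantBimodule {F G : BimoduleFunctor k H₁ H₂ B}
    (f : F.covariantBimodule ⟶ G.covariantBimodule) :
    ∃ α : F.functor ⟶ G.functor, lin (α.app (regular k B)) = f.1 := by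
  obtain ⟨α, hα⟩ := exists_natTrans F.rightExact (G := G.functor)
    (mkHom (X := F.functor.obj (regular k B)) (Y := G.functor.obj (regular k B)) f.1 f.2.1) f.2.2.1
  exact ⟨α, congrArg lin hα⟩

/-- The transformation comes from the two actions alone. The H₁-component of the coaction makes it
commute with the left structures, the H₂^cop-component with the right ones. -/
instance : (toCovariant k H₁ H₂ B).Full where
  map_surjective {F G} f := by
    obtain ⟨α, hα⟩ := exists_natTrans_of_covariantBimodule f
    have h₁ : α.app (regular k B) ≫ coactMap (H := H₁) G.functor =
        coactMap F.functor ≫ regular k H₁ ⊴ₗ α.app (regular k B) := by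
      refine hom_ext (LinearMap.ext fun y => ?_)
      have h := coactMap_left_apply f y
      rw [← hα] at h
      exact h
    have h₂ : α.app (regular k B) ≫ coactMap (H := Cop H₂) G.functor =
        coactMap F.functor ≫ regular k (Cop H₂) ⊴ₗ α.app (regular k B) := by
      refine hom_ext (LinearMap.ext fun y => ?_)
      have h := coactMap_right_apply f y
      rw [← hα] at h
      exact h
    exact ⟨⟨α, fun X M => (comp_δₗ_iff α X M).2 (comp_δₗ_of_comp_coactMap F.rightExact α h₁ X M),
      fun M Y => (comp_μᵣ_iff F.map_copSwap_comp_δₗ G.map_copSwap_comp_δₗ α M Y).2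
        (comp_δₗ_of_comp_coactMap F.rightExact α h₂ (toCopMod Y) M)⟩, Subtype.ext hα⟩

end BimoduleFunctor

end HopfWall

/-! ### Bimodule functors from covariant bimodules -/

namespace HopfWall

open scoped MonoidalLeftAction MonoidalRightAction
open FDMod Functor.LaxLeftLinear Functor.OplaxLeftLinear Functor.LaxRightLinear
  Functor.OplaxRightLinear

variable {k : Type u} [Field k]

namespace BimoduleFunctor

variable {H₁ H₂ B : Type u} [Ring H₁] [Bialgebra k H₁] [Ring H₂] [Bialgebra k H₂] [Ring B]
  [Algebra k B] [LeftComoduleAlgebra k H₁ B] [RightComoduleAlgebra k H₂ B]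
  [BicomoduleAlgebra k H₁ H₂ B]

theorem δᵣ_rightLinearOfLeftLinear (F : FDMod k B ⥤ FDMod k B) [F.LeftLinear (FDMod k (Cop H₂))]
    (M : FDMod k B) (X : FDMod k H₂) :
    letI := rightLinearOfLeftLinear H₂ F
    δᵣ F M X = copδᵣ F M X := rfl

theorem map_copSwap_comp_δₗ_of_leftLinear (F : FDMod k B ⥤ FDMod k B) [F.LeftLinear (FDMod k (Cop H₂))]
    (M : FDMod k B) (X : FDMod k H₂) :
    letI := rightLinearOfLeftLinear H₂ F
    F.map (copSwap M X).hom ≫ δₗ F (toCopMod X) M = δᵣ F M X ≫ (copSwap (F.obj M) X).hom := by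
  rw [δᵣ_rightLinearOfLeftLinear, copδᵣ_comp_copSwap]

/-- A functor with commuting left `Rep(H₁)`-linear and `Rep(H₂^cop)`-linear structures is a bimodule
functor. -/
def ofLeftLinear (F : FDMod k B ⥤ FDMod k B) [F.Additive] [F.Linear k]
    (hF : RightExact F) [F.LeftLinear (FDMod k H₁)] [F.LeftLinear (FDMod k (Cop H₂))]
    (h : ∀ (X : FDMod k H₁) (M : FDMod k B) (Y : FDMod k H₂),
      F.map (actionSwap X Y M) ≫ δₗ F X (toCopMod Y ⊙ₗ M) ≫ X ⊴ₗ δₗ F (toCopMod Y) M =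
        δₗ F (toCopMod Y) (X ⊙ₗ M) ≫ toCopMod Y ⊴ₗ δₗ F X M ≫ actionSwap X Y (F.obj M)) :
    BimoduleFunctor k H₁ H₂ B :=
  letI := rightLinearOfLeftLinear H₂ F
  { functor := F
    rightExact := hF
    compatible := fun X M Z => (compatible_iff F (fun M X => map_copSwap_comp_δₗ_of_leftLinear F M X)
      X M Z).2 (h X M Z) }

/-- The left structure over H₂^cop was turned into a right structure and back. Both left structures
satisfy the same relation to δᵣ through an invertible swap, so the round trip changes nothing. -/
theorem coactMap_ofLeftLinear [FiniteDimensional k H₂] [FiniteDimensional k B]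
    (F : FDMod k B ⥤ FDMod k B) [F.Additive] [F.Linear k]
    (hF : RightExact F) [F.LeftLinear (FDMod k H₁)] [F.LeftLinear (FDMod k (Cop H₂))]
    (h : ∀ (X : FDMod k H₁) (M : FDMod k B) (Y : FDMod k H₂),
      F.map (actionSwap X Y M) ≫ δₗ F X (toCopMod Y ⊙ₗ M) ≫ X ⊴ₗ δₗ F (toCopMod Y) M =
        δₗ F (toCopMod Y) (X ⊙ₗ M) ≫ toCopMod Y ⊴ₗ δₗ F X M ≫ actionSwap X Y (F.obj M)) :
    coactMap (H := Cop H₂) (ofLeftLinear F hF h).functor = coactMap (H := Cop H₂) F := by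
  refine congrArg (F.map (coactHom k (Cop H₂) B) ≫ ·) ?_
  let _ := rightLinearOfLeftLinear H₂ F
  have h1 : F.map (copSwap (regular k B) (regular k H₂)).hom ≫
      copδₗ F (toCopMod (regular k H₂)) (regular k B) = _ :=
    (map_copSwap_comp_copδₗ F (regular k H₂) (regular k B)).trans
      (map_copSwap_comp_δₗ_of_leftLinear F (regular k B) (regular k H₂)).symm
  exact ((cancel_epi (F.map (copSwap (regular k B) (regular k H₂)).hom)).1 h1 :
    copδₗ F (toCopMod (regular k H₂)) (regular k B) = δₗ F (toCopMod (regular k H₂)) (regular k B))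

end BimoduleFunctor

namespace CovariantBimodule

theorem bijective_of_iso {H A : Type u} [Ring H] [Bialgebra k H] [Ring A] [Algebra k A]
    [LeftComoduleAlgebra k H A] {Y Z : CovariantBimodule k H A} (e : Y ≅ Z) :
    Function.Bijective e.hom.1 :=
  Function.bijective_iff_has_inverse.2 ⟨e.inv.1,
    fun y => LinearMap.congr_fun (congrArg (fun f : Y ⟶ Y => f.1) e.hom_inv_id) y,
    fun z => LinearMap.congr_fun (congrArg (fun f : Z ⟶ Z => f.1) e.inv_hom_id) z⟩

theorem lTensor_deltaLin_proj_tmul {H A W : Type u} [Ring H] [Bialgebra k H] [Ring A] [Algebra k A]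
    [LeftComoduleAlgebra k H A] [AddCommGroup W] [Module k W] (Y : CovariantBimodule k H A)
    (X : FDMod k H) (M : FDMod k A) (g : Y.Balanced M →ₗ[k] W) (y : Y.carrier) (x : X.carrier)
    (m : M.carrier) :
    g.lTensor X.carrier (Y.deltaLin X M (Y.proj (X ⊙ₗ M) (y ⊗ₜ[k] (x ⊗ₜ[k] m)))) =
      TensorProduct.map (X.act.toLinearMap.flip x)
        (g ∘ₗ Y.proj M ∘ₗ (TensorProduct.mk k Y.carrier M.carrier).flip m) (Y.coact y) := by
  rw [deltaLin_proj_tmul, ← LinearMap.comp_apply, LinearMap.lTensor_comp_map]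

theorem map_map_coact_comm {H C Y V W U : Type u} [AddCommGroup H] [Module k H] [AddCommGroup C]
    [Module k C] [AddCommGroup Y] [Module k Y] [AddCommGroup V] [Module k V] [AddCommGroup W]
    [Module k W] [AddCommGroup U] [Module k U] {τ : Y →ₗ[k] H ⊗[k] Y} {ρ : Y →ₗ[k] C ⊗[k] Y} {y : Y}
    (h : ρ.lTensor H (τ y) = TensorProduct.leftComm k C H Y (τ.lTensor C (ρ y)))
    (a : H →ₗ[k] V) (b : C →ₗ[k] W) (p : Y →ₗ[k] U) :
    TensorProduct.map a (TensorProduct.map b p ∘ₗ ρ) (τ y) =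
      TensorProduct.leftComm k W V U (TensorProduct.map b (TensorProduct.map a p ∘ₗ τ) (ρ y)) := by
  rw [← LinearMap.map_comp_lTensor, ← LinearMap.map_comp_lTensor, LinearMap.comp_apply,
    LinearMap.comp_apply, h]
  exact LinearMap.congr_fun (f := TensorProduct.map a (TensorProduct.map b p) ∘ₗ
    (TensorProduct.leftComm k C H Y).toLinearMap)
    (g := (TensorProduct.leftComm k W V U).toLinearMap ∘ₗ
      TensorProduct.map b (TensorProduct.map a p))
    (TensorProduct.ext_threefold' fun _ _ _ => rfl) _

variable {H₁ H₂ B : Type u} [Ring H₁] [Bialgebra k H₁] [Ring H₂] [Bialgebra k H₂] [Ring B]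
  [Algebra k B] [LeftComoduleAlgebra k H₁ B] [RightComoduleAlgebra k H₂ B]
  [BicomoduleAlgebra k H₁ H₂ B] (Y : CovariantBimodule k (H₁ ⊗[k] Cop H₂) B)

/-- On generators the two composites apply the two components of the coaction of Y in opposite
orders, and the components commute. -/
theorem deltaLin_fst_snd (X : FDMod k H₁) (X' : FDMod k (Cop H₂)) (M : FDMod k B)
    (y : Y.carrier) (x : X.carrier) (x' : X'.carrier) (m : M.carrier) :
    (Y.snd.deltaLin X' M).lTensor X.carrier (Y.fst.deltaLin X (X' ⊙ₗ M)
      (Y.fst.proj (X ⊙ₗ X' ⊙ₗ M) (y ⊗ₜ[k] (x ⊗ₜ[k] (x' ⊗ₜ[k] m))))) =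
    TensorProduct.leftComm k X'.carrier X.carrier _ ((Y.fst.deltaLin X M).lTensor X'.carrier
      (Y.snd.deltaLin X' (X ⊙ₗ M)
        (Y.snd.proj (X' ⊙ₗ X ⊙ₗ M) (y ⊗ₜ[k] (x' ⊗ₜ[k] (x ⊗ₜ[k] m)))))) := by
  let p : Y.carrier →ₗ[k] Y.Balanced M :=
    Y.proj M ∘ₗ (TensorProduct.mk k Y.carrier M.carrier).flip m
  let a := X.act.toLinearMap.flip x
  let a' := X'.act.toLinearMap.flip x'
  have h1 : Y.snd.deltaLin X' M ∘ₗ Y.snd.proj (X' ⊙ₗ M) ∘ₗ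
      (TensorProduct.mk k Y.carrier (X' ⊙ₗ M).carrier).flip (x' ⊗ₜ[k] m) =
      TensorProduct.map a' p ∘ₗ Y.snd.coact :=
    LinearMap.ext fun y => Y.snd.deltaLin_proj_tmul X' M y x' m
  have h2 : Y.fst.deltaLin X M ∘ₗ Y.fst.proj (X ⊙ₗ M) ∘ₗ
      (TensorProduct.mk k Y.carrier (X ⊙ₗ M).carrier).flip (x ⊗ₜ[k] m) =
      TensorProduct.map a p ∘ₗ Y.fst.coact :=
    LinearMap.ext fun y => Y.fst.deltaLin_proj_tmul X M y x m
  refine (Y.fst.lTensor_deltaLin_proj_tmul X (X' ⊙ₗ M) (Y.snd.deltaLin X' M) y x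
    (x' ⊗ₜ[k] m)).trans (Eq.trans ?_ (congrArg (TensorProduct.leftComm k X'.carrier X.carrier _)
    (Y.snd.lTensor_deltaLin_proj_tmul X' (X ⊙ₗ M) (Y.fst.deltaLin X M) y x'
      (x ⊗ₜ[k] m))).symm)
  refine (congrArg (fun g => TensorProduct.map a g (Y.fst.coact y)) h1).trans (Eq.trans ?_
    (congrArg (fun g => TensorProduct.leftComm k X'.carrier X.carrier _
      (TensorProduct.map a' g (Y.snd.coact y))) h2).symm)
  exact map_map_coact_comm (Y.fst_snd_comm y) a a' p

/-- `Y.fst` and `Y.snd` share one underlying bimodule, so their tensor functors agree by definition;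
the type ascription lets the δ's of both be composed. This is the commutation that
`BimoduleFunctor.ofLeftLinear` asks for. -/
theorem tensorFunctor_map_actionSwap (X : FDMod k H₁) (Z : FDMod k H₂) (M : FDMod k B) :
    (show Y.fst.tensorObj (toCopMod Z ⊙ₗ X ⊙ₗ M) ⟶ X ⊙ₗ toCopMod Z ⊙ₗ Y.fst.tensorObj M from
    Y.fst.tensorFunctor.map (actionSwap X Z M) ≫
      δₗ Y.fst.tensorFunctor X (toCopMod Z ⊙ₗ M) ≫
        X ⊴ₗ δₗ Y.snd.tensorFunctor (toCopMod Z) M) =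
      δₗ Y.snd.tensorFunctor (toCopMod Z) (X ⊙ₗ M) ≫
        toCopMod Z ⊴ₗ δₗ Y.fst.tensorFunctor X M ≫
          actionSwap X Z (Y.fst.tensorObj M) := by
  refine hom_ext (X := Y.fst.tensorObj (toCopMod Z ⊙ₗ X ⊙ₗ M))
    (Submodule.linearMap_qext _ (TensorProduct.ext (LinearMap.ext fun y =>
      TensorProduct.ext_threefold' fun z x m => ?_)))
  exact (Y.deltaLin_fst_snd X (toCopMod Z) M y x z m).trans
    (LinearMap.congr_fun (lin_actionSwap X Z (Y.fst.tensorObj M)) _).symm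

variable [FiniteDimensional k B] {T₁ : H₁ →ₗ[k] H₁} (hT₁ : IsSkewAntipode T₁)
  {T₂ : Cop H₂ →ₗ[k] Cop H₂} (hT₂ : IsSkewAntipode T₂)

/-- The bimodule functor `Y ⊗_B -`. -/
def tensorBimoduleFunctor : BimoduleFunctor k H₁ H₂ B :=
  letI : Y.fst.tensorFunctor.LeftLinear (FDMod k H₁) := (Y.fst.tensorModuleFunctor hT₁).leftLinear
  letI : Y.fst.tensorFunctor.LeftLinear (FDMod k (Cop H₂)) :=
    (Y.snd.tensorModuleFunctor hT₂).leftLinear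
  BimoduleFunctor.ofLeftLinear Y.fst.tensorFunctor Y.fst.rightExact_tensorFunctor
    fun X M Z => Y.tensorFunctor_map_actionSwap X Z M

theorem coactMap_snd_tensorBimoduleFunctor [FiniteDimensional k H₂] :
    lin (coactMap (H := Cop H₂) (Y.tensorBimoduleFunctor hT₁ hT₂).functor) =
      (covariantBimodule (Cop H₂) (Y.snd.tensorModuleFunctor hT₂).functor).coact :=
  letI : Y.fst.tensorFunctor.LeftLinear (FDMod k H₁) := (Y.fst.tensorModuleFunctor hT₁).leftLinear
  letI : Y.fst.tensorFunctor.LeftLinear (FDMod k (Cop H₂)) :=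
    (Y.snd.tensorModuleFunctor hT₂).leftLinear
  congrArg lin (BimoduleFunctor.coactMap_ofLeftLinear Y.fst.tensorFunctor
    Y.fst.rightExact_tensorFunctor fun X M Z => Y.tensorFunctor_map_actionSwap X Z M)

variable [FiniteDimensional k H₁] [FiniteDimensional k H₂]

/-- The isomorphism `Y ≅ Y ⊗_B B`. -/
def isoCovariantBimodule :
    Y ≅ (Y.tensorBimoduleFunctor hT₁ hT₂).covariantBimodule :=
  isoOfBijective (Z := (Y.tensorBimoduleFunctor hT₁ hT₂).covariantBimodule)
    ⟨(Y.fst.isoTensorRegular hT₁).hom.1, (Y.fst.isoTensorRegular hT₁).hom.2.1,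
      (Y.fst.isoTensorRegular hT₁).hom.2.2.1, by
      have h₁ : (Y.fst.isoTensorRegular hT₁).hom.1.lTensor H₁ ∘ₗ Y.fst.coact =
          lin (coactMap (H := H₁) (Y.tensorBimoduleFunctor hT₁ hT₂).functor) ∘ₗ
            (Y.fst.isoTensorRegular hT₁).hom.1 :=
        (Y.fst.isoTensorRegular hT₁).hom.2.2.2
      -- The map y ↦ y ⊗ 1 is the same for both components, so the isomorphism for `Y.snd` applies
      -- to it.
      have h₂ : (Y.fst.isoTensorRegular hT₁).hom.1.lTensor (Cop H₂) ∘ₗ Y.snd.coact =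
          lin (coactMap (H := Cop H₂) (Y.tensorBimoduleFunctor hT₁ hT₂).functor) ∘ₗ
            (Y.fst.isoTensorRegular hT₁).hom.1 := by
        rw [coactMap_snd_tensorBimoduleFunctor]
        exact (Y.snd.isoTensorRegular hT₂).hom.2.2.2
      have h := pairCoact_comp h₁ h₂
      have h' : pairCoact Y.fst.coact Y.snd.coact = Y.coact := LinearMap.ext Y.pairCoact_fst_snd
      rw [h'] at h
      exact h⟩
    (bijective_of_iso (Y.fst.isoTensorRegular hT₁))

end CovariantBimodule

end HopfWall

/-! ### Comparison of underlying functors, and the semisimple case -/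

namespace HopfWall

open FDMod

namespace FDMod

variable {k : Type u} [Field k] {A C : Type u} [Ring A] [Algebra k A] [Ring C] [Algebra k C]
  [FiniteDimensional k A]

/-- Eilenberg–Watts in families: for each d the isomorphism at the regular module and its inverse
extend to transformations, and uniqueness of extensions supplies both the inverse identities and
naturality in d. -/
theorem nonempty_natIso_of_rightExact {D : Type*} [Category D] (U V : D ⥤ FDMod k A ⥤ FDMod k C)
    [∀ d, (U.obj d).Additive] [∀ d, (U.obj d).Linear k] [∀ d, (V.obj d).Additive]
    [∀ d, (V.obj d).Linear k] (hU : ∀ d, RightExact (U.obj d)) (hV : ∀ d, RightExact (V.obj d))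
    (e : U ⋙ (evaluation _ _).obj (regular k A) ≅ V ⋙ (evaluation _ _).obj (regular k A))
    (he : ∀ d a, lin (e.hom.app d) ∘ₗ rightAct (U.obj d) a =
      rightAct (V.obj d) a ∘ₗ lin (e.hom.app d)) : Nonempty (U ≅ V) := by
  have he' (d : D) (a : A) : lin (e.inv.app d) ∘ₗ rightAct (V.obj d) a =
      rightAct (U.obj d) a ∘ₗ lin (e.inv.app d) := by
    have h1 : lin (e.inv.app d) ∘ₗ lin (e.hom.app d) = .id :=
      congrArg lin (e.hom_inv_id_app d)
    have h2 : lin (e.hom.app d) ∘ₗ lin (e.inv.app d) = .id :=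
      congrArg lin (e.inv_hom_id_app d)
    calc lin (e.inv.app d) ∘ₗ rightAct (V.obj d) a
        = lin (e.inv.app d) ∘ₗ (rightAct (V.obj d) a ∘ₗ lin (e.hom.app d)) ∘ₗ
            lin (e.inv.app d) := by rw [LinearMap.comp_assoc, h2, LinearMap.comp_id]
      _ = (lin (e.inv.app d) ∘ₗ lin (e.hom.app d)) ∘ₗ rightAct (U.obj d) a ∘ₗ
            lin (e.inv.app d) := by rw [← he]; rfl
      _ = rightAct (U.obj d) a ∘ₗ lin (e.inv.app d) := by rw [h1, LinearMap.id_comp]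
  choose α hα using fun d => exists_natTrans (hU d) (e.hom.app d) (he d)
  choose β hβ using fun d => exists_natTrans (hV d) (e.inv.app d) (he' d)
  refine ⟨NatIso.ofComponents (fun d => ⟨α d, β d, natTrans_ext_of_rightExact (hU d) ?_,
    natTrans_ext_of_rightExact (hV d) ?_⟩) fun {c d} f => natTrans_ext_of_rightExact (hU c) ?_⟩
  · rw [NatTrans.comp_app, hα, hβ]
    exact e.hom_inv_id_app d
  · rw [NatTrans.comp_app, hα, hβ]
    exact e.inv_hom_id_app d
  · change (U.map f).app _ ≫ (α d).app _ = (α c).app _ ≫ (V.map f).app _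
    rw [hα, hα]
    exact e.hom.naturality f

end FDMod

/-- Over a semisimple ring the sequence splits: there are s with s ≫ g = 1 and r with r ≫ f = 1 - g
≫ s. With f ≫ g = 0, these equations survive any additive functor and imply exactness. -/
theorem FDMod.rightExact_of_isSemisimpleRing {k : Type u} [Field k] {A C : Type u} [Ring A]
    [Algebra k A] [Ring C] [Algebra k C] [IsSemisimpleRing A] (F : FDMod k A ⥤ FDMod k C)
    [F.Additive] : RightExact F := by
  intro X Y Z f g hfg hg
  let _ (X : FDMod k A) : Module A X.carrier := Module.compHom X.carrier X.act.toRingHom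
  let toA {X Y : FDMod k A} (f : X ⟶ Y) : X.carrier →ₗ[A] Y.carrier :=
    { toFun := lin f
      map_add' := map_add (lin f)
      map_smul' := lin_act f }
  have (X : FDMod k A) : IsScalarTower k A X.carrier := ⟨fun c a x => by
    change X.act (c • a) x = c • X.act a x
    rw [map_smul]; rfl⟩
  let ofA {X Y : FDMod k A} (f : X.carrier →ₗ[A] Y.carrier) : X ⟶ Y :=
    mkHom (f.restrictScalars k) fun a => LinearMap.ext fun x => f.map_smul a x
  have hproj (P : FDMod k A) : Module.Projective A P.carrier :=
    Module.projective_of_isSemisimpleRing A P.carrier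
  -- Projectivity is used against g corestricted to its range, so the statement also applies to f,
  -- which need not be surjective.
  have hlift {P X Y : FDMod k A} (g : X ⟶ Y) (h : P ⟶ Y)
      (hgh : ∀ p, ∃ x, lin g x = lin h p) : ∃ s : P ⟶ X, s ≫ g = h := by
    let g' : X.carrier →ₗ[A] LinearMap.range (toA g) := (toA g).rangeRestrict
    let h' : P.carrier →ₗ[A] LinearMap.range (toA g) := (toA h).codRestrict _ hgh
    obtain ⟨s, hs⟩ := Module.projective_lifting_property g' h' (toA g).surjective_rangeRestrict
    exact ⟨ofA s, hom_ext (LinearMap.ext fun p =>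
      congrArg Subtype.val (LinearMap.congr_fun hs p))⟩
  obtain ⟨s, hs⟩ := hlift g (𝟙 Z) fun z => hg z
  -- 1 - g ≫ s takes values in the kernel of g, which is the range of f.
  obtain ⟨r, hr⟩ := hlift f (𝟙 Y - g ≫ s) fun y => (hfg _).1 <| by
    have h1 : (𝟙 Y - g ≫ s) ≫ g = 0 := by
      rw [Preadditive.sub_comp, Category.assoc, hs, Category.id_comp, Category.comp_id, sub_self]
    exact LinearMap.congr_fun (congrArg lin h1) y
  have hs' : F.map s ≫ F.map g = 𝟙 _ := by rw [← F.map_comp, hs, F.map_id]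
  have hr' : F.map r ≫ F.map f = 𝟙 _ - F.map g ≫ F.map s := by
    rw [← F.map_comp, hr, F.map_sub, F.map_id, F.map_comp]
  have hfg' : F.map f ≫ F.map g = 0 := by
    have h : f ≫ g = 0 := hom_ext (LinearMap.ext fun x => hfg.apply_apply_eq_zero x)
    rw [← F.map_comp, h, F.map_zero]
  refine ⟨fun y => ⟨fun hy => ⟨lin (F.map r) y, ?_⟩, ?_⟩, fun z => ⟨lin (F.map s) z, ?_⟩⟩
  · rw [← lin_comp_apply, hr', lin_sub, LinearMap.sub_apply, lin_comp_apply, hy, map_zero, sub_zero]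
    rfl
  · rintro ⟨x, rfl⟩
    exact LinearMap.congr_fun (congrArg lin hfg') x
  · exact LinearMap.congr_fun (congrArg lin hs') z

namespace BimoduleFunctor

variable {k : Type u} [Field k] {H₁ H₂ B : Type u} [Ring H₁] [Bialgebra k H₁] [Ring H₂]
  [Bialgebra k H₂] [Ring B] [Algebra k B] [LeftComoduleAlgebra k H₁ B]
  [RightComoduleAlgebra k H₂ B] [BicomoduleAlgebra k H₁ H₂ B] [FiniteDimensional k H₁]
  [FiniteDimensional k H₂] [FiniteDimensional k B] {T₁ : H₁ →ₗ[k] H₁} (hT₁ : IsSkewAntipode T₁)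
  {T₂ : Cop H₂ →ₗ[k] Cop H₂} (hT₂ : IsSkewAntipode T₂)

include hT₁ hT₂

theorem isEquivalence_toCovariant : (toCovariant k H₁ H₂ B).IsEquivalence :=
  have : (toCovariant k H₁ H₂ B).EssSurj :=
    ⟨fun Y => ⟨Y.tensorBimoduleFunctor hT₁ hT₂, ⟨(Y.isoCovariantBimodule hT₁ hT₂).symm⟩⟩⟩
  { }

/-- The equivalence is F ↦ F(B) followed by an inverse of the equivalence for module functors. A
bimodule functor and its image therefore have naturally isomorphic bimodules at B, and these
determine the underlying functors. -/
theorem exists_equivalence {T : H₁ ⊗[k] Cop H₂ →ₗ[k] H₁ ⊗[k] Cop H₂} (hT : IsSkewAntipode T) :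
    ∃ (E : BimoduleFunctor k H₁ H₂ B ≌ ModuleFunctor k (H₁ ⊗[k] Cop H₂) B)
      (_ : E.functor.Additive) (_ : E.functor.Linear k),
      Nonempty (E.functor ⋙ ModuleFunctor.forget k (H₁ ⊗[k] Cop H₂) B ≅ forget k H₁ H₂ B) := by
  have := isEquivalence_toCovariant (B := B) hT₁ hT₂
  have := ModuleFunctor.isEquivalence_toCovariant (A := B) hT
  let E₁ := (toCovariant k H₁ H₂ B).asEquivalence
  let E₂ := (ModuleFunctor.toCovariant k (H₁ ⊗[k] Cop H₂) B).asEquivalence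
  have : E₁.functor.Additive := inferInstanceAs (toCovariant k H₁ H₂ B).Additive
  have : E₁.functor.Linear k := inferInstanceAs ((toCovariant k H₁ H₂ B).Linear k)
  have : E₂.functor.Additive :=
    inferInstanceAs (ModuleFunctor.toCovariant k (H₁ ⊗[k] Cop H₂) B).Additive
  have : E₂.functor.Linear k :=
    inferInstanceAs ((ModuleFunctor.toCovariant k (H₁ ⊗[k] Cop H₂) B).Linear k)
  refine ⟨E₁.trans E₂.symm, inferInstanceAs (E₁.functor ⋙ E₂.inverse).Additive,
    inferInstanceAs ((E₁.functor ⋙ E₂.inverse).Linear k), ?_⟩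
  let i : (E₁.functor ⋙ E₂.inverse) ⋙ ModuleFunctor.toCovariant k (H₁ ⊗[k] Cop H₂) B ≅
      toCovariant k H₁ H₂ B :=
    Functor.isoWhiskerLeft E₁.functor E₂.counitIso
  let U := (E₁.functor ⋙ E₂.inverse) ⋙ ModuleFunctor.forget k (H₁ ⊗[k] Cop H₂) B
  have (F : BimoduleFunctor k H₁ H₂ B) : (U.obj F).Additive := ((E₁.functor ⋙ E₂.inverse).obj F).additive
  have (F : BimoduleFunctor k H₁ H₂ B) : (U.obj F).Linear k := ((E₁.functor ⋙ E₂.inverse).obj F).linear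
  have (F : BimoduleFunctor k H₁ H₂ B) : ((forget k H₁ H₂ B).obj F).Additive := F.additive
  have (F : BimoduleFunctor k H₁ H₂ B) : ((forget k H₁ H₂ B).obj F).Linear k := F.linear
  exact nonempty_natIso_of_rightExact U (forget k H₁ H₂ B)
    (fun F => ((E₁.functor ⋙ E₂.inverse).obj F).rightExact) (fun F => F.rightExact)
    (Functor.isoWhiskerRight i (CovariantBimodule.toLeftModule k (H₁ ⊗[k] Cop H₂) B))
    fun F a => (i.hom.app F).2.2.1 a

end BimoduleFunctor

end HopfWall

end

theorem mainTheorem6 {k : Type u} [Field k] {H₁ H₂ B : Type u}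
    [Ring H₁] [HopfAlgebra k H₁] [FiniteDimensional k H₁]
    [Ring H₂] [HopfAlgebra k H₂] [FiniteDimensional k H₂]
    [Ring B] [Algebra k B] [FiniteDimensional k B]
    [HopfWall.LeftComoduleAlgebra k H₁ B] [HopfWall.RightComoduleAlgebra k H₂ B]
    [HopfWall.BicomoduleAlgebra k H₁ H₂ B] :
    (∃ (E : HopfWall.BimoduleFunctor k H₁ H₂ B ≌
          HopfWall.ModuleFunctor k (H₁ ⊗[k] HopfWall.Cop H₂) B)
        (_ : E.functor.Additive) (_ : E.functor.Linear k),
      Nonempty (E.functor ⋙ HopfWall.ModuleFunctor.forget k (H₁ ⊗[k] HopfWall.Cop H₂) B ≅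
        HopfWall.BimoduleFunctor.forget k H₁ H₂ B)) ∧
    (∃ (E : HopfWall.ModuleFunctor k (H₁ ⊗[k] HopfWall.Cop H₂) B ≌
          HopfWall.CovariantBimodule k (H₁ ⊗[k] HopfWall.Cop H₂) B)
        (_ : E.functor.Additive) (_ : E.functor.Linear k),
      Nonempty (E.functor ⋙
          HopfWall.CovariantBimodule.toLeftModule k (H₁ ⊗[k] HopfWall.Cop H₂) B ≅
        HopfWall.ModuleFunctor.forget k (H₁ ⊗[k] HopfWall.Cop H₂) B ⋙
          (evaluation _ _).obj (HopfWall.FDMod.regular k B))) ∧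
    (IsSemisimpleRing B → ∀ F : HopfWall.FDMod k B ⥤ HopfWall.FDMod k B,
      F.Additive → HopfWall.FDMod.RightExact F) := by
  -- For H₁ the skew antipode is the inverse of the antipode, whence finite dimension; for H₂^cop it
  -- is the antipode of H₂ itself.
  obtain ⟨T₁, hT₁⟩ := HopfWall.exists_isSkewAntipode k H₁
  have hT₂ := HopfWall.isSkewAntipode_cop (k := k) (H := H₂)
  have hT := hT₁.map hT₂
  refine ⟨HopfWall.BimoduleFunctor.exists_equivalence hT₁ hT₂ hT, ?_, fun _ F _ =>
    HopfWall.FDMod.rightExact_of_isSemisimpleRing F⟩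
  have := HopfWall.ModuleFunctor.isEquivalence_toCovariant (A := B) hT
  exact ⟨(HopfWall.ModuleFunctor.toCovariant k (H₁ ⊗[k] HopfWall.Cop H₂) B).asEquivalence,
    inferInstanceAs (HopfWall.ModuleFunctor.toCovariant k (H₁ ⊗[k] HopfWall.Cop H₂) B).Additive,
    inferInstanceAs ((HopfWall.ModuleFunctor.toCovariant k (H₁ ⊗[k] HopfWall.Cop H₂) B).Linear k),
    ⟨HopfWall.ModuleFunctor.toCovariantCompToLeftModule k (H₁ ⊗[k] HopfWall.Cop H₂) B⟩⟩
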